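/- **Setting.** Let $-\infty<a<b<\infty$, $n,N\in\mathbb N_0$, $\mathcal X=L^2(a,b;\mathbb C^n)$ and $P_k,S_k\in\mathbb C^{n\times n}$ for $k=0,\dots,N$ (put $P_k=S_k=0$ for $k>N$). On $C_c^\infty(a,b;\mathbb C^n)$ define the minimal operators $$\mathcal P_0x=\sum_{k=0}^N\tfrac{d^k}{d\xi^k}P_k^H\tfrac{d^k}{d\xi^k}x,\qquad \mathcal S_0x=\sum_{k=0}^N\tfrac{d^k}{d\xi^k}S_k^H\tfrac{d^k}{d\xi^k}x ,$$ and let $\mathcal P=\mathcal P_0^*$, $\mathcal S=\mathcal S_0^*$ be their Hilbert space adjoints in $\mathcal X$, i.e. $\mathcal P=\sum_k\frac{d^k}{d\xi^k}P_k\frac{d^k}{d\xi^k}$ and $\mathcal S=\sum_k\frac{d^k}{d\xi^k}S_k\frac{d^k}{d\xi^k}$ in the sense of distributions, on their maximal domains in $\mathcal X$. Let $\left[\begin{smallmatrix}\mathcal P\\ \mathcal S\end{smallmatrix}\right]x=(\mathcal Px,\mathcal Sx)$ on $\operatorname{dom}\left[\begin{smallmatrix}\mathcal P\\ \mathcal S\end{smallmatrix}\right]=\operatorname{dom}\mathcal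 P\cap\operatorname{dom}\mathcal S$, let $H=\{(f_1,f_2)\in C_c^\infty(a,b;\mathbb C^n)^2:\mathcal S_0f_1=\mathcal P_0f_2\}\subset\mathcal X\times\mathcal X$, and let $$H^*=\{(g_1,g_2)\in\mathcal X\times\mathcal X:\langle g_2,h_1\rangle=\langle g_1,h_2\rangle\ \text{for all }(h_1,h_2)\in H\}$$ be its adjoint relation. A *boundary triplet* for $\operatorname{ran}\left[\begin{smallmatrix}\mathcal P\\ \mathcal S\end{smallmatrix}\right]$ is a triplet $(\mathcal G,\Gamma_0,\Gamma_1)$ of a Hilbert space $\mathcal G$ and a linear surjective map $\Gamma=\left[\begin{smallmatrix}\Gamma_0\\ \Gamma_1\end{smallmatrix}\right]:\operatorname{dom}\left[\begin{smallmatrix}\mathcal P\\ \mathcal S\end{smallmatrix}\right]\to\mathcal G\times\mathcal G$ such that $$\langle\mathcal Sx,\mathcal Py\rangle-\langle\mathcal Px,\mathcal Sy\rangle=\langle\Gamma_1x,\Gamma_0y\rangle-\langle\Gamma_0x,\Gamma_1y\rangle\quad\text{for all }x,y\in\operatorname{dom}\left[\begin{smallmatrix}\mathcal P\\ \mathcal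 S\end{smallmatrix}\right].$$ Let $\gamma:H^{2N}(a,b;\mathbb C^n)\to\mathbb C^{4Nn}$, $\gamma x=(x(b),x'(b),\dots,x^{(2N-1)}(b),x(a),x'(a),\dots,x^{(2N-1)}(a))$ be the trace operator. For $1\le l\le N$, $0\le k\le l-1$ and odd $m$ with $2l-1\le m\le 2N-1$ let $M_{lkm}\in\mathbb C^{2Nn\times2Nn}$ be the block matrix with $n\times n$ blocks, indexed by $i,j=0,\dots,2N-1$, whose only nonzero blocks are $(-1)^kS_{\frac{m+1}2}^HP_{\frac{m+1-2l}2}$ at $(i,j)=(m-k,\,m+1-2l+k)$ and $(-1)^kS_{\frac{m+1-2l}2}^HP_{\frac{m+1}2}$ at $(i,j)=(m+1-2l+k,\,m-k)$. Put $$B=\Big(\sum_{l=1}^N\sum_{k=0}^{l-1}\ \sum_{\substack{m=2l-1\\ m\text{ odd}}}^{2N-1}M_{lkm}\Big)^H,\qquad A=B-B^H .$$ *Assumption (C):* for all $p=0,\dots,2N$ the matrix $\sum_{m=0}^pS_m^HP_{p-m}$ is Hermitian, and $(P_k,S_l)\neq(0,0)$ for at least one pair $k\neq l$ in $\{0,\dots,N\}$.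 **Theorem.** Suppose that $\left[\begin{smallmatrix}\mathcal P\\ \mathcal S\end{smallmatrix}\right]$ is coercive: there is $c>0$ with $\big(\|\mathcal Px\|^2+\|\mathcal Sx\|^2\big)^{1/2}\ge c\|x\|$ for all $x\in\operatorname{dom}\left[\begin{smallmatrix}\mathcal P\\ \mathcal S\end{smallmatrix}\right]$. Then $\mathcal P_0$ and $\mathcal S_0$ are densely defined with $\left[\begin{smallmatrix}\mathcal P_0^*\\ \mathcal S_0^*\end{smallmatrix}\right]$ coercive, and the following holds. (i) Let Assumption (C) hold and let $H\subset H^*$. Then $H^*=\operatorname{ran}\left[\begin{smallmatrix}\mathcal P\\ \mathcal S\end{smallmatrix}\right]$ and $H^{2N}(a,b;\mathbb C^n)\subset\operatorname{dom}\left[\begin{smallmatrix}\mathcal P\\ \mathcal S\end{smallmatrix}\right]$. With $r=\operatorname{rk}A$, there are $U_{\mathrm r}\in\mathbb C^{2Nn\times r}$ with orthonormal columns and an invertible diagonal matrix $D_{\mathrm r}\in\mathbb C^{r\times r}$ with $A=U_{\mathrm r}D_{\mathrm r}U_{\mathrm r}^H$; and for every such factorization the map $$x\mapsto\frac1{\sqrt2}\begin{bmatrix}D_{\mathrm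 r}&-D_{\mathrm r}\\-I&-I\end{bmatrix}\begin{bmatrix}U_{\mathrm r}^H&0\\0&U_{\mathrm r}^H\end{bmatrix}\gamma x,\qquad x\in H^{2N}(a,b;\mathbb C^n),$$ has exactly one linear extension $\widetilde\Gamma=\left[\begin{smallmatrix}\widetilde\Gamma_0\\ \widetilde\Gamma_1\end{smallmatrix}\right]:\operatorname{dom}\left[\begin{smallmatrix}\mathcal P\\ \mathcal S\end{smallmatrix}\right]\to\mathbb C^r\times\mathbb C^r$ that is bounded with respect to the norm $(\|\mathcal Px\|^2+\|\mathcal Sx\|^2)^{1/2}$, and $(\mathbb C^r,\widetilde\Gamma_0,\widetilde\Gamma_1)$ is a boundary triplet for $H^*=\operatorname{ran}\left[\begin{smallmatrix}\mathcal P\\ \mathcal S\end{smallmatrix}\right]$. (ii) Let Assumption (C) hold and let $\operatorname{rk}A=2Nn$. Then $H^*=\operatorname{ran}\left[\begin{smallmatrix}\mathcal P\\ \mathcal S\end{smallmatrix}\right]$, $\operatorname{dom}\left[\begin{smallmatrix}\mathcal P\\ \mathcal S\end{smallmatrix}\right]=H^{2N}(a,b;\mathbb C^n)$, and $(\mathbb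 C^{2Nn},\Gamma_0,\Gamma_1)$ with $$\Gamma x=\begin{bmatrix}\Gamma_0\\ \Gamma_1\end{bmatrix}x=\frac1{\sqrt2}\begin{bmatrix}A&-A\\-I&-I\end{bmatrix}\gamma x$$ is a boundary triplet for $H^*$. Moreover, $\overline H=\left[\begin{smallmatrix}\mathcal P\\ \mathcal S\end{smallmatrix}\right]H_0^{2N}(a,b;\mathbb C^n)$. -/

import Mathlib

open MeasureTheory Set Matrix
open scoped InnerProductSpace Distributions

noncomputable section

namespace RangeTriplet

/-! ### Abstract setting: pairs of operators, the relations they generate, boundary triplets -/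

section Abstract

variable {X : Type*} [NormedAddCommGroup X] [InnerProductSpace ℂ X]

/-- The domain `dom P ∩ dom S` of the column operator `[P; S]`. -/
def colDomain (P S : X →ₗ.[ℂ] X) : Submodule ℂ X := P.domain ⊓ S.domain

/-- The column operator `[P; S] : dom P ∩ dom S → X × X`, `x ↦ (P x, S x)`. -/
def column (P S : X →ₗ.[ℂ] X) : colDomain P S →ₗ[ℂ] X × X :=
  (P.toFun ∘ₗ Submodule.inclusion inf_le_left).prod
    (S.toFun ∘ₗ Submodule.inclusion inf_le_right)

/-- The Hilbert space norm `(‖P x‖² + ‖S x‖²)^(1/2)` of `[P; S] x` in `X × X`. -/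
def columnNorm (P S : X →ₗ.[ℂ] X) (x : colDomain P S) : ℝ :=
  √(‖(column P S x).1‖ ^ 2 + ‖(column P S x).2‖ ^ 2)

/-- `[P; S]` is coercive: `‖[P; S] x‖ ≥ c ‖x‖` on its domain for some `c > 0`. -/
def IsCoerciveColumn (P S : X →ₗ.[ℂ] X) : Prop :=
  ∃ c : ℝ, 0 < c ∧ ∀ x : colDomain P S, c * ‖(x : X)‖ ≤ columnNorm P S x

/-- The linear relation `ran [P; S] = {(P x, S x) | x ∈ dom P ∩ dom S}`. -/
def ranColumn (P S : X →ₗ.[ℂ] X) : Submodule ℂ (X × X) := LinearMap.range (column P S)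

/-- The standing assumption on two operators `P₀`, `S₀`: they are densely defined and the column
operator of their adjoints is coercive. -/
def StandingAssumption [CompleteSpace X] (P₀ S₀ : X →ₗ.[ℂ] X) : Prop :=
  Dense (P₀.domain : Set X) ∧ Dense (S₀.domain : Set X) ∧
    IsCoerciveColumn P₀.adjoint S₀.adjoint

/-- The linear relation `H = (gr P₀)⁻¹ (gr S₀)`, that is,
`{(f₁, f₂) ∈ dom S₀ × dom P₀ | S₀ f₁ = P₀ f₂}`. Its adjoint relation is `Submodule.adjoint`. -/
def kerRelation (P₀ S₀ : X →ₗ.[ℂ] X) : Submodule ℂ (X × X) where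
  carrier := {f | ∃ f₁ : S₀.domain, ∃ f₂ : P₀.domain,
    f = ((f₁ : X), (f₂ : X)) ∧ S₀ f₁ = P₀ f₂}
  zero_mem' := ⟨0, 0, rfl, by simp⟩
  add_mem' := by
    rintro _ _ ⟨f₁, f₂, rfl, hf⟩ ⟨g₁, g₂, rfl, hg⟩
    exact ⟨f₁ + g₁, f₂ + g₂, rfl, by rw [S₀.map_add, P₀.map_add, hf, hg]⟩
  smul_mem' := by
    rintro c _ ⟨f₁, f₂, rfl, hf⟩
    exact ⟨c • f₁, c • f₂, rfl, by rw [S₀.map_smul, P₀.map_smul, hf]⟩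

/-- `(G, Γ₀, Γ₁)`, with `Γ = (Γ₀, Γ₁)` defined on `dom [P; S]`, is a boundary triplet for
`ran [P; S]`: `Γ` is linear and onto `G × G` and the abstract Green identity holds. -/
structure IsBoundaryTriplet (P S : X →ₗ.[ℂ] X) {G : Type*} [NormedAddCommGroup G]
    [InnerProductSpace ℂ G] [CompleteSpace G] (Γ : colDomain P S →ₗ[ℂ] G × G) : Prop where
  surjective : Function.Surjective Γ
  green : ∀ x y : colDomain P S,
    ⟪(column P S x).2, (column P S y).1⟫_ℂ - ⟪(column P S x).1, (column P S y).2⟫_ℂ =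
      ⟪(Γ x).2, (Γ y).1⟫_ℂ - ⟪(Γ x).1, (Γ y).2⟫_ℂ

end Abstract

/-! ### Function spaces on the interval `(a, b)` -/

/-- The open interval `(a, b)`. -/
def openInterval (a b : ℝ) : TopologicalSpace.Opens ℝ := ⟨Ioo a b, isOpen_Ioo⟩

/-- The Hilbert space `L²(a, b; ℂⁿ)`. -/
abbrev L2 (a b : ℝ) (n : ℕ) : Type :=
  Lp (EuclideanSpace ℂ (Fin n)) 2 (volume.restrict (Ioo a b))

/-- The space `C_c^∞(a, b; ℂⁿ)` of test functions. -/
abbrev Test (a b : ℝ) (n : ℕ) : Type := 𝓓(openInterval a b, EuclideanSpace ℂ (Fin n))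

variable {a b : ℝ} {n : ℕ}

/-- The inclusion `C_c^∞(a, b; ℂⁿ) → L²(a, b; ℂⁿ)`. -/
def testToL2 : Test a b n →ₗ[ℂ] L2 a b n where
  toFun φ := (φ.continuous.memLp_of_hasCompactSupport φ.hasCompactSupport).toLp φ
  map_add' _ _ := rfl
  map_smul' _ _ := rfl

theorem tsupport_iteratedDeriv_subset (j : ℕ) (φ : ℝ → EuclideanSpace ℂ (Fin n)) :
    tsupport (iteratedDeriv j φ) ⊆ tsupport φ := by
  induction j with
  | zero => simp
  | succ j ih =>
    rw [iteratedDeriv_succ]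
    exact tsupport_deriv_subset.trans ih

/-- The classical derivative `φ ↦ φ^(j)` on test functions. -/
def testDeriv (j : ℕ) : Test a b n →ₗ[ℂ] Test a b n where
  toFun φ :=
    { toFun := iteratedDeriv j φ
      contDiff' := by
        rw [iteratedDeriv_eq_iterate]
        exact ContDiff.iterate_deriv j φ.contDiff
      hasCompactSupport' :=
        φ.hasCompactSupport.mono' (subset_closure.trans (tsupport_iteratedDeriv_subset j φ))
      tsupport_subset' := (tsupport_iteratedDeriv_subset j φ).trans φ.tsupport_subset }
  map_add' φ ψ := by
    ext1 t
    exact iteratedDeriv_add (φ.contDiff.of_le (by exact_mod_cast le_top)).contDiffAt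
      (ψ.contDiff.of_le (by exact_mod_cast le_top)).contDiffAt
  map_smul' c φ := by
    ext1 t
    exact iteratedDeriv_const_smul_field c φ

/-- The pointwise action `φ ↦ (ξ ↦ M φ(ξ))` of a matrix on test functions. -/
def testMatrix (M : Matrix (Fin n) (Fin n) ℂ) : Test a b n →ₗ[ℂ] Test a b n :=
  (TestFunction.postcompCLM (Matrix.toEuclideanCLM (𝕜 := ℂ) M)).toLinearMap

theorem testToL2_injective : Function.Injective (testToL2 : Test a b n →ₗ[ℂ] L2 a b n) := by
  intro φ ψ h
  have hae : (φ : ℝ → EuclideanSpace ℂ (Fin n)) =ᵐ[volume.restrict (Ioo a b)] ψ :=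
    (MemLp.toLp_eq_toLp_iff (φ.continuous.memLp_of_hasCompactSupport φ.hasCompactSupport)
      (ψ.continuous.memLp_of_hasCompactSupport ψ.hasCompactSupport)).1 h
  have hon := Measure.eqOn_open_of_ae_eq hae isOpen_Ioo φ.continuous.continuousOn
    ψ.continuous.continuousOn
  ext1 t
  by_cases ht : t ∈ Ioo a b
  · exact hon ht
  · rw [image_eq_zero_of_notMem_tsupport fun h' => ht (φ.tsupport_subset h'),
      image_eq_zero_of_notMem_tsupport fun h' => ht (ψ.tsupport_subset h')]

/-- `y` is the weak derivative of order `j` of `x` on `(a, b)`: for all test functions `φ`,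
`∫ ⟨y, φ⟩ = (-1)^j ∫ ⟨x, φ^(j)⟩`. -/
def IsWeakDeriv (j : ℕ) (x y : L2 a b n) : Prop :=
  ∀ φ : Test a b n, ⟪y, testToL2 φ⟫_ℂ = (-1) ^ j * ⟪x, testToL2 (testDeriv j φ)⟫_ℂ

/-- The space `{(x, x', …, x^(k)) | x ∈ H^k(a, b; ℂⁿ)}`. The topology it inherits from
`L²(a, b; ℂⁿ)^(k+1)` is that of the norm of `H^k(a, b; ℂⁿ)`. -/
def sobolevJets (a b : ℝ) (n k : ℕ) : Submodule ℂ (Fin (k + 1) → L2 a b n) where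
  carrier := {u | ∀ j : Fin (k + 1), IsWeakDeriv j (u 0) (u j)}
  zero_mem' j φ := by simp
  add_mem' := by
    intro u v hu hv j φ
    simp only [Pi.add_apply, inner_add_left, hu j φ, hv j φ, mul_add]
  smul_mem' := by
    intro c u hu j φ
    simp only [Pi.smul_apply, inner_smul_left, hu j φ]
    ring

/-- The Sobolev space `H^k(a, b; ℂⁿ)` of the `x ∈ L²` whose weak derivatives up to order `k`
exist in `L²`. -/
def sobolevSpace (a b : ℝ) (n k : ℕ) : Submodule ℂ (L2 a b n) :=
  (sobolevJets a b n k).map (LinearMap.proj 0)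

/-- The map `φ ↦ (φ, φ', …, φ^(k))` on test functions. -/
def testJet (a b : ℝ) (n k : ℕ) : Test a b n →ₗ[ℂ] (Fin (k + 1) → L2 a b n) :=
  LinearMap.pi fun j => testToL2 ∘ₗ testDeriv (j : ℕ)

/-- The space `H₀^k(a, b; ℂⁿ)`: the closure of `C_c^∞(a, b; ℂⁿ)` with respect to the norm of
`H^k(a, b; ℂⁿ)`. -/
def sobolevSpaceZero (a b : ℝ) (n k : ℕ) : Submodule ℂ (L2 a b n) :=
  (LinearMap.range (testJet a b n k)).topologicalClosure.map (LinearMap.proj 0)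

open Classical in
/-- The weak derivative of order `j` of `x` (and `0` if there is none in `L²`). -/
def weakDeriv (j : ℕ) (x : L2 a b n) : L2 a b n :=
  if h : ∃ y, IsWeakDeriv j x y then h.choose else 0

open Classical in
/-- A representative of `y` that is continuous on `[a, b]` (and `0` if there is none). For
`a < b` its values on `[a, b]` are determined by `y`. -/
def contRep (y : L2 a b n) : ℝ → EuclideanSpace ℂ (Fin n) :=
  if h : ∃ g : ℝ → EuclideanSpace ℂ (Fin n),
      ContinuousOn g (Icc a b) ∧ y =ᵐ[volume.restrict (Ioo a b)] g then h.choose else 0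

/-- The trace operator
`γ x = (x(b), x'(b), …, x^(k-1)(b), x(a), x'(a), …, x^(k-1)(a)) ∈ ℂ^(2kn)` of `H^k(a, b; ℂⁿ)`.
The index `(j, i)` stands for the `i`-th component of the `j`-th derivative; the left summand
holds the values at `b`, the right one those at `a`. -/
def trace (k : ℕ) (x : L2 a b n) : (Fin k × Fin n) ⊕ (Fin k × Fin n) → ℂ :=
  Sum.elim (fun r => contRep (weakDeriv r.1 x) b r.2) (fun r => contRep (weakDeriv r.1 x) a r.2)

/-! ### Matrix differential operators of even order -/

variable {N : ℕ}

/-- `φ ↦ ∑ₖ ∂^k C_k^H ∂^k φ` on test functions. -/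
def testOp (C : Fin (N + 1) → Matrix (Fin n) (Fin n) ℂ) : Test a b n →ₗ[ℂ] Test a b n :=
  ∑ k : Fin (N + 1), testDeriv (k : ℕ) ∘ₗ testMatrix (C k)ᴴ ∘ₗ testDeriv (k : ℕ)

/-- The minimal operator `x ↦ ∑ₖ ∂^k C_k^H ∂^k x` in `L²(a, b; ℂⁿ)` with domain
`C_c^∞(a, b; ℂⁿ)`. -/
def minOp (a b : ℝ) (C : Fin (N + 1) → Matrix (Fin n) (Fin n) ℂ) : L2 a b n →ₗ.[ℂ] L2 a b n where
  domain := LinearMap.range testToL2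
  toFun := testToL2 ∘ₗ testOp C ∘ₗ
    (LinearEquiv.ofInjective testToL2 testToL2_injective).symm.toLinearMap

/-- The operator `x ↦ ∑ₖ ∂^k C_k ∂^k x` in the sense of distributions, on its maximal domain
`{x ∈ L² | ∑ₖ ∂^k C_k ∂^k x ∈ L²}`, as the adjoint of the minimal operator: `z` is its value at
`x` if and only if `⟨z, φ⟩ = ⟨x, ∑ₖ ∂^k C_k^H ∂^k φ⟩` for all test functions `φ`. -/
def maxOp (a b : ℝ) (C : Fin (N + 1) → Matrix (Fin n) (Fin n) ℂ) : L2 a b n →ₗ.[ℂ] L2 a b n :=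
  (minOp a b C).adjoint

/-- The coefficients with the convention `C_m = 0` for `m > N`. -/
def coeff (C : Fin (N + 1) → Matrix (Fin n) (Fin n) ℂ) (m : ℕ) : Matrix (Fin n) (Fin n) ℂ :=
  if h : m < N + 1 then C ⟨m, h⟩ else 0

/-- The assumption on the coefficients: `∑_{m ≤ p} S_m^H P_{p-m}` is Hermitian for all
`p = 0, …, 2N`, and some pair `(P_k, S_l)` with `k ≠ l` is not `(0, 0)`. -/
structure CoeffAssumption (P S : Fin (N + 1) → Matrix (Fin n) (Fin n) ℂ) : Prop where
  symmetric : ∀ p ≤ 2 * N,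
    (∑ m ∈ Finset.range (p + 1), (coeff S m)ᴴ * coeff P (p - m)).IsHermitian
  nontrivial : ∃ k l : Fin (N + 1), k ≠ l ∧ (P k, S l) ≠ (0, 0)

/-- The block matrix `M_{lkm}` with two nonzero blocks. The block index `j = 0, …, 2N - 1`
belongs to the derivative of order `j`. -/
def greenBlock (P S : Fin (N + 1) → Matrix (Fin n) (Fin n) ℂ) (l k m : ℕ) :
    Matrix (Fin (2 * N) × Fin n) (Fin (2 * N) × Fin n) ℂ :=
  Matrix.of fun r s =>
    if (r.1 : ℕ) = m - k ∧ (s.1 : ℕ) = m + 1 - 2 * l + k then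
      (-1) ^ k * ((coeff S ((m + 1) / 2))ᴴ * coeff P ((m + 1 - 2 * l) / 2)) r.2 s.2
    else if (r.1 : ℕ) = m + 1 - 2 * l + k ∧ (s.1 : ℕ) = m - k then
      (-1) ^ k * ((coeff S ((m + 1 - 2 * l) / 2))ᴴ * coeff P ((m + 1) / 2)) r.2 s.2
    else 0

/-- `B = (∑_{l=1}^N ∑_{k=0}^{l-1} ∑_m M_{lkm})^H`, where `m = 2 i - 1` runs through the odd
numbers from `2 l - 1` to `2 N - 1`. -/
def greenB (P S : Fin (N + 1) → Matrix (Fin n) (Fin n) ℂ) :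
    Matrix (Fin (2 * N) × Fin n) (Fin (2 * N) × Fin n) ℂ :=
  (∑ l ∈ Finset.Icc 1 N, ∑ k ∈ Finset.range l, ∑ i ∈ Finset.Icc l N,
    greenBlock P S l k (2 * i - 1))ᴴ

/-- `A = B - B^H`. -/
def greenA (P S : Fin (N + 1) → Matrix (Fin n) (Fin n) ℂ) :
    Matrix (Fin (2 * N) × Fin n) (Fin (2 * N) × Fin n) ℂ :=
  greenB P S - (greenB P S)ᴴ

/-- `A = U D U^H`, where `D = diag d` is invertible of size `rk A` and the columns of `U` are
orthonormal: `d` lists the nonzero eigenvalues of `A`, and the columns of `U` are eigenvectors. -/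
structure IsReducedFactorization {ι : Type*} [Fintype ι] [DecidableEq ι] (A : Matrix ι ι ℂ)
    (U : Matrix ι (Fin A.rank) ℂ) (d : Fin A.rank → ℂ) : Prop where
  orthonormal : Uᴴ * U = 1
  ne_zero : ∀ i, d i ≠ 0
  eq : A = U * Matrix.diagonal d * Uᴴ

/-- The pair `(v₀, v₁)` given by `(1/√2) [D, -D; -I, -I] v`. -/
def boundaryPair {ι : Type*} [Fintype ι] [DecidableEq ι] (D : Matrix ι ι ℂ) (v : ι ⊕ ι → ℂ) :
    EuclideanSpace ℂ ι × EuclideanSpace ℂ ι :=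
  let w : ι ⊕ ι → ℂ := (1 / (√2 : ℂ)) • (Matrix.fromBlocks D (-D) (-1) (-1) *ᵥ v)
  (WithLp.toLp 2 (w ∘ Sum.inl), WithLp.toLp 2 (w ∘ Sum.inr))

/-- `Γ` is a bounded linear extension to `dom [P; S]`, with respect to the norm `‖[P; S] x‖`, of
the boundary map `x ↦ (1/√2) [D, -D; -I, -I] [U^H, 0; 0, U^H] γ x` on `H^{2N}(a, b; ℂⁿ)`, where
`D = diag d`. -/
structure IsTraceExtension (P S : Fin (N + 1) → Matrix (Fin n) (Fin n) ℂ) {r : ℕ}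
    (U : Matrix (Fin (2 * N) × Fin n) (Fin r) ℂ) (d : Fin r → ℂ)
    (Γ : colDomain (maxOp a b P) (maxOp a b S) →ₗ[ℂ]
      EuclideanSpace ℂ (Fin r) × EuclideanSpace ℂ (Fin r)) : Prop where
  bounded : ∃ c : ℝ, ∀ x, ‖Γ x‖ ≤ c * columnNorm (maxOp a b P) (maxOp a b S) x
  extends_trace : ∀ x : colDomain (maxOp a b P) (maxOp a b S),
    (x : L2 a b n) ∈ sobolevSpace a b n (2 * N) →
      Γ x = boundaryPair (Matrix.diagonal d)
        (Matrix.fromBlocks Uᴴ 0 0 Uᴴ *ᵥ trace (2 * N) (x : L2 a b n))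

end RangeTriplet

end

noncomputable section

namespace RangeTriplet

open Polynomial

/-! ### Polynomial matrices -/

section PolynomialMatrices

variable {ι κ : Type*} [Fintype ι]

/-! The operators contain only even derivatives, so the column operator is `M(∂²)` for the
polynomial matrix `M = [P(X); S(X)]` (`colSymbol`), and analytic questions become algebra over the
principal ideal domain `ℂ[X]`. Applied to `x = exp(l t) v` with `l² = μ`, coercivity says that `‖v‖
≤ c ‖M(μ) v‖` with `c` independent of `μ ∈ ℂ` (`exists_symbol_bound`). This has two consequences.
First, `M(μ)` is injective for every `μ`, so `M` has a polynomial left inverse `Q`. Second, let `W`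
be unimodular such that `M W` is column reduced, with column degrees `d_j`; the uniform bound forces
the `j`-th column of `W` to have degree at most `d_j`, so that `W` loses no more derivatives than `M
W` (`exists_reduction`).

Regularity: write `x = W(∂²) y`. If `M(∂²) x` is in `L²` and `x` is a distribution of finite order,
a bootstrap on the column reduced system puts `y_j` in `H^(2 d_j)`, hence `x` in `L²`. Approximating
`y_j^(2 d_j)` by test functions changes `x`, `P x` and `S x` by small amounts in `L²` and makes `x`
smooth enough to lie in `H^(2N)`; thus `H^(2N)` is dense in the domain for the norm of the column
operator (`exists_sobolevSpace_columnNorm_sub_lt`).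

Duality: the Hermitian condition in (C) is the identity `R M = 0` for the row `R = [S~, -P~]`, where
`~` is the formal adjoint. Taking adjoints in `Q M = 1` gives a right inverse of `R`, and a complex
split at both ends is exact: `M Q + Z R = 1` (`exists_exact`). On test functions this gives that `H`
is the image of the test functions under `M(∂²)`. For `g ∈ H*` it follows that `R(∂²) g = 0`, so `u
= Q(∂²) g` solves `M(∂²) u = g`, and regularity puts `u` in `L²` (`adjoint_kerRelation_eq`).

Boundary triplet: integrating `⟨S x, P y⟩` by parts until both factors carry equally many
derivatives leaves a form that is Hermitian by (C), and boundary terms with matrix `B^H`.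
Antisymmetrization gives the Green identity on `H^(2N)` with matrix `A`. Traces are arbitrary by
Hermite interpolation. Pairing with finitely many functions of prescribed traces expresses the
boundary map through `(P x, S x)` continuously (`exists_boundaryMap_eq_column`), so it extends,
uniquely by density, and the Green identity persists.

Full rank: a common null vector of `P_N` and `S_N` would give a null vector of `A`. Hence `M` itself
is column reduced with all column degrees `N`, and the domain is `H^(2N)`. The column operator is
then injective with closed range `H*` on the complete space of jets, so it commutes with closures,
which gives the formula for the closure of `H`. -/

theorem exists_matrix_leftInverse [DecidableEq ι] [Fintype κ] [DecidableEq κ]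
    (A : Matrix κ ι ℂ) (hA : ∀ v, A *ᵥ v = 0 → v = 0) :
    ∃ L : Matrix ι κ ℂ, L * A = 1 := by
  obtain ⟨g, hg⟩ := LinearMap.exists_leftInverse_of_injective (Matrix.toLin' A)
    (LinearMap.ker_eq_bot'.2 fun v hv => hA v (by simpa using hv))
  refine ⟨LinearMap.toMatrix' g, ?_⟩
  rw [← LinearMap.toMatrix'_id, ← hg, LinearMap.toMatrix'_comp, LinearMap.toMatrix'_toLin']

/-- A polynomial matrix that is injective at each point has a polynomial left inverse. -/
theorem exists_polynomial_leftInverse [DecidableEq ι] [Fintype κ] [DecidableEq κ]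
    (M : Matrix κ ι ℂ[X])
    (hM : ∀ μ v, M.map (evalRingHom μ) *ᵥ v = 0 → v = 0) : ∃ Q : Matrix ι κ ℂ[X], Q * M = 1 := by
  -- The ideal of all `f` for which `f • 1` is a left multiple of `M`; the claim is that it contains
  -- `1`.
  let I : Ideal ℂ[X] :=
    { carrier := {f | ∃ Q : Matrix ι κ ℂ[X], Q * M = f • (1 : Matrix ι ι ℂ[X])}
      zero_mem' := ⟨0, by simp⟩
      add_mem' := by
        rintro f g ⟨Q, hQ⟩ ⟨Q', hQ'⟩
        exact ⟨Q + Q', by rw [Matrix.add_mul, hQ, hQ', add_smul]⟩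
      smul_mem' := by
        rintro f g ⟨Q, hQ⟩
        exact ⟨f • Q, by rw [Matrix.smul_mul, hQ, smul_smul, smul_eq_mul]⟩ }
  suffices h : (1 : ℂ[X]) ∈ I by
    obtain ⟨Q, hQ⟩ := h
    exact ⟨Q, by simpa using hQ⟩
  by_contra hne
  obtain ⟨g, hg⟩ := (inferInstance : I.IsPrincipal)
  -- A proper principal ideal over `ℂ` has a generator with a root, also when the generator is zero.
  have hroot : ∃ μ, g.eval μ = 0 := by
    by_cases h0 : g.degree = 0
    · exfalso
      apply hne
      rw [hg]
      exact Ideal.mem_span_singleton.2 (isUnit_iff_degree_eq_zero.2 h0).dvd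
    · exact IsAlgClosed.exists_root g h0
  obtain ⟨μ, hμ⟩ := hroot
  obtain ⟨L, hL⟩ := exists_matrix_leftInverse _ (hM μ)
  -- By the adjugate, the determinant of any `L * M` lies in the ideal. With `L` a left inverse of
  -- `M(μ)` it takes the value `1` at `μ`, where every element of the ideal vanishes.
  have hmem : (L.map C * M).det ∈ I :=
    ⟨(L.map C * M).adjugate * L.map C, by rw [Matrix.mul_assoc, Matrix.adjugate_mul]⟩
  rw [hg] at hmem
  obtain ⟨q, hq⟩ := Ideal.mem_span_singleton.1 hmem
  have h1 : evalRingHom μ (L.map C * M).det = 1 := by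
    rw [RingHom.map_det, RingHom.mapMatrix_apply, Matrix.map_mul, Matrix.map_map]
    have : (evalRingHom μ ∘ C : ℂ → ℂ) = id := by ext; simp
    rw [this, Matrix.map_id, hL, Matrix.det_one]
  rw [hq] at h1
  simp [hμ] at h1

/-- A complex `0 → R^ι → R^(ι ⊕ ι) → R^ι → 0` that is split at both ends is split exact. -/
theorem exists_mul_add_mul_eq_one [DecidableEq ι] {A : Type*} [CommRing A] {M : Matrix (ι ⊕ ι) ι A}
    {R : Matrix ι (ι ⊕ ι) A} {Q : Matrix ι (ι ⊕ ι) A} {Z : Matrix (ι ⊕ ι) ι A}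
    (hQ : Q * M = 1) (hZ : R * Z = 1) (hRM : R * M = 0) :
    ∃ Z' : Matrix (ι ⊕ ι) ι A, M * Q + Z' * R = 1 := by
  refine ⟨(1 - M * Q) * Z, ?_⟩
  -- The sum is the product of the square matrices `[M, Z']` and `[Q; R]`, so it suffices to invert
  -- on the other side. Projecting `Z` along the range of `M` makes `Q Z'` vanish without changing
  -- `R Z = 1`.
  rw [← Matrix.fromCols_mul_fromRows, mul_eq_one_comm, Matrix.fromRows_mul_fromCols, hQ, hRM]
  have h1 : R * ((1 - M * Q) * Z) = 1 := by
    rw [← Matrix.mul_assoc, Matrix.mul_sub, ← Matrix.mul_assoc, hRM]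
    simp [hZ]
  have h2 : Q * ((1 - M * Q) * Z) = 0 := by
    rw [← Matrix.mul_assoc, Matrix.mul_sub, ← Matrix.mul_assoc, hQ]
    simp
  rw [h1, h2, Matrix.fromBlocks_one]

/-- The effect on `M * W` of the elementary column operation used in the reduction; its determinant
is multiplied by `e j₀`, which is why `e j₀` has to be a nonzero constant there. -/
theorem mul_updateCol_sum_apply [DecidableEq ι] (M : Matrix κ ι ℂ[X]) (W : Matrix ι ι ℂ[X])
    (e : ι → ℂ[X])
    (j₀ j : ι) (i : κ) :
    (M * W.updateCol j₀ fun k => ∑ l, e l • W k l) i j =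
      if j = j₀ then ∑ l, e l * (M * W) i l else (M * W) i j := by
  split_ifs with h
  · subst h
    simp only [Matrix.mul_apply, Matrix.updateCol_self, Finset.mul_sum, smul_eq_mul]
    rw [Finset.sum_comm]
    exact Finset.sum_congr rfl fun _ _ => Finset.sum_congr rfl fun _ _ => by ring
  · simp only [Matrix.mul_apply, Matrix.updateCol_ne h]

/-- Column reduction: after multiplication with a unimodular matrix, the matrix of the leading
coefficients of the columns is left invertible. -/
theorem exists_column_reduction [DecidableEq ι] [Fintype κ] [DecidableEq κ]
    (M : Matrix κ ι ℂ[X]) (Q : Matrix ι κ ℂ[X]) (hQ : Q * M = 1) :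
    ∃ (W : Matrix ι ι ℂ[X]) (d : ι → ℕ) (L : Matrix ι κ ℂ), IsUnit W.det ∧
      (∀ i j, ((M * W) i j).natDegree ≤ d j) ∧
      L * (Matrix.of fun i j => ((M * W) i j).coeff (d j)) = 1 := by
  -- The reduction is found by minimizing the sum of the column degree bounds over all unimodular
  -- `W`.
  let s : Set ℕ := {m | ∃ (W : Matrix ι ι ℂ[X]) (d : ι → ℕ), IsUnit W.det ∧
    (∀ i j, ((M * W) i j).natDegree ≤ d j) ∧ ∑ j, d j = m}
  have hs : s.Nonempty := by
    refine ⟨_, 1, fun j => ∑ i, (M i j).natDegree, by simp, fun i j => ?_, rfl⟩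
    rw [Matrix.mul_one]
    exact Finset.single_le_sum (f := fun i => (M i j).natDegree) (fun _ _ => Nat.zero_le _)
      (Finset.mem_univ i)
  obtain ⟨W, d, hW, hd, hsum⟩ := Nat.sInf_mem hs
  obtain ⟨L, hL⟩ : ∃ L : Matrix ι κ ℂ,
      L * (Matrix.of fun i j => ((M * W) i j).coeff (d j)) = 1 := by
    refine exists_matrix_leftInverse _ fun c hc => ?_
    by_contra hc0
    obtain ⟨j₁, hj₁⟩ := Function.ne_iff.1 hc0
    obtain ⟨j₀, hj₀, hmax⟩ := Finset.exists_max_image (Finset.univ.filter fun j => c j ≠ 0) d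
      ⟨j₁, by simpa using hj₁⟩
    simp only [Finset.mem_filter, Finset.mem_univ, true_and] at hj₀ hmax
    have hc' : ∀ i, ∑ j, ((M * W) i j).coeff (d j) * c j = 0 := fun i => congrFun hc i
    let e : ι → ℂ[X] := fun j => C (c j) * X ^ (d j₀ - d j)
    have hcoeff : ∀ i m, d j₀ ≤ m → (∑ l, e l * (M * W) i l).coeff m = 0 := by
      intro i m hm
      rw [finsetSum_coeff]
      have key : ∀ l, (e l * (M * W) i l).coeff m =
          if m = d j₀ then ((M * W) i l).coeff (d l) * c l else 0 := by
        intro l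
        by_cases hl : c l = 0
        · simp [e, hl]
        have hle := hmax l hl
        simp only [e]
        rw [mul_assoc, coeff_C_mul, coeff_X_pow_mul', if_pos (by omega)]
        split_ifs with h
        · rw [h, Nat.sub_sub_self hle, mul_comm]
        · rw [coeff_eq_zero_of_natDegree_lt, mul_zero]
          exact (hd i l).trans_lt (by omega)
      simp only [key]
      split_ifs
      · exact hc' i
      · simp
    -- In degree `0` the cancellation is total and contradicts the left inverse of `M`; otherwise
    -- the degree bound of column `j₀` drops by one, against minimality.
    rcases Nat.eq_zero_or_pos (d j₀) with h0 | hpos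
    · have hz : M *ᵥ (W *ᵥ e) = 0 := by
        rw [Matrix.mulVec_mulVec]
        ext1 i
        ext1 m
        have := hcoeff i m (by omega)
        simp only [Matrix.mulVec, dotProduct, Pi.zero_apply, coeff_zero]
        simpa only [mul_comm] using this
      have hz' : e = 0 := by
        have h1 : W *ᵥ e = 0 := by
          rw [← Matrix.one_mulVec (W *ᵥ e), ← hQ, ← Matrix.mulVec_mulVec, hz, Matrix.mulVec_zero]
        rw [← Matrix.one_mulVec e, ← Matrix.nonsing_inv_mul W hW, ← Matrix.mulVec_mulVec, h1,
          Matrix.mulVec_zero]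
      have := congrFun hz' j₀
      simp [e] at this
      exact hj₀ this
    · have hmem : ∑ j, Function.update d j₀ (d j₀ - 1) j ∈ s := by
        refine ⟨W.updateCol j₀ fun k => ∑ l, e l • W k l, _, ?_, fun i j => ?_, rfl⟩
        · rw [Matrix.det_updateCol_sum]
          refine IsUnit.mul ?_ hW
          simpa [e] using hj₀
        · rw [mul_updateCol_sum_apply]
          split_ifs with h
          · subst h
            rw [Function.update_self, natDegree_le_iff_coeff_eq_zero]
            exact fun m hm => hcoeff i m (by omega)
          · rw [Function.update_of_ne h]
            exact hd i j
      have hlt : ∑ j, Function.update d j₀ (d j₀ - 1) j < ∑ j, d j := by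
        refine Finset.sum_lt_sum (fun j _ => ?_) ⟨j₀, Finset.mem_univ _, ?_⟩
        · by_cases h : j = j₀
          · subst h; simp
          · simp [h]
        · simpa using hpos
      exact absurd (Nat.sInf_le hmem) (by omega)
  exact ⟨W, d, L, hW, hd, hL⟩

/-! ### Degree bounds from uniform estimates. -/

theorem eval_reflect_mul_pow (N : ℕ) (f : ℂ[X]) (hf : f.natDegree ≤ N) {x : ℂ} (hx : x ≠ 0) :
    (reflect N f).eval x = x ^ N * f.eval x⁻¹ := by
  have := invertibleOfNonzero (inv_ne_zero hx)
  have := eval₂_reflect_mul_pow (RingHom.id ℂ) x⁻¹ N f hf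
  rw [invOf_eq_inv, inv_inv] at this
  rw [eval, eval, ← this, mul_comm, mul_assoc, ← mul_pow, inv_mul_cancel₀ hx, one_pow, mul_one]

/-- Growth at infinity is read off at zero: reversing all polynomials at the degree `e` of `w`
preserves the estimate away from `0`. If `e > d`, its limit at `0` bounds the leading coefficient of
`w` by the coefficients of the `t k` in degree `e`, which vanish. -/
theorem natDegree_le_of_norm_eval_le [Fintype κ] {w : ℂ[X]} {t : κ → ℂ[X]} {d : ℕ}
    (ht : ∀ k, (t k).natDegree ≤ d) {c : ℝ}
    (h : ∀ μ, ‖w.eval μ‖ ≤ c * ∑ k, ‖(t k).eval μ‖) : w.natDegree ≤ d := by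
  by_contra! hlt
  set e := w.natDegree with he
  have hle : ∀ x : ℂ, x ≠ 0 →
      ‖(reflect e w).eval x‖ ≤ c * ∑ k, ‖(reflect e (t k)).eval x‖ := by
    intro x hx
    rw [eval_reflect_mul_pow e w he.ge hx]
    simp_rw [eval_reflect_mul_pow e (t _) ((ht _).trans hlt.le) hx, norm_mul, ← Finset.mul_sum]
    have := mul_le_mul_of_nonneg_left (h x⁻¹) (norm_nonneg (x ^ e))
    linarith
  have hc1 : Continuous fun x : ℂ => ‖(reflect e w).eval x‖ := by fun_prop
  have hc2 : Continuous fun x : ℂ => c * ∑ k, ‖(reflect e (t k)).eval x‖ := by fun_prop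
  have h0 := le_of_tendsto_of_tendsto
    ((hc1.tendsto 0).mono_left (nhdsWithin_le_nhds (s := {0}ᶜ)))
    ((hc2.tendsto 0).mono_left (nhdsWithin_le_nhds (s := {0}ᶜ)))
    (Filter.eventually_of_mem self_mem_nhdsWithin fun x hx => hle x hx)
  have h1 : ∀ f : ℂ[X], (reflect e f).eval 0 = f.coeff e := fun f => by
    rw [← coeff_zero_eq_eval_zero, coeff_reflect, revAt_le (Nat.zero_le _), Nat.sub_zero]
  have h2 : ∀ k, (t k).coeff e = 0 := fun k =>
    coeff_eq_zero_of_natDegree_lt ((ht k).trans_lt hlt)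
  simp only [h1, h2, norm_zero, Finset.sum_const_zero, mul_zero, norm_le_zero_iff] at h0
  have hw : w = 0 := leadingCoeff_eq_zero.1 h0
  rw [hw] at he
  simp at he
  omega

/-- The column degrees of the unimodular matrix of a column reduction of `M` are at most those of
the reduced matrix, if `M` is bounded below uniformly on `ℂ`. -/
theorem natDegree_le_of_bounded_below [Fintype κ] {M : Matrix κ ι ℂ[X]} {W : Matrix ι ι ℂ[X]}
    {d : ι → ℕ}
    (hd : ∀ i j, ((M * W) i j).natDegree ≤ d j) {c : ℝ}
    (h : ∀ μ v i, ‖v i‖ ≤ c * ∑ k, ‖(M.map (evalRingHom μ) *ᵥ v) k‖) (i j : ι) :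
    (W i j).natDegree ≤ d j := by
  -- The lower bound is applied to the `j`-th column of `W(μ)`, which `M(μ)` maps to the `j`-th
  -- column of `(M W)(μ)`.
  refine natDegree_le_of_norm_eval_le (t := fun k => (M * W) k j) (fun k => hd k j) (c := c) ?_
  intro μ
  convert h μ (fun i => (W i j).eval μ) i using 5 with k
  simp [Matrix.mul_apply, Matrix.mulVec, dotProduct, eval_finsetSum]

end PolynomialMatrices

/-! ### Test functions, primitives and integration by parts in `L²` -/

section Primitives

variable {a b : ℝ} {n : ℕ}

theorem coeFn_testToL2 (φ : Test a b n) : testToL2 φ =ᵐ[volume.restrict (Ioo a b)] φ :=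
  MemLp.coeFn_toLp (φ.continuous.memLp_of_hasCompactSupport φ.hasCompactSupport)

theorem inner_testToL2_right (x : L2 a b n) (φ : Test a b n) :
    ⟪x, testToL2 φ⟫_ℂ = ∫ t in Ioo a b, ⟪x t, φ t⟫_ℂ := by
  rw [L2.inner_def]
  refine integral_congr_ae ?_
  filter_upwards [coeFn_testToL2 φ] with t ht
  rw [ht]

/-- The test function `g v` for a scalar test function `g` and a vector `v`. -/
def tensorTest (g : ℝ → ℝ) (hg : ContDiff ℝ (⊤ : ℕ∞) g) (hc : HasCompactSupport g)
    (hs : tsupport g ⊆ Ioo a b) (v : EuclideanSpace ℂ (Fin n)) : Test a b n where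
  toFun t := g t • v
  contDiff' := hg.smul contDiff_const
  hasCompactSupport' := hc.smul_right
  tsupport_subset' := (tsupport_smul_subset_left g _).trans hs

theorem integrable_L2 (x : L2 a b n) : Integrable x (volume.restrict (Ioo a b)) :=
  (Lp.memLp x).integrable (by norm_num)

/-- The fundamental lemma of the calculus of variations, applied to each component through test
functions `g e_i` with scalar real `g`. -/
theorem eq_zero_of_inner_test (x : L2 a b n) (h : ∀ φ : Test a b n, ⟪x, testToL2 φ⟫_ℂ = 0) :
    x = 0 := by
  have key : ∀ i : Fin n, ∀ᵐ t ∂volume, t ∈ Ioo a b → (x t) i = 0 := by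
    intro i
    refine isOpen_Ioo.ae_eq_zero_of_integral_contDiff_smul_eq_zero ?_ fun g hg hc hs => ?_
    · have := (integrable_L2 x).eval_piLp i
      exact IntegrableOn.locallyIntegrableOn this
    · have h1 := h (tensorTest g hg hc hs (EuclideanSpace.single i 1))
      rw [inner_testToL2_right] at h1
      have h2 : ∫ t in Ioo a b, (starRingEnd ℂ) (g t • x t i) = 0 := by
        rw [← h1]
        refine integral_congr_ae (Filter.Eventually.of_forall fun t => ?_)
        change _ = ⟪x t, g t • EuclideanSpace.single i (1 : ℂ)⟫_ℂ
        rw [← Complex.coe_smul (g t) (EuclideanSpace.single i (1 : ℂ)), inner_smul_right,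
          EuclideanSpace.inner_single_right]
        simp
      rw [integral_conj, map_eq_zero_iff _ (starRingEnd ℂ).injective] at h2
      rwa [setIntegral_eq_integral_of_forall_compl_eq_zero] at h2
      intro t ht
      rw [image_eq_zero_of_notMem_tsupport fun h' => ht (hs h'), zero_smul]
  rw [Lp.eq_zero_iff_ae_eq_zero]
  have := ae_all_iff.2 key
  filter_upwards [ae_restrict_of_ae this, ae_restrict_mem measurableSet_Ioo] with t ht hm
  ext i
  exact ht i hm

theorem dense_range_testToL2 :
    Dense ((LinearMap.range (testToL2 : Test a b n →ₗ[ℂ] L2 a b n)) : Set (L2 a b n)) := by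
  rw [Submodule.dense_iff_topologicalClosure_eq_top, Submodule.topologicalClosure_eq_top_iff,
    Submodule.eq_bot_iff]
  intro x hx
  exact eq_zero_of_inner_test x fun φ =>
    Submodule.mem_orthogonal' _ _ |>.1 hx _ (LinearMap.mem_range_self _ φ)

theorem denseRange_testToL2 : DenseRange (testToL2 : Test a b n →ₗ[ℂ] L2 a b n) := by
  simpa [DenseRange, LinearMap.coe_range] using dense_range_testToL2 (a := a) (b := b) (n := n)

/-- The primitive `t ↦ ∫_a^t f`. -/
def prim (f : L2 a b n) (t : ℝ) : EuclideanSpace ℂ (Fin n) :=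
  ∫ s in a..t, (Ioo a b).indicator f s

theorem integrable_indicator_L2 (f : L2 a b n) : Integrable ((Ioo a b).indicator f) :=
  (integrable_indicator_iff measurableSet_Ioo).2 (integrable_L2 f)

theorem continuous_prim (f : L2 a b n) : Continuous (prim f) :=
  intervalIntegral.continuous_primitive
    (fun _ _ => (integrable_indicator_L2 f).intervalIntegrable) a

theorem prim_eq_of_ae_eq {f : L2 a b n} {g : ℝ → EuclideanSpace ℂ (Fin n)}
    (h : f =ᵐ[volume.restrict (Ioo a b)] g) (t : ℝ) :
    prim f t = ∫ s in a..t, (Ioo a b).indicator g s := by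
  refine intervalIntegral.integral_congr_ae ?_
  filter_upwards [(ae_restrict_iff' measurableSet_Ioo).1 h] with s hs _
  by_cases hm : s ∈ Ioo a b
  · rw [indicator_of_mem hm, indicator_of_mem hm, hs hm]
  · rw [indicator_of_notMem hm, indicator_of_notMem hm]

theorem prim_add (f g : L2 a b n) (t : ℝ) : prim (f + g) t = prim f t + prim g t := by
  rw [prim_eq_of_ae_eq (Lp.coeFn_add f g), prim, prim, ← intervalIntegral.integral_add
    (integrable_indicator_L2 f).intervalIntegrable (integrable_indicator_L2 g).intervalIntegrable]
  congr 1
  ext1 s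
  rw [indicator_add']
  rfl

theorem prim_smul (c : ℂ) (f : L2 a b n) (t : ℝ) : prim (c • f) t = c • prim f t := by
  rw [prim_eq_of_ae_eq (Lp.coeFn_smul c f), prim, ← intervalIntegral.integral_smul]
  congr 1
  ext1 s
  exact indicator_const_smul_apply _ c _ s

/-- The primitive is bounded by the `L¹` norm, which Hölder's inequality bounds by the `L²` norm on
the bounded interval. -/
theorem exists_norm_prim_le (a b : ℝ) (n : ℕ) :
    ∃ C : ℝ, 0 ≤ C ∧ ∀ (f : L2 a b n) (t : ℝ), ‖prim f t‖ ≤ C * ‖f‖ := by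
  refine ⟨(volume.restrict (Ioo a b) univ ^ ((1 : ℝ) / (1 : ENNReal).toReal -
    1 / (2 : ENNReal).toReal)).toReal, ENNReal.toReal_nonneg, fun f t => ?_⟩
  have h1 : ‖prim f t‖ ≤ ∫ s in Ioo a b, ‖f s‖ := by
    refine intervalIntegral.norm_integral_le_integral_norm_uIoc.trans ?_
    refine (setIntegral_le_integral (integrable_indicator_L2 f).norm
      (Filter.Eventually.of_forall fun _ => norm_nonneg _)).trans ?_
    simp_rw [norm_indicator_eq_indicator_norm]
    rw [integral_indicator measurableSet_Ioo]
  refine h1.trans ?_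
  have h2 := eLpNorm_le_eLpNorm_mul_rpow_measure_univ (p := 1) (q := 2) (by norm_num)
    (Lp.aestronglyMeasurable f)
  rw [integral_norm_eq_lintegral_enorm (Lp.aestronglyMeasurable f), ← eLpNorm_one_eq_lintegral_enorm,
    Lp.norm_def, mul_comm, ← ENNReal.toReal_mul]
  refine ENNReal.toReal_mono (ENNReal.mul_ne_top (Lp.eLpNorm_ne_top f) ?_) h2
  refine ENNReal.rpow_ne_top_of_nonneg (by norm_num) (measure_ne_top _ _)

/-- Evaluation at `t` of the primitive, as a continuous linear map. -/
def primEval (a b : ℝ) (n : ℕ) (t : ℝ) : L2 a b n →L[ℂ] EuclideanSpace ℂ (Fin n) :=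
  LinearMap.mkContinuousOfExistsBound
    { toFun := fun f => prim f t
      map_add' := fun f g => prim_add f g t
      map_smul' := fun c f => prim_smul c f t }
    (let ⟨C, _, hC⟩ := exists_norm_prim_le a b n; ⟨C, fun f => hC f t⟩)

theorem primEval_apply (t : ℝ) (f : L2 a b n) : primEval a b n t f = prim f t := rfl

theorem memLp_of_continuous {g : ℝ → EuclideanSpace ℂ (Fin n)} (hg : Continuous g) :
    MemLp g 2 (volume.restrict (Ioo a b)) := by
  obtain ⟨C, hC⟩ := (isCompact_Icc (a := a) (b := b)).exists_bound_of_continuousOn hg.continuousOn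
  refine MemLp.of_bound hg.aestronglyMeasurable C ?_
  filter_upwards [ae_restrict_mem measurableSet_Ioo] with t ht
  exact hC t (Ioo_subset_Icc_self ht)

/-- The element of `L²` given by a continuous function. -/
def contL2 (a b : ℝ) {n : ℕ} (g : ℝ → EuclideanSpace ℂ (Fin n)) (hg : Continuous g) : L2 a b n :=
  (memLp_of_continuous hg).toLp g

theorem coeFn_contL2 {g : ℝ → EuclideanSpace ℂ (Fin n)} (hg : Continuous g) :
    contL2 a b g hg =ᵐ[volume.restrict (Ioo a b)] g :=
  MemLp.coeFn_toLp _

/-- The operator `f ↦ (t ↦ ∫_a^t f)` on `L²`. -/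
def primL2 (a b : ℝ) (n : ℕ) : L2 a b n →L[ℂ] L2 a b n :=
  LinearMap.mkContinuousOfExistsBound
    { toFun := fun f => contL2 a b (prim f) (continuous_prim f)
      map_add' := fun f g => by
        refine Lp.ext ?_
        filter_upwards [coeFn_contL2 (a := a) (b := b) (continuous_prim f),
          coeFn_contL2 (a := a) (b := b) (continuous_prim g),
          coeFn_contL2 (a := a) (b := b) (continuous_prim (f + g)),
          Lp.coeFn_add (contL2 a b (prim f) (continuous_prim f))
            (contL2 a b (prim g) (continuous_prim g))] with t h1 h2 h3 h4
        rw [h3, h4, Pi.add_apply, h1, h2, prim_add]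
      map_smul' := fun c f => by
        refine Lp.ext ?_
        filter_upwards [coeFn_contL2 (a := a) (b := b) (continuous_prim f),
          coeFn_contL2 (a := a) (b := b) (continuous_prim (c • f)),
          Lp.coeFn_smul c (contL2 a b (prim f) (continuous_prim f))] with t h1 h3 h4
        rw [h3, RingHom.id_apply, h4, Pi.smul_apply, h1, prim_smul] }
    (by
      obtain ⟨C, hC0, hC⟩ := exists_norm_prim_le a b n
      refine ⟨(measureUnivNNReal (volume.restrict (Ioo a b)) : ℝ) ^ (2 : ENNReal).toReal⁻¹ * C,
        fun f => ?_⟩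
      rw [mul_assoc]
      refine Lp.norm_le_of_ae_bound (mul_nonneg hC0 (norm_nonneg f)) ?_
      filter_upwards [coeFn_contL2 (a := a) (b := b) (continuous_prim f)] with t ht
      exact (congrArg norm ht).trans_le (hC f t))

theorem primL2_apply (f : L2 a b n) :
    primL2 a b n f = contL2 a b (prim f) (continuous_prim f) := rfl

/-- The constant functions in `L²`. -/
def constL2 (a b : ℝ) (n : ℕ) : EuclideanSpace ℂ (Fin n) →L[ℂ] L2 a b n :=
  Lp.constL 2 (volume.restrict (Ioo a b)) ℂ

theorem coeFn_constL2 (c : EuclideanSpace ℂ (Fin n)) :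
    constL2 a b n c =ᵐ[volume.restrict (Ioo a b)] fun _ => c :=
  Lp.coeFn_const _ _ c

theorem coeFn_constL2_add_primL2 (c : EuclideanSpace ℂ (Fin n)) (f : L2 a b n) :
    (constL2 a b n c + primL2 a b n f : L2 a b n) =ᵐ[volume.restrict (Ioo a b)]
      fun t => c + prim f t := by
  filter_upwards [Lp.coeFn_add (constL2 a b n c) (primL2 a b n f),
    coeFn_constL2 (a := a) (b := b) c,
    coeFn_contL2 (a := a) (b := b) (continuous_prim f)] with t h1 h2 h3
  rw [h1, Pi.add_apply, h2, primL2_apply, h3]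

theorem prim_testToL2 (φ : Test a b n) (t : ℝ) : prim (testToL2 φ) t = ∫ s in a..t, φ s := by
  rw [prim_eq_of_ae_eq (coeFn_testToL2 φ)]
  congr 1
  ext1 s
  by_cases hs : s ∈ Ioo a b
  · rw [indicator_of_mem hs]
  · rw [indicator_of_notMem hs, image_eq_zero_of_notMem_tsupport fun h => hs (φ.tsupport_subset h)]

theorem hasDerivAt_prim_testToL2 (φ : Test a b n) (t : ℝ) :
    HasDerivAt (prim (testToL2 φ)) (φ t) t := by
  rw [show prim (testToL2 φ) = fun t => ∫ s in a..t, φ s from funext (prim_testToL2 φ)]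
  exact intervalIntegral.integral_hasDerivAt_right (φ.continuous.intervalIntegrable _ _)
    φ.continuous.stronglyMeasurable.stronglyMeasurableAtFilter φ.continuous.continuousAt

theorem prim_left (f : L2 a b n) : prim f a = 0 := intervalIntegral.integral_same

/-- Integration by parts for the absolutely continuous functions `c + ∫ f` and `d + ∫ g`. -/
theorem inner_add_inner_primL2 (hab : a ≤ b) (c d : EuclideanSpace ℂ (Fin n)) (f g : L2 a b n) :
    ⟪f, constL2 a b n d + primL2 a b n g⟫_ℂ + ⟪constL2 a b n c + primL2 a b n f, g⟫_ℂ =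
      ⟪c + prim f b, d + prim g b⟫_ℂ - ⟪c, d⟫_ℂ := by
  simp only [← primEval_apply]
  -- Both sides are continuous in `f` and `g` for the `L²` norm, so the fundamental theorem of
  -- calculus for smooth `f` and `g` suffices.
  induction f using denseRange_testToL2.induction_on with
  | hp => exact isClosed_eq (by fun_prop) (by fun_prop)
  | ih φ =>
  induction g using denseRange_testToL2.induction_on with
  | hp => exact isClosed_eq (by fun_prop) (by fun_prop)
  | ih ψ =>
  simp only [primEval_apply]
  have hu : ∀ t, HasDerivAt (fun t => c + prim (testToL2 φ) t) (φ t) t := fun t =>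
    (hasDerivAt_prim_testToL2 φ t).const_add c
  have hv : ∀ t, HasDerivAt (fun t => d + prim (testToL2 ψ) t) (ψ t) t := fun t =>
    (hasDerivAt_prim_testToL2 ψ t).const_add d
  have hcu : Continuous fun t => c + prim (testToL2 φ) t := continuous_const.add (continuous_prim _)
  have hcv : Continuous fun t => d + prim (testToL2 ψ) t := continuous_const.add (continuous_prim _)
  have hφ := φ.continuous
  have hψ := ψ.continuous
  have key := intervalIntegral.integral_eq_sub_of_hasDerivAt (a := a) (b := b)
    (fun t _ => (hu t).inner ℂ (hv t))
    (Continuous.intervalIntegrable (by fun_prop) _ _)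
  simp only [prim_left, add_zero] at key
  rw [← key, L2.inner_def, L2.inner_def, intervalIntegral.integral_of_le hab,
    integral_Ioc_eq_integral_Ioo, add_comm,
    ← integral_add (L2.integrable_inner _ _) (L2.integrable_inner _ _)]
  refine integral_congr_ae ?_
  filter_upwards [coeFn_testToL2 φ, coeFn_testToL2 ψ, coeFn_constL2_add_primL2 c (testToL2 φ),
    coeFn_constL2_add_primL2 d (testToL2 ψ)] with t h1 h1' h2 h3
  rw [h1, h1', h2, h3]

end Primitives

/-! ### Antilinear functionals on test functions -/

section Distributions

variable {a b : ℝ} {n : ℕ}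

/-- The antilinear functionals on the space of test functions. -/
abbrev Dist (a b : ℝ) (n : ℕ) : Type := Test a b n →ₗ⋆[ℂ] ℂ

/-- The functional `φ ↦ ⟨φ, x⟩` given by `x ∈ L²`. -/
def toDist : L2 a b n →ₗ[ℂ] Dist a b n where
  toFun x :=
    { toFun := fun φ => ⟪testToL2 φ, x⟫_ℂ
      map_add' := fun φ ψ => by rw [map_add, inner_add_left]
      map_smul' := fun c φ => by rw [map_smul, inner_smul_left, smul_eq_mul] }
  map_add' x y := by ext φ; exact inner_add_right (𝕜 := ℂ) (testToL2 φ) x y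
  map_smul' c x := by ext φ; exact inner_smul_right (𝕜 := ℂ) (testToL2 φ) x c

theorem toDist_apply (x : L2 a b n) (φ : Test a b n) : toDist x φ = ⟪testToL2 φ, x⟫_ℂ := rfl

theorem toDist_injective : Function.Injective (toDist : L2 a b n →ₗ[ℂ] Dist a b n) := by
  refine (injective_iff_map_eq_zero _).2 fun x hx => eq_zero_of_inner_test x fun φ => ?_
  rw [← inner_conj_symm, ← toDist_apply, hx, LinearMap.zero_apply, map_zero]

/-- The distributional derivative. -/
def distDeriv : Dist a b n →ₗ[ℂ] Dist a b n where
  toFun Λ := -(Λ ∘ₛₗ testDeriv 1)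
  map_add' Λ Λ' := by ext φ; simp; ring
  map_smul' c Λ := by ext φ; simp

theorem distDeriv_apply (Λ : Dist a b n) (φ : Test a b n) :
    distDeriv Λ φ = -Λ (testDeriv 1 φ) := rfl

theorem testDeriv_zero_apply (φ : Test a b n) : testDeriv 0 φ = φ := by
  ext1 t
  rfl

theorem coe_testDeriv (j : ℕ) (φ : Test a b n) :
    (testDeriv j φ : ℝ → EuclideanSpace ℂ (Fin n)) = iteratedDeriv j φ := rfl

theorem testDeriv_add_apply (i j : ℕ) (φ : Test a b n) :
    testDeriv (i + j) φ = testDeriv i (testDeriv j φ) := by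
  ext1 t
  rw [coe_testDeriv, coe_testDeriv, coe_testDeriv, iteratedDeriv_eq_iterate,
    iteratedDeriv_eq_iterate, iteratedDeriv_eq_iterate, Function.iterate_add_apply]

theorem hasDerivAt_test (φ : Test a b n) (t : ℝ) : HasDerivAt φ (testDeriv 1 φ t) t := by
  rw [coe_testDeriv, iteratedDeriv_one]
  exact ((φ.contDiff.differentiable (by simp)) t).hasDerivAt

theorem distDeriv_pow_apply (j : ℕ) (Λ : Dist a b n) (φ : Test a b n) :
    (distDeriv ^ j) Λ φ = (-1) ^ j * Λ (testDeriv j φ) := by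
  induction j generalizing φ with
  | zero => simp [testDeriv_zero_apply]
  | succ j ih =>
    rw [pow_succ', Module.End.mul_apply, distDeriv_apply, ih, ← testDeriv_add_apply, pow_succ]
    ring

theorem isWeakDeriv_iff (j : ℕ) (x y : L2 a b n) :
    IsWeakDeriv j x y ↔ (distDeriv ^ j) (toDist x) = toDist y := by
  rw [IsWeakDeriv, LinearMap.ext_iff]
  refine forall_congr' fun φ => ?_
  rw [distDeriv_pow_apply, toDist_apply, toDist_apply,
    ← (starRingEnd ℂ).injective.eq_iff, map_mul, inner_conj_symm, inner_conj_symm, eq_comm]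
  simp

theorem test_eq_zero_of_notMem (φ : Test a b n) {t : ℝ} (ht : t ∉ Ioo a b) : φ t = 0 :=
  image_eq_zero_of_notMem_tsupport fun h => ht (φ.tsupport_subset h)

theorem prim_testDeriv (φ : Test a b n) (t : ℝ) : prim (testToL2 (testDeriv 1 φ)) t = φ t := by
  rw [prim_testToL2, intervalIntegral.integral_eq_sub_of_hasDerivAt
    (fun t _ => hasDerivAt_test φ t) ((testDeriv 1 φ).continuous.intervalIntegrable _ _),
    test_eq_zero_of_notMem φ (t := a) (by simp), sub_zero]

theorem primL2_testDeriv (φ : Test a b n) :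
    primL2 a b n (testToL2 (testDeriv 1 φ)) = testToL2 φ := by
  refine Lp.ext ?_
  filter_upwards [coeFn_testToL2 φ,
    coeFn_contL2 (a := a) (b := b) (continuous_prim (testToL2 (testDeriv 1 φ)))] with t h1 h2
  rw [h1, primL2_apply, h2, prim_testDeriv]

theorem distDeriv_constL2_add_primL2 (hab : a ≤ b) (c : EuclideanSpace ℂ (Fin n)) (f : L2 a b n) :
    distDeriv (toDist (constL2 a b n c + primL2 a b n f)) = toDist f := by
  ext φ
  have h := inner_add_inner_primL2 hab 0 c (testToL2 (testDeriv 1 φ)) f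
  rw [map_zero, zero_add, primL2_testDeriv, prim_testDeriv, test_eq_zero_of_notMem φ (by simp),
    add_zero, inner_zero_left, inner_zero_left, sub_zero] at h
  rw [distDeriv_apply, toDist_apply, toDist_apply]
  linear_combination -h

theorem distDeriv_primL2 (hab : a ≤ b) (f : L2 a b n) :
    distDeriv (toDist (primL2 a b n f)) = toDist f := by
  simpa using distDeriv_constL2_add_primL2 hab 0 f

theorem distDeriv_toDist_testToL2 (hab : a ≤ b) (φ : Test a b n) :
    distDeriv (toDist (testToL2 φ)) = toDist (testToL2 (testDeriv 1 φ)) := by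
  rw [← primL2_testDeriv, distDeriv_primL2 hab]

/-- Evaluation of test functions at a point. -/
def testEval (a b : ℝ) (n : ℕ) (t : ℝ) : Test a b n →ₗ[ℂ] EuclideanSpace ℂ (Fin n) where
  toFun φ := φ t
  map_add' _ _ := rfl
  map_smul' _ _ := rfl

/-- The primitive from `a` vanishes to the left of the support of `ψ`, and by the zero mean also to
its right; hence it is a test function. -/
theorem exists_testDeriv_eq (ψ : Test a b n) (h : ∫ t in a..b, ψ t = 0) :
    ∃ φ : Test a b n, testDeriv 1 φ = ψ := by
  obtain ⟨α, β, haα, hβb, hsub⟩ : ∃ α β, a < α ∧ β < b ∧ tsupport ψ ⊆ Icc α β := by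
    rcases (tsupport ψ).eq_empty_or_nonempty with h0 | h0
    · exact ⟨a + 1, b - 1, by linarith, by linarith, by simp [h0]⟩
    · obtain ⟨α, hα, hα'⟩ := ψ.hasCompactSupport.isCompact.exists_isLeast h0
      obtain ⟨β, hβ, hβ'⟩ := ψ.hasCompactSupport.isCompact.exists_isGreatest h0
      exact ⟨α, β, (ψ.tsupport_subset hα).1, (ψ.tsupport_subset hβ).2,
        fun t ht => ⟨hα' ht, hβ' ht⟩⟩
  have hz : ∀ t, t ∉ Icc α β → ψ t = 0 := fun t ht =>
    image_eq_zero_of_notMem_tsupport fun h => ht (hsub h)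
  set F : ℝ → EuclideanSpace ℂ (Fin n) := fun t => ∫ s in a..t, ψ s with hF
  have hd : ∀ t, HasDerivAt F (ψ t) t := fun t =>
    intervalIntegral.integral_hasDerivAt_right (ψ.continuous.intervalIntegrable _ _)
      ψ.continuous.stronglyMeasurable.stronglyMeasurableAtFilter ψ.continuous.continuousAt
  have hderiv : deriv F = ψ := funext fun t => (hd t).deriv
  have hsupp : Function.support F ⊆ Icc α β := by
    intro t ht
    by_contra hn
    apply ht
    rcases lt_or_ge t α with h1 | h1
    · refine (intervalIntegral.integral_congr fun s hs => ?_).trans intervalIntegral.integral_zero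
      refine hz s fun hs' => ?_
      rcases le_total a t with h2 | h2
      · rw [uIcc_of_le h2] at hs; linarith [hs.2, hs'.1]
      · rw [uIcc_of_ge h2] at hs; linarith [hs.2, hs'.1]
    · have h2 : β < t := lt_of_not_ge fun h2 => hn ⟨h1, h2⟩
      -- The zero mean allows the primitive to be started at `b` instead of `a`.
      have h3 : F t = ∫ s in b..t, ψ s := by
        rw [hF, ← sub_zero (∫ s in b..t, ψ s), ← neg_zero, sub_neg_eq_add, ← h, add_comm]
        exact (intervalIntegral.integral_add_adjacent_intervals
          (ψ.continuous.intervalIntegrable _ _) (ψ.continuous.intervalIntegrable _ _)).symm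
      rw [h3]
      refine (intervalIntegral.integral_congr fun s hs => ?_).trans intervalIntegral.integral_zero
      refine hz s fun hs' => ?_
      rcases le_total b t with h2 | h2
      · rw [uIcc_of_le h2] at hs; linarith [hs.1, hs'.2]
      · rw [uIcc_of_ge h2] at hs; linarith [hs.1, hs'.2]
  refine ⟨⟨F, ?_, HasCompactSupport.of_support_subset_isCompact isCompact_Icc hsupp, ?_⟩, ?_⟩
  · refine contDiff_infty_iff_deriv.2 ⟨fun t => (hd t).differentiableAt, ?_⟩
    rw [hderiv]
    exact ψ.contDiff
  · refine (closure_minimal hsupp isClosed_Icc).trans fun t ht => ?_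
    exact ⟨haα.trans_le ht.1, ht.2.trans_lt hβb⟩
  · ext1 t
    rw [coe_testDeriv, iteratedDeriv_one]
    exact (hd t).deriv

theorem exists_bump (hab : a < b) : ∃ g : ℝ → ℝ, ContDiff ℝ (⊤ : ℕ∞) g ∧ HasCompactSupport g ∧
    tsupport g ⊆ Ioo a b ∧ ∫ t, g t = 1 := by
  let f : ContDiffBump ((a + b) / 2) := ⟨(b - a) / 8, (b - a) / 4, by linarith, by linarith⟩
  refine ⟨f.normed volume, f.contDiff_normed, f.hasCompactSupport_normed, ?_, f.integral_normed⟩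
  rw [f.tsupport_normed_eq, Real.closedBall_eq_Icc]
  change Icc ((a + b) / 2 - (b - a) / 4) ((a + b) / 2 + (b - a) / 4) ⊆ Ioo a b
  intro t ht
  exact ⟨by linarith [ht.1], by linarith [ht.2]⟩

theorem inner_testToL2_constL2 (hab : a ≤ b) (φ : Test a b n) (c : EuclideanSpace ℂ (Fin n)) :
    ⟪testToL2 φ, constL2 a b n c⟫_ℂ = ⟪∫ t in a..b, φ t, c⟫_ℂ := by
  have h := inner_add_inner_primL2 hab 0 c (testToL2 φ) 0
  simp only [map_zero, add_zero, zero_add, inner_zero_right, inner_zero_left, sub_zero] at h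
  rw [h, prim_testToL2]
  have : prim (0 : L2 a b n) b = 0 := (primEval a b n b).map_zero
  rw [this, add_zero]

/-- With a bump `g` of integral one, each `ψ` differs from `g ∫ψ` by a function of mean zero, which
is a derivative and is killed by `Λ`. So `Λ` depends only on `∫ψ`, and the constant is given by its
values on the `g e_i`. -/
theorem exists_constL2_of_distDeriv_eq_zero (hab : a < b) (Λ : Dist a b n)
    (h : distDeriv Λ = 0) : ∃ c, Λ = toDist (constL2 a b n c) := by
  obtain ⟨g, hg, hc, hs, hint⟩ := exists_bump hab
  let e : Fin n → Test a b n := fun i => tensorTest g hg hc hs (EuclideanSpace.single i 1)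
  refine ⟨WithLp.toLp 2 fun i => Λ (e i), ?_⟩
  ext ψ
  set v := ∫ t in a..b, ψ t with hv
  have hcomb : ∫ t in a..b, (ψ - ∑ i, v i • e i) t = 0 := by
    have h1 : ∀ t, (ψ - ∑ i, v i • e i) t = ψ t - g t • v := by
      intro t
      have : (∑ i, v i • e i) t = g t • v := by
        have h2 : v = ∑ i, v i • EuclideanSpace.single i (1 : ℂ) := by
          ext j
          simp [Pi.single_apply]
        conv_rhs => rw [h2]
        rw [Finset.smul_sum]
        change testEval a b n t _ = _
        rw [map_sum]
        refine Finset.sum_congr rfl fun i _ => ?_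
        rw [map_smul, smul_comm]
        rfl
      rw [← this]; rfl
    simp_rw [h1]
    rw [intervalIntegral.integral_sub (ψ.continuous.intervalIntegrable _ _)
      (Continuous.intervalIntegrable (by have := hg.continuous; fun_prop) _ _),
      intervalIntegral.integral_smul_const, ← hv]
    have h3 : ∫ t in a..b, g t = 1 := by
      rw [intervalIntegral.integral_of_le hab.le, integral_Ioc_eq_integral_Ioo,
        setIntegral_eq_integral_of_forall_compl_eq_zero, hint]
      exact fun t ht => image_eq_zero_of_notMem_tsupport fun h => ht (hs h)
    rw [h3, one_smul, sub_self]
  obtain ⟨φ, hφ⟩ := exists_testDeriv_eq _ hcomb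
  have h4 : Λ (ψ - ∑ i, v i • e i) = 0 := by
    rw [← hφ, ← neg_eq_zero, ← distDeriv_apply, h, LinearMap.zero_apply]
  rw [toDist_apply, inner_testToL2_constL2 hab.le, ← hv]
  rw [map_sub, map_sum, sub_eq_zero] at h4
  rw [h4, PiLp.inner_apply]
  refine Finset.sum_congr rfl fun i _ => ?_
  rw [LinearMap.map_smulₛₗ]
  simp [mul_comm]

theorem exists_of_distDeriv_eq_toDist (hab : a < b) (Λ : Dist a b n) (f : L2 a b n)
    (h : distDeriv Λ = toDist f) : ∃ c, Λ = toDist (constL2 a b n c + primL2 a b n f) := by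
  obtain ⟨c, hc⟩ := exists_constL2_of_distDeriv_eq_zero hab (Λ - toDist (primL2 a b n f))
    (by rw [map_sub, distDeriv_primL2 hab.le, h, sub_self])
  exact ⟨c, by rw [map_add, ← hc, sub_add_cancel]⟩

/-! ### The scale of Sobolev spaces of integer order -/

/-- The Sobolev space of order `m ∈ ℤ`: the functionals whose `m`-th derivative is in `L²` for
`m ≥ 0`, and the `|m|`-th derivatives of `L²`-functions for `m < 0`. -/
def sobolevScale (a b : ℝ) (n : ℕ) : ℤ → Submodule ℂ (Dist a b n)
  | Int.ofNat k => (LinearMap.range toDist).comap (distDeriv ^ k)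
  | Int.negSucc k => (LinearMap.range toDist).map (distDeriv ^ (k + 1))

theorem sobolevScale_natCast (k : ℕ) :
    sobolevScale a b n k = (LinearMap.range toDist).comap (distDeriv ^ k) := rfl

theorem sobolevScale_zero : sobolevScale a b n 0 = LinearMap.range toDist := by
  rw [← Nat.cast_zero, sobolevScale_natCast]
  ext; simp

theorem sobolevScale_neg_natCast (k : ℕ) :
    sobolevScale a b n (-k) = (LinearMap.range toDist).map (distDeriv ^ k) := by
  cases k with
  | zero => rw [Nat.cast_zero, neg_zero, sobolevScale_zero]; ext; simp
  | succ k => rfl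

theorem range_toDist_le_map (hab : a < b) (k : ℕ) :
    LinearMap.range (toDist : L2 a b n →ₗ[ℂ] _) ≤
      (LinearMap.range toDist).map (distDeriv ^ k) := by
  rintro _ ⟨x, rfl⟩
  induction k generalizing x with
  | zero => exact ⟨toDist x, ⟨x, rfl⟩, by simp⟩
  | succ k ih =>
    obtain ⟨_, ⟨y, rfl⟩, hy⟩ := ih x
    exact ⟨_, ⟨primL2 a b n y, rfl⟩, by
      rw [pow_succ, Module.End.mul_apply, distDeriv_primL2 hab.le, hy]⟩

/-- For nonnegative `m` this is the definition. For negative `m`, two distributions with equal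
derivatives differ by a constant, and constants lie in every space of negative order. -/
theorem mem_sobolevScale_add_one_iff (hab : a < b) (m : ℤ) (Λ : Dist a b n) :
    Λ ∈ sobolevScale a b n (m + 1) ↔ distDeriv Λ ∈ sobolevScale a b n m := by
  obtain ⟨k, rfl | rfl⟩ := m.eq_nat_or_neg
  · rw [← Nat.cast_succ, sobolevScale_natCast, sobolevScale_natCast, Submodule.mem_comap,
      Submodule.mem_comap, Nat.succ_eq_add_one, pow_succ, Module.End.mul_apply]
  cases k with
  | zero =>
    rw [Nat.cast_zero, neg_zero, zero_add, sobolevScale_zero, ← Nat.cast_one, sobolevScale_natCast,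
      Submodule.mem_comap, pow_one]
  | succ k =>
    rw [Nat.cast_succ, neg_add_rev, add_comm, add_neg_cancel_left, sobolevScale_neg_natCast,
      ← neg_add_rev, ← Nat.cast_succ, sobolevScale_neg_natCast]
    constructor
    · rintro ⟨x, hx, rfl⟩
      exact ⟨x, hx, by rw [Nat.succ_eq_add_one, pow_succ', Module.End.mul_apply]⟩
    · rintro ⟨x, hx, hxΛ⟩
      rw [Nat.succ_eq_add_one, pow_succ', Module.End.mul_apply, eq_comm, ← sub_eq_zero,
        ← map_sub] at hxΛ
      obtain ⟨c, hc⟩ := exists_constL2_of_distDeriv_eq_zero hab _ hxΛ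
      rw [sub_eq_iff_eq_add] at hc
      rw [hc]
      exact add_mem (range_toDist_le_map hab k ⟨_, rfl⟩) ⟨x, hx, rfl⟩

/-- At order zero, a distribution with derivative `f ∈ L²` is `c + ∫ f`, again in `L²`. Positive
orders reduce to this by differentiation, and at negative orders an `L²` function is replaced by its
primitive. -/
theorem sobolevScale_add_one_le (hab : a < b) (m : ℤ) :
    sobolevScale a b n (m + 1) ≤ sobolevScale a b n m := by
  obtain ⟨k, rfl | rfl⟩ := m.eq_nat_or_neg
  · induction k with
    | zero =>
      intro Λ hΛ
      rw [Nat.cast_zero] at hΛ ⊢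
      rw [mem_sobolevScale_add_one_iff hab, sobolevScale_zero] at hΛ
      obtain ⟨f, hf⟩ := hΛ
      obtain ⟨c, hc⟩ := exists_of_distDeriv_eq_toDist hab Λ f hf.symm
      rw [sobolevScale_zero, hc]
      exact ⟨_, rfl⟩
    | succ k ih =>
      intro Λ hΛ
      rw [mem_sobolevScale_add_one_iff hab] at hΛ
      rw [Nat.cast_succ] at hΛ ⊢
      rw [mem_sobolevScale_add_one_iff hab]
      exact ih hΛ
  · cases k with
    | zero =>
      intro Λ hΛ
      rw [Nat.cast_zero, neg_zero] at hΛ ⊢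
      rw [mem_sobolevScale_add_one_iff hab, sobolevScale_zero] at hΛ
      obtain ⟨f, hf⟩ := hΛ
      obtain ⟨c, hc⟩ := exists_of_distDeriv_eq_toDist hab Λ f hf.symm
      rw [sobolevScale_zero, hc]
      exact ⟨_, rfl⟩
    | succ k =>
      rw [Nat.cast_succ, neg_add_rev, add_comm, add_neg_cancel_left, sobolevScale_neg_natCast,
        ← neg_add_rev, ← Nat.cast_succ, sobolevScale_neg_natCast]
      rintro _ ⟨_, ⟨x, rfl⟩, rfl⟩
      exact ⟨_, ⟨primL2 a b n x, rfl⟩, by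
        rw [Nat.succ_eq_add_one, pow_succ, Module.End.mul_apply, distDeriv_primL2 hab.le]⟩

theorem sobolevScale_antitone (hab : a < b) : Antitone (sobolevScale a b n) :=
  antitone_int_of_succ_le (sobolevScale_add_one_le hab)

theorem mem_sobolevScale_add_natCast_iff (hab : a < b) (m : ℤ) (k : ℕ) (Λ : Dist a b n) :
    Λ ∈ sobolevScale a b n (m + k) ↔ (distDeriv ^ k) Λ ∈ sobolevScale a b n m := by
  induction k generalizing Λ with
  | zero => simp
  | succ k ih =>
    rw [Nat.cast_succ, ← add_assoc, mem_sobolevScale_add_one_iff hab, ih, pow_succ,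
      Module.End.mul_apply]

theorem distDeriv_pow_primL2_pow (hab : a < b) (k : ℕ) (f : L2 a b n) :
    (distDeriv ^ k) (toDist ((primL2 a b n ^ k) f)) = toDist f := by
  induction k with
  | zero => simp
  | succ k ih =>
    rw [pow_succ, Module.End.mul_apply, pow_succ' (primL2 a b n), mul_apply_eq_comp,
      distDeriv_primL2 hab.le, ih]

end Distributions

/-! ### Pointwise linear maps -/

section Pointwise

variable {a b : ℝ} {n m l : ℕ}

/-- The pointwise action of a linear map on `L²`. -/
def mapL2 (a b : ℝ) (T : EuclideanSpace ℂ (Fin n) →L[ℂ] EuclideanSpace ℂ (Fin m)) :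
    L2 a b n →L[ℂ] L2 a b m :=
  T.compLpL 2 (volume.restrict (Ioo a b))

theorem coeFn_mapL2 (T : EuclideanSpace ℂ (Fin n) →L[ℂ] EuclideanSpace ℂ (Fin m)) (x : L2 a b n) :
    mapL2 a b T x =ᵐ[volume.restrict (Ioo a b)] fun t => T (x t) :=
  ContinuousLinearMap.coeFn_compLpL T x

theorem mapL2_mapL2 (T : EuclideanSpace ℂ (Fin m) →L[ℂ] EuclideanSpace ℂ (Fin l))
    (U : EuclideanSpace ℂ (Fin n) →L[ℂ] EuclideanSpace ℂ (Fin m)) (x : L2 a b n) :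
    mapL2 a b T (mapL2 a b U x) = mapL2 a b (T ∘L U) x := by
  refine Lp.ext ?_
  filter_upwards [coeFn_mapL2 T (mapL2 a b U x), coeFn_mapL2 U x, coeFn_mapL2 (T ∘L U) x]
    with t h1 h2 h3
  rw [h1, h2, h3]
  rfl

theorem mapL2_id (x : L2 a b n) : mapL2 a b (ContinuousLinearMap.id ℂ _) x = x := by
  refine Lp.ext ?_
  filter_upwards [coeFn_mapL2 (ContinuousLinearMap.id ℂ _) x] with t h1
  rw [h1]
  rfl

theorem mapL2_zero (x : L2 a b n) :
    mapL2 a b (0 : EuclideanSpace ℂ (Fin n) →L[ℂ] EuclideanSpace ℂ (Fin m)) x = 0 := by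
  refine Lp.ext ?_
  filter_upwards [coeFn_mapL2 (0 : EuclideanSpace ℂ (Fin n) →L[ℂ] EuclideanSpace ℂ (Fin m)) x,
    Lp.coeFn_zero (EuclideanSpace ℂ (Fin m)) 2 (volume.restrict (Ioo a b))] with t h1 h2
  rw [h1, h2]
  rfl

theorem mapL2_add (T U : EuclideanSpace ℂ (Fin n) →L[ℂ] EuclideanSpace ℂ (Fin m)) (x : L2 a b n) :
    mapL2 a b (T + U) x = mapL2 a b T x + mapL2 a b U x := by
  rw [mapL2, ContinuousLinearMap.add_compLpL]
  rfl

theorem mapL2_smul (c : ℂ) (T : EuclideanSpace ℂ (Fin n) →L[ℂ] EuclideanSpace ℂ (Fin m))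
    (x : L2 a b n) : mapL2 a b (c • T) x = c • mapL2 a b T x := by
  rw [mapL2, ContinuousLinearMap.smul_compLpL]
  rfl

theorem mapL2_sum {ι : Type*} (s : Finset ι)
    (T : ι → EuclideanSpace ℂ (Fin n) →L[ℂ] EuclideanSpace ℂ (Fin m)) (x : L2 a b n) :
    mapL2 a b (∑ i ∈ s, T i) x = ∑ i ∈ s, mapL2 a b (T i) x := by
  classical
  induction s using Finset.induction_on with
  | empty => simp [mapL2_zero]
  | insert i s hi ih => rw [Finset.sum_insert hi, Finset.sum_insert hi, mapL2_add, ih]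

theorem inner_mapL2_left (T : EuclideanSpace ℂ (Fin n) →L[ℂ] EuclideanSpace ℂ (Fin m))
    (x : L2 a b n) (y : L2 a b m) :
    ⟪mapL2 a b T x, y⟫_ℂ = ⟪x, mapL2 a b (ContinuousLinearMap.adjoint T) y⟫_ℂ := by
  rw [L2.inner_def, L2.inner_def]
  refine integral_congr_ae ?_
  filter_upwards [coeFn_mapL2 T x, coeFn_mapL2 (ContinuousLinearMap.adjoint T) y] with t h1 h2
  rw [h1, h2, ContinuousLinearMap.adjoint_inner_right]

/-- The pointwise action of a linear map on test functions. -/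
def mapTest (a b : ℝ) (T : EuclideanSpace ℂ (Fin n) →L[ℂ] EuclideanSpace ℂ (Fin m)) :
    Test a b n →ₗ[ℂ] Test a b m :=
  (TestFunction.postcompCLM T).toLinearMap

theorem mapTest_apply (T : EuclideanSpace ℂ (Fin n) →L[ℂ] EuclideanSpace ℂ (Fin m))
    (φ : Test a b n) (t : ℝ) : mapTest a b T φ t = T (φ t) := by
  change (TestFunction.postcompCLM T φ) t = _
  rw [TestFunction.postcompCLM_apply]
  rfl

theorem mapL2_testToL2 (T : EuclideanSpace ℂ (Fin n) →L[ℂ] EuclideanSpace ℂ (Fin m))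
    (φ : Test a b n) : mapL2 a b T (testToL2 φ) = testToL2 (mapTest a b T φ) := by
  refine Lp.ext ?_
  filter_upwards [coeFn_mapL2 T (testToL2 φ), coeFn_testToL2 φ, coeFn_testToL2 (mapTest a b T φ)]
    with t h1 h2 h3
  rw [h1, h2, h3, mapTest_apply]

theorem testDeriv_mapTest (j : ℕ) (T : EuclideanSpace ℂ (Fin n) →L[ℂ] EuclideanSpace ℂ (Fin m))
    (φ : Test a b n) : testDeriv j (mapTest a b T φ) = mapTest a b T (testDeriv j φ) := by
  induction j generalizing φ with
  | zero => rw [testDeriv_zero_apply, testDeriv_zero_apply]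
  | succ j ih =>
    rw [testDeriv_add_apply, testDeriv_add_apply, ← ih]
    congr 1
    ext1 t
    have h1 : HasDerivAt (mapTest a b T φ) (T (testDeriv 1 φ t)) t := by
      have := (T.restrictScalars ℝ).hasFDerivAt.comp_hasDerivAt t (hasDerivAt_test φ t)
      rwa [show (T.restrictScalars ℝ ∘ φ : ℝ → EuclideanSpace ℂ (Fin m)) = mapTest a b T φ from
        funext fun s => (mapTest_apply T φ s).symm] at this
    rw [mapTest_apply]
    exact (hasDerivAt_test _ t).unique h1

/-- The coordinate `v ↦ v i`. -/
def coordE (i : Fin n) : EuclideanSpace ℂ (Fin n) →L[ℂ] EuclideanSpace ℂ (Fin 1) :=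
  LinearMap.toContinuousLinearMap
    { toFun := fun v => WithLp.toLp 2 fun _ => v i
      map_add' := fun _ _ => rfl
      map_smul' := fun _ _ => rfl }

theorem coordE_apply (i : Fin n) (v : EuclideanSpace ℂ (Fin n)) (k : Fin 1) :
    coordE i v k = v i := rfl

/-- The inclusion of the `i`-th coordinate. -/
def inclE (i : Fin n) : EuclideanSpace ℂ (Fin 1) →L[ℂ] EuclideanSpace ℂ (Fin n) :=
  ContinuousLinearMap.adjoint (coordE i)

theorem inclE_apply (i j : Fin n) (v : EuclideanSpace ℂ (Fin 1)) :
    inclE i v j = if j = i then v 0 else 0 := by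
  have h := ContinuousLinearMap.adjoint_inner_right (coordE i) (EuclideanSpace.single j (1 : ℂ)) v
  rw [EuclideanSpace.inner_single_left, map_one, one_mul] at h
  rw [inclE, h, PiLp.inner_apply, Fin.sum_univ_one, coordE_apply]
  by_cases hij : j = i
  · simp [hij]
  · simp [hij, Ne.symm hij]

theorem coordE_comp_inclE (i j : Fin n) :
    coordE i ∘L inclE j = if i = j then ContinuousLinearMap.id ℂ _ else 0 := by
  ext v k
  rw [Subsingleton.elim k 0]
  simp only [ContinuousLinearMap.comp_apply, coordE_apply, inclE_apply]
  split_ifs <;> rfl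

theorem sum_inclE_comp_coordE :
    ∑ i : Fin n, inclE i ∘L coordE i = ContinuousLinearMap.id ℂ _ := by
  ext v k
  simp [inclE_apply, coordE_apply]

theorem mapL2_coordE_inclE (i j : Fin n) (x : L2 a b 1) :
    mapL2 a b (coordE i) (mapL2 a b (inclE j) x) = if i = j then x else 0 := by
  rw [mapL2_mapL2, coordE_comp_inclE]
  split_ifs
  · exact mapL2_id x
  · exact mapL2_zero x

theorem sum_mapL2_inclE_coordE (x : L2 a b n) :
    ∑ i, mapL2 a b (inclE i) (mapL2 a b (coordE i) x) = x := by
  simp_rw [mapL2_mapL2]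
  rw [← mapL2_sum, sum_inclE_comp_coordE, mapL2_id]

theorem mapTest_coordE_inclE (i j : Fin n) (φ : Test a b 1) :
    mapTest a b (coordE i) (mapTest a b (inclE j) φ) = if i = j then φ else 0 := by
  apply testToL2_injective
  rw [← mapL2_testToL2, ← mapL2_testToL2, mapL2_coordE_inclE]
  split_ifs
  · rfl
  · rw [map_zero]

theorem sum_mapTest_inclE_coordE (φ : Test a b n) :
    ∑ i, mapTest a b (inclE i) (mapTest a b (coordE i) φ) = φ := by
  apply testToL2_injective
  simp only [map_sum, ← mapL2_testToL2]
  exact sum_mapL2_inclE_coordE _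

/-- The components of an element of `L²(a, b; ℂⁿ)` as distributions. -/
def vecDist : L2 a b n →ₗ[ℂ] (Fin n → Dist a b 1) :=
  LinearMap.pi fun i => toDist ∘ₗ (mapL2 a b (coordE i)).toLinearMap

theorem vecDist_apply (x : L2 a b n) (i : Fin n) :
    vecDist x i = toDist (mapL2 a b (coordE i) x) := rfl

theorem vecDist_injective : Function.Injective (vecDist : L2 a b n →ₗ[ℂ] _) := by
  intro x y h
  rw [← sum_mapL2_inclE_coordE x, ← sum_mapL2_inclE_coordE y]
  exact Finset.sum_congr rfl fun i _ => congrArg _ (toDist_injective (congrFun h i))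

theorem exists_vecDist_eq (u : Fin n → Dist a b 1) (h : ∀ i, u i ∈ LinearMap.range toDist) :
    ∃ x : L2 a b n, vecDist x = u := by
  choose f hf using h
  refine ⟨∑ j, mapL2 a b (inclE j) (f j), ?_⟩
  ext1 i
  rw [vecDist_apply, map_sum]
  simp_rw [mapL2_coordE_inclE]
  rw [Finset.sum_ite_eq Finset.univ i, if_pos (Finset.mem_univ i), hf]

/-- The components of a test function. -/
def vecTest : Test a b n →ₗ[ℂ] (Fin n → Test a b 1) :=
  LinearMap.pi fun i => mapTest a b (coordE i)

theorem vecTest_apply (φ : Test a b n) (i : Fin n) : vecTest φ i = mapTest a b (coordE i) φ := rfl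

theorem vecTest_injective : Function.Injective (vecTest : Test a b n →ₗ[ℂ] _) := by
  intro x y h
  rw [← sum_mapTest_inclE_coordE x, ← sum_mapTest_inclE_coordE y]
  exact Finset.sum_congr rfl fun i _ => congrArg _ (congrFun h i)

theorem exists_vecTest_eq (u : Fin n → Test a b 1) : ∃ φ : Test a b n, vecTest φ = u := by
  refine ⟨∑ j, mapTest a b (inclE j) (u j), ?_⟩
  ext1 i
  rw [vecTest_apply, map_sum]
  simp_rw [mapTest_coordE_inclE]
  rw [Finset.sum_ite_eq Finset.univ i, if_pos (Finset.mem_univ i)]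

theorem vecDist_testToL2 (φ : Test a b n) (i : Fin n) :
    vecDist (testToL2 φ) i = toDist (testToL2 (vecTest φ i)) := by
  rw [vecDist_apply, mapL2_testToL2, vecTest_apply]

theorem inner_testToL2_left (φ : Test a b n) (x : L2 a b n) :
    ⟪testToL2 φ, x⟫_ℂ = ∑ i, vecDist x i (vecTest φ i) := by
  conv_lhs => rw [← sum_mapTest_inclE_coordE φ, map_sum, sum_inner]
  refine Finset.sum_congr rfl fun i _ => ?_
  rw [← mapL2_testToL2, inner_mapL2_left, inclE, ContinuousLinearMap.adjoint_adjoint]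
  rfl

end Pointwise

/-! ### Polynomial matrices acting on vectors with entries in a module -/

section PolyAct

variable {V V' : Type*} [AddCommGroup V] [Module ℂ V] [AddCommGroup V'] [Module ℂ V']
variable {ι κ θ : Type*}

/-- The action of a polynomial matrix on vectors, where `X` acts as the endomorphism `δ`. -/
def polyAct [Fintype ι] (δ : Module.End ℂ V) (M : Matrix κ ι ℂ[X]) : (ι → V) →ₗ[ℂ] (κ → V) :=
  LinearMap.pi fun i => ∑ j, aeval δ (M i j) ∘ₗ LinearMap.proj j

theorem polyAct_apply [Fintype ι] (δ : Module.End ℂ V) (M : Matrix κ ι ℂ[X]) (u : ι → V) (i : κ) :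
    polyAct δ M u i = ∑ j, aeval δ (M i j) (u j) := by
  simp [polyAct]

theorem polyAct_mul [Fintype ι] [Fintype κ] (δ : Module.End ℂ V) (M : Matrix θ κ ℂ[X]) (N : Matrix κ ι ℂ[X])
    (u : ι → V) : polyAct δ (M * N) u = polyAct δ M (polyAct δ N u) := by
  ext1 i
  simp only [polyAct_apply, Matrix.mul_apply, map_sum, LinearMap.sum_apply, map_mul,
    Module.End.mul_apply]
  rw [Finset.sum_comm]

theorem polyAct_one [Fintype ι] [DecidableEq ι] (δ : Module.End ℂ V) (u : ι → V) :
    polyAct δ (1 : Matrix ι ι ℂ[X]) u = u := by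
  ext1 i
  rw [polyAct_apply, Finset.sum_eq_single i]
  · simp
  · intro j _ hj
    simp [Matrix.one_apply_ne hj.symm]
  · simp

theorem polyAct_add [Fintype ι] (δ : Module.End ℂ V) (M N : Matrix κ ι ℂ[X]) (u : ι → V) :
    polyAct δ (M + N) u = polyAct δ M u + polyAct δ N u := by
  ext1 i
  simp [polyAct_apply, Finset.sum_add_distrib]

theorem polyAct_zero [Fintype ι] (δ : Module.End ℂ V) (u : ι → V) :
    polyAct δ (0 : Matrix κ ι ℂ[X]) u = 0 := by
  ext1 i
  simp [polyAct_apply]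

theorem map_aeval_of_intertwine {δ : Module.End ℂ V} {δ' : Module.End ℂ V'} (f : V →ₗ[ℂ] V')
    (h : ∀ v, f (δ v) = δ' (f v)) (p : ℂ[X]) (v : V) : f (aeval δ p v) = aeval δ' p (f v) := by
  induction p using Polynomial.induction_on' generalizing v with
  | add p q hp hq => simp [hp, hq]
  | monomial k c =>
    have hk : ∀ v, f ((δ ^ k) v) = (δ' ^ k) (f v) := by
      intro v
      induction k generalizing v with
      | zero => simp
      | succ k ih => rw [pow_succ, pow_succ, Module.End.mul_apply, Module.End.mul_apply, ih, h]
    simp [aeval_monomial, hk]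

theorem map_polyAct_of_intertwine [Fintype ι] {δ : Module.End ℂ V} {δ' : Module.End ℂ V'} (f : V →ₗ[ℂ] V')
    (h : ∀ v, f (δ v) = δ' (f v)) (M : Matrix κ ι ℂ[X]) (u : ι → V) (i : κ) :
    f (polyAct δ M u i) = polyAct δ' M (fun j => f (u j)) i := by
  simp only [polyAct_apply, map_sum, map_aeval_of_intertwine f h]

/-- The entrywise conjugate transpose of a polynomial matrix, with `X` real. -/
def conjTr (M : Matrix κ ι ℂ[X]) : Matrix ι κ ℂ[X] :=
  Mᵀ.map (mapRingHom (starRingEnd ℂ))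

theorem conjTr_apply (M : Matrix κ ι ℂ[X]) (i : ι) (j : κ) :
    conjTr M i j = (M j i).map (starRingEnd ℂ) := rfl

theorem conjTr_mul [Fintype κ] (M : Matrix θ κ ℂ[X]) (N : Matrix κ ι ℂ[X]) :
    conjTr (M * N) = conjTr N * conjTr M := by
  rw [conjTr, Matrix.transpose_mul, Matrix.map_mul]
  rfl

theorem conjTr_add (M N : Matrix κ ι ℂ[X]) : conjTr (M + N) = conjTr M + conjTr N := by
  ext1 i j
  simp [conjTr_apply]

theorem conjTr_one [DecidableEq ι] : conjTr (1 : Matrix ι ι ℂ[X]) = 1 := by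
  rw [conjTr, Matrix.transpose_one, Matrix.map_one _ (map_zero _) (map_one _)]

end PolyAct

/-! ### The maximal operators -/

section MaxOp

variable {a b : ℝ} {n N : ℕ}

/-- The symbol `∑ₖ C_k X^k`, where `X` stands for the second derivative. -/
def symbol (C : Fin (N + 1) → Matrix (Fin n) (Fin n) ℂ) : Matrix (Fin n) (Fin n) ℂ[X] :=
  Matrix.of fun i j => ∑ k : Fin (N + 1), monomial (k : ℕ) (C k i j)

theorem symbol_apply (C : Fin (N + 1) → Matrix (Fin n) (Fin n) ℂ) (i j : Fin n) :
    symbol C i j = ∑ k : Fin (N + 1), monomial (k : ℕ) (C k i j) := rfl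

theorem conjTr_symbol (C : Fin (N + 1) → Matrix (Fin n) (Fin n) ℂ) :
    conjTr (symbol C) = symbol fun k => (C k)ᴴ := by
  ext1 i j
  simp [conjTr_apply, symbol_apply, Polynomial.map_sum, Polynomial.map_monomial]

theorem natDegree_symbol_le (C : Fin (N + 1) → Matrix (Fin n) (Fin n) ℂ) (i j : Fin n) :
    (symbol C i j).natDegree ≤ N := by
  rw [symbol_apply]
  refine natDegree_sum_le_of_forall_le Finset.univ _ fun k _ => (natDegree_monomial_le (C k i j)).trans ?_
  omega

/-- The second derivative of distributions. -/
abbrev distD2 (a b : ℝ) : Module.End ℂ (Dist a b 1) := distDeriv ^ 2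

/-- The second derivative of test functions. -/
abbrev testD2 (a b : ℝ) : Module.End ℂ (Test a b 1) := testDeriv 2

theorem testD2_pow_apply (k : ℕ) (φ : Test a b 1) : (testD2 a b ^ k) φ = testDeriv (2 * k) φ := by
  induction k generalizing φ with
  | zero => rw [Nat.mul_zero, testDeriv_zero_apply]; rfl
  | succ k ih => rw [pow_succ, Module.End.mul_apply, ih, ← testDeriv_add_apply, Nat.mul_succ]

theorem toDist_testToL2_testD2 (hab : a ≤ b) (φ : Test a b 1) :
    toDist (testToL2 (testD2 a b φ)) = distD2 a b (toDist (testToL2 φ)) := by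
  change _ = distDeriv (distDeriv _)
  rw [distDeriv_toDist_testToL2 hab, distDeriv_toDist_testToL2 hab,
    ← testDeriv_add_apply]

/-- Two integrations by parts produce no sign. The coefficients are conjugated because the
functionals are antilinear. -/
theorem aeval_distD2_apply (p : ℂ[X]) (Λ : Dist a b 1) (φ : Test a b 1) :
    aeval (distD2 a b) p Λ φ = Λ (aeval (testD2 a b) (p.map (starRingEnd ℂ)) φ) := by
  induction p using Polynomial.induction_on' with
  | add p q hp hq => simp [hp, hq]
  | monomial k c =>
    rw [Polynomial.map_monomial, aeval_monomial, aeval_monomial, Module.End.mul_apply,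
      Module.End.mul_apply, Module.algebraMap_end_apply, Module.algebraMap_end_apply,
      LinearMap.map_smulₛₗ, LinearMap.smul_apply, starRingEnd_self_apply, testD2_pow_apply,
      ← pow_mul, distDeriv_pow_apply, pow_mul]
    simp

/-- The formal adjoint of a matrix differential operator in `∂²` has the symbol `conjTr M`. -/
theorem sum_polyAct_apply {ι κ : Type*} [Fintype ι] [Fintype κ] (M : Matrix κ ι ℂ[X])
    (u : ι → Dist a b 1) (φ : κ → Test a b 1) :
    ∑ i, polyAct (distD2 a b) M u i (φ i) = ∑ j, u j (polyAct (testD2 a b) (conjTr M) φ j) := by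
  simp only [polyAct_apply, LinearMap.sum_apply, aeval_distD2_apply, map_sum, conjTr_apply]
  exact Finset.sum_comm

theorem vecTest_testOp (C : Fin (N + 1) → Matrix (Fin n) (Fin n) ℂ) (φ : Test a b n) :
    vecTest (testOp C φ) = polyAct (testD2 a b) (symbol fun k => (C k)ᴴ) (vecTest φ) := by
  have hmat : ∀ (A : Matrix (Fin n) (Fin n) ℂ) (ψ : Test a b n) (i : Fin n),
      vecTest (testMatrix A ψ) i = ∑ j, A i j • vecTest ψ j := by
    intro A ψ i
    ext1 t
    change _ = testEval a b 1 t _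
    rw [map_sum, vecTest_apply, mapTest_apply]
    ext k
    change ((testMatrix A ψ) t) i = _
    change (mapTest a b (Matrix.toEuclideanCLM (𝕜 := ℂ) A) ψ t) i = _
    rw [mapTest_apply, Matrix.ofLp_toEuclideanCLM]
    simp only [WithLp.ofLp_sum, Finset.sum_apply, Matrix.mulVec, dotProduct]
    refine Finset.sum_congr rfl fun j _ => ?_
    change _ = (A i j • (mapTest a b (coordE j) ψ) t) k
    rw [mapTest_apply]
    rfl
  have hder : ∀ (j : ℕ) (ψ : Test a b n) (i : Fin n),
      vecTest (testDeriv j ψ) i = testDeriv j (vecTest ψ i) := fun j ψ i => by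
    rw [vecTest_apply, vecTest_apply, testDeriv_mapTest]
  ext1 i
  rw [polyAct_apply, testOp, LinearMap.sum_apply, map_sum, Finset.sum_apply]
  simp only [symbol_apply, map_sum, LinearMap.sum_apply]
  rw [Finset.sum_comm]
  refine Finset.sum_congr rfl fun k _ => ?_
  rw [LinearMap.comp_apply, LinearMap.comp_apply, hder, hmat, map_sum]
  refine Finset.sum_congr rfl fun j _ => ?_
  rw [map_smul, hder, ← testDeriv_add_apply, aeval_monomial, Module.End.mul_apply,
    testD2_pow_apply, two_mul]
  rfl

theorem dense_minOp_domain (C : Fin (N + 1) → Matrix (Fin n) (Fin n) ℂ) :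
    Dense ((minOp a b C).domain : Set (L2 a b n)) := dense_range_testToL2

theorem minOp_apply (C : Fin (N + 1) → Matrix (Fin n) (Fin n) ℂ) (φ : Test a b n)
    (h : testToL2 φ ∈ (minOp a b C).domain) :
    minOp a b C ⟨testToL2 φ, h⟩ = testToL2 (testOp C φ) := by
  change testToL2 (testOp C ((LinearEquiv.ofInjective testToL2 testToL2_injective).symm
    ⟨testToL2 φ, h⟩)) = _
  congr 2
  rw [LinearEquiv.symm_apply_eq]
  rfl

/-- The graph of the maximal operator. -/
theorem maxOp_graph_iff (C : Fin (N + 1) → Matrix (Fin n) (Fin n) ℂ) (x z : L2 a b n) :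
    (∃ h : x ∈ (maxOp a b C).domain, maxOp a b C ⟨x, h⟩ = z) ↔
      polyAct (distD2 a b) (symbol C) (vecDist x) = vecDist z := by
  have hint : ∀ φ : Test a b n, ∑ i, polyAct (distD2 a b) (symbol C) (vecDist x) i (vecTest φ i) =
      ⟪testToL2 (testOp C φ), x⟫_ℂ := fun φ => by
    rw [sum_polyAct_apply, conjTr_symbol, ← vecTest_testOp, inner_testToL2_left]
  have hsymm : ∀ (φ : Test a b n), (⟪z, testToL2 φ⟫_ℂ = ⟪x, testToL2 (testOp C φ)⟫_ℂ ↔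
      ⟪testToL2 φ, z⟫_ℂ = ⟪testToL2 (testOp C φ), x⟫_ℂ) := fun φ => by
    rw [← inner_conj_symm z, ← inner_conj_symm x, (starRingEnd ℂ).injective.eq_iff]
  constructor
  · rintro ⟨h, rfl⟩
    ext i φ
    -- A test function with only one nonzero component isolates the `i`-th row.
    obtain ⟨Φ, hΦ⟩ := exists_vecTest_eq (Pi.single i φ)
    have h1 := (hsymm Φ).1
      ((LinearPMap.adjoint_isFormalAdjoint (dense_minOp_domain C) ⟨x, h⟩
        ⟨testToL2 Φ, ⟨Φ, rfl⟩⟩).trans (congrArg (inner ℂ x) (minOp_apply C Φ ⟨Φ, rfl⟩)))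
    rw [inner_testToL2_left, ← hint, hΦ, Finset.sum_eq_single i, Finset.sum_eq_single i] at h1
    · simpa using h1.symm
    all_goals simp +contextual
  · intro h
    have key : ∀ v : (minOp a b C).domain, ⟪z, v⟫_ℂ = ⟪x, minOp a b C v⟫_ℂ := by
      rintro ⟨_, φ, rfl⟩
      refine ((hsymm φ).2 ?_).trans (congrArg (inner ℂ x) (minOp_apply C φ ⟨φ, rfl⟩)).symm
      rw [inner_testToL2_left, ← hint, h]
    have hx := LinearPMap.mem_adjoint_domain_of_exists x ⟨z, key⟩
    exact ⟨hx, LinearPMap.adjoint_apply_eq (dense_minOp_domain C) ⟨x, hx⟩ key⟩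

end MaxOp

/-! ### Regularity for column reduced systems -/

section Regularity

variable {a b : ℝ} {n N : ℕ} {ι κ : Type*} [Fintype ι]

theorem distD2_pow_mem_sobolevScale (hab : a < b) {m : ℤ} (k : ℕ) {Λ : Dist a b 1}
    (hΛ : Λ ∈ sobolevScale a b 1 m) : (distD2 a b ^ k) Λ ∈ sobolevScale a b 1 (m - 2 * k) := by
  rw [← pow_mul, ← mem_sobolevScale_add_natCast_iff hab]
  convert hΛ using 2
  push_cast
  ring

theorem aeval_distD2_eq_sum {p : ℂ[X]} {d : ℕ} (hp : p.natDegree ≤ d) (Λ : Dist a b 1) :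
    aeval (distD2 a b) p Λ = ∑ k ∈ Finset.range (d + 1), p.coeff k • (distD2 a b ^ k) Λ := by
  rw [aeval_eq_sum_range' (Nat.lt_succ_of_le hp), LinearMap.sum_apply]
  rfl

theorem aeval_distD2_mem_sobolevScale (hab : a < b) {p : ℂ[X]} {d : ℕ} (hp : p.natDegree ≤ d)
    {m : ℤ} {Λ : Dist a b 1} (hΛ : Λ ∈ sobolevScale a b 1 m) :
    aeval (distD2 a b) p Λ ∈ sobolevScale a b 1 (m - 2 * d) := by
  rw [aeval_distD2_eq_sum hp]
  refine Submodule.sum_mem _ fun k hk => Submodule.smul_mem _ _ ?_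
  refine sobolevScale_antitone hab ?_ (distD2_pow_mem_sobolevScale hab k hΛ)
  have := Finset.mem_range.1 hk
  omega

theorem exists_polyAct_mem_sobolevScale [Fintype κ] (hab : a < b) (M : Matrix κ ι ℂ[X]) {K : ℕ}
    {u : ι → Dist a b 1} (hu : ∀ i, u i ∈ sobolevScale a b 1 (-(2 * K))) :
    ∃ K' : ℕ, ∀ i, polyAct (distD2 a b) M u i ∈ sobolevScale a b 1 (-(2 * K')) := by
  let e := ∑ i, ∑ j, (M i j).natDegree
  refine ⟨K + e, fun i => ?_⟩
  rw [polyAct_apply]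
  refine Submodule.sum_mem _ fun j _ => ?_
  have hdeg : (M i j).natDegree ≤ e :=
    (Finset.single_le_sum (f := fun j => (M i j).natDegree) (fun _ _ => Nat.zero_le _)
      (Finset.mem_univ j)).trans (Finset.single_le_sum
        (f := fun i => ∑ j, (M i j).natDegree) (fun _ _ => Nat.zero_le _) (Finset.mem_univ i))
  convert aeval_distD2_mem_sobolevScale hab hdeg (hu j) using 2
  push_cast
  ring

/-- A distributional solution of finite order of a column reduced system with right-hand side in
`L²` has the regularity given by the column degrees. -/
theorem mem_sobolevScale_of_columnReduced [Fintype κ] [DecidableEq ι] (hab : a < b)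
    {T : Matrix κ ι ℂ[X]} {d : ι → ℕ} {L : Matrix ι κ ℂ}
    (hd : ∀ i j, (T i j).natDegree ≤ d j)
    (hL : L * (Matrix.of fun i j => (T i j).coeff (d j)) = 1) {y : ι → Dist a b 1}
    (hT : ∀ k, polyAct (distD2 a b) T y k ∈ sobolevScale a b 1 0) (K : ℕ)
    (hy : ∀ j, y j ∈ sobolevScale a b 1 (2 * d j - 2 * K)) (j : ι) :
    y j ∈ sobolevScale a b 1 (2 * d j) := by
  induction K generalizing j with
  | zero => simpa using hy j
  | succ K ih =>
    -- Each pass of the bootstrap gains two orders. Multiplication by `L` isolates the top terms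
    -- `∂^(2 d_i) y_i`; the others apply at most `d_j - 1` second derivatives to `y_j` and therefore
    -- lie in the space of order `-2K`, as does the right-hand side.
    refine ih (fun i => ?_) j
    have h1 : ∑ k, L i k • polyAct (distD2 a b) T y k ∈ sobolevScale a b 1 (-(2 * K)) :=
      Submodule.sum_mem _ fun k _ =>
        Submodule.smul_mem _ _ (sobolevScale_antitone hab (by omega) (hT k))
    have h2 : ∑ k, L i k • polyAct (distD2 a b) T y k =
        ∑ j, (∑ k, L i k * (T k j).coeff (d j)) • (distD2 a b ^ d j) (y j) +
          ∑ j, ∑ k, ∑ m ∈ Finset.range (d j), (L i k * (T k j).coeff m) •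
            (distD2 a b ^ m) (y j) := by
      simp only [polyAct_apply, Finset.smul_sum, Finset.sum_smul]
      rw [Finset.sum_comm, ← Finset.sum_add_distrib]
      refine Finset.sum_congr rfl fun j _ => ?_
      rw [← Finset.sum_add_distrib]
      refine Finset.sum_congr rfl fun k _ => ?_
      rw [aeval_distD2_eq_sum (hd k j), Finset.sum_range_succ, smul_add, Finset.smul_sum, add_comm]
      simp only [smul_smul]
    have h3 : ∑ j, (∑ k, L i k * (T k j).coeff (d j)) • (distD2 a b ^ d j) (y j) =
        (distD2 a b ^ d i) (y i) := by
      have h4 : ∀ j, ∑ k, L i k * (T k j).coeff (d j) = if i = j then 1 else 0 := fun j => by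
        have := congrFun (congrFun hL i) j
        rwa [Matrix.mul_apply, Matrix.one_apply] at this
      simp [h4]
    have h5 : ∑ j, ∑ k, ∑ m ∈ Finset.range (d j), (L i k * (T k j).coeff m) •
        (distD2 a b ^ m) (y j) ∈ sobolevScale a b 1 (-(2 * K)) := by
      refine Submodule.sum_mem _ fun j _ => Submodule.sum_mem _ fun k _ =>
        Submodule.sum_mem _ fun m hm => Submodule.smul_mem _ _ ?_
      refine sobolevScale_antitone hab ?_ (distD2_pow_mem_sobolevScale hab m (hy j))
      have := Finset.mem_range.1 hm
      push_cast
      omega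
    rw [h2, h3] at h1
    have h6 := (Submodule.add_mem_iff_left _ h5).1 h1
    rw [← pow_mul, ← mem_sobolevScale_add_natCast_iff hab] at h6
    convert h6 using 2
    push_cast
    ring

/-- The operator `w(∂²) J^(2d)` on `L²` for a polynomial `w` of degree at most `d`, where `J` is
the integration operator. -/
def liftL2 (a b : ℝ) (w : ℂ[X]) (d : ℕ) : L2 a b 1 →L[ℂ] L2 a b 1 :=
  ∑ k ∈ Finset.range (d + 1), w.coeff k • primL2 a b 1 ^ (2 * (d - k))

/-- Since `k ≤ d`, `∂^(2k)` cancels `2k` of the `2d` integrations, which leaves a bounded operator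
on `L²`. -/
theorem toDist_liftL2 (hab : a < b) {w : ℂ[X]} {d : ℕ} (hw : w.natDegree ≤ d) (h : L2 a b 1) :
    toDist (liftL2 a b w d h) =
      aeval (distD2 a b) w (toDist ((primL2 a b 1 ^ (2 * d)) h)) := by
  rw [aeval_distD2_eq_sum hw, liftL2, _root_.sum_apply, map_sum]
  refine Finset.sum_congr rfl fun k hk => ?_
  have hk' : 2 * d = 2 * k + 2 * (d - k) := by
    have := Finset.mem_range.1 hk
    omega
  rw [_root_.smul_apply, map_smul, hk', pow_add, mul_apply_eq_comp, ← pow_mul,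
    distDeriv_pow_primL2_pow hab]

end Regularity

/-! ### Smooth functions -/

section Smooth

variable {a b : ℝ} {n : ℕ}

theorem prim_contL2 {f f' : ℝ → EuclideanSpace ℂ (Fin n)} (hf : ∀ t, HasDerivAt f (f' t) t)
    (hf' : Continuous f') {t : ℝ} (ht : t ∈ Ioo a b) :
    prim (contL2 a b f' hf') t = f t - f a := by
  rw [prim_eq_of_ae_eq (coeFn_contL2 hf'), ← intervalIntegral.integral_eq_sub_of_hasDerivAt
    (fun t _ => hf t) (hf'.intervalIntegrable _ _)]
  refine intervalIntegral.integral_congr_ae (Filter.Eventually.of_forall fun s hs => ?_)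
  rw [uIoc_of_le ht.1.le] at hs
  exact indicator_of_mem (show s ∈ Ioo a b from ⟨hs.1, hs.2.trans_lt ht.2⟩) _

theorem distDeriv_contL2 (hab : a ≤ b) {f f' : ℝ → EuclideanSpace ℂ (Fin n)} (hc : Continuous f)
    (hf : ∀ t, HasDerivAt f (f' t) t) (hf' : Continuous f') :
    distDeriv (toDist (contL2 a b f hc)) = toDist (contL2 a b f' hf') := by
  rw [← distDeriv_constL2_add_primL2 hab (f a) (contL2 a b f' hf')]
  congr 2
  refine Lp.ext ?_
  filter_upwards [coeFn_contL2 (a := a) (b := b) hc,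
    coeFn_constL2_add_primL2 (f a) (contL2 a b f' hf'), ae_restrict_mem measurableSet_Ioo]
    with t h1 h2 ht
  rw [h1, h2, prim_contL2 hf hf' ht, add_sub_cancel]

end Smooth

/-! ### Coercivity -/

section Coercivity

variable {a b : ℝ} {n N : ℕ}

/-- The symbol of the column operator. -/
abbrev colSymbol (P S : Fin (N + 1) → Matrix (Fin n) (Fin n) ℂ) :
    Matrix (Fin n ⊕ Fin n) (Fin n) ℂ[X] :=
  Matrix.fromRows (symbol P) (symbol S)

theorem mem_colDomain_iff (P S : Fin (N + 1) → Matrix (Fin n) (Fin n) ℂ) (x : L2 a b n) :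
    x ∈ colDomain (maxOp a b P) (maxOp a b S) ↔ ∃ z w : L2 a b n,
      polyAct (distD2 a b) (symbol P) (vecDist x) = vecDist z ∧
      polyAct (distD2 a b) (symbol S) (vecDist x) = vecDist w := by
  simp only [← maxOp_graph_iff]
  constructor
  · rintro ⟨h1, h2⟩
    exact ⟨_, _, ⟨h1, rfl⟩, ⟨h2, rfl⟩⟩
  · rintro ⟨_, _, ⟨h1, _⟩, ⟨h2, _⟩⟩
    exact ⟨h1, h2⟩

theorem polyAct_vecDist_fst (P S : Fin (N + 1) → Matrix (Fin n) (Fin n) ℂ)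
    (x : colDomain (maxOp a b P) (maxOp a b S)) :
    polyAct (distD2 a b) (symbol P) (vecDist (x : L2 a b n)) =
      vecDist (column (maxOp a b P) (maxOp a b S) x).1 :=
  (maxOp_graph_iff P _ _).1 ⟨x.2.1, rfl⟩

theorem polyAct_vecDist_snd (P S : Fin (N + 1) → Matrix (Fin n) (Fin n) ℂ)
    (x : colDomain (maxOp a b P) (maxOp a b S)) :
    polyAct (distD2 a b) (symbol S) (vecDist (x : L2 a b n)) =
      vecDist (column (maxOp a b P) (maxOp a b S) x).2 :=
  (maxOp_graph_iff S _ _).1 ⟨x.2.2, rfl⟩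

theorem columnNorm_le {X : Type*} [NormedAddCommGroup X] [InnerProductSpace ℂ X]
    (P S : X →ₗ.[ℂ] X) (x : colDomain P S) :
    columnNorm P S x ≤ ‖(column P S x).1‖ + ‖(column P S x).2‖ := by
  refine Real.sqrt_le_iff.2 ⟨by positivity, ?_⟩
  nlinarith [norm_nonneg (column P S x).1, norm_nonneg (column P S x).2]

theorem norm_fst_le_columnNorm {X : Type*} [NormedAddCommGroup X] [InnerProductSpace ℂ X]
    (P S : X →ₗ.[ℂ] X) (x : colDomain P S) : ‖(column P S x).1‖ ≤ columnNorm P S x :=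
  Real.le_sqrt_of_sq_le (le_add_of_nonneg_right (sq_nonneg _))

theorem norm_snd_le_columnNorm {X : Type*} [NormedAddCommGroup X] [InnerProductSpace ℂ X]
    (P S : X →ₗ.[ℂ] X) (x : colDomain P S) : ‖(column P S x).2‖ ≤ columnNorm P S x :=
  Real.le_sqrt_of_sq_le (le_add_of_nonneg_left (sq_nonneg _))

theorem exists_norm_coord_le (a b : ℝ) (n : ℕ) :
    ∃ C : ℝ, 0 ≤ C ∧ ∀ (x : L2 a b n) (i : Fin n), ‖mapL2 a b (coordE i) x‖ ≤ C * ‖x‖ := by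
  refine ⟨∑ i, ‖mapL2 a b (coordE (n := n) i)‖, by positivity, fun x i => ?_⟩
  refine ((mapL2 a b (coordE i)).le_opNorm x).trans
    (mul_le_mul_of_nonneg_right ?_ (norm_nonneg x))
  exact Finset.single_le_sum (f := fun i => ‖mapL2 a b (coordE (n := n) i)‖)
    (fun _ _ => norm_nonneg _) (Finset.mem_univ i)

theorem exists_norm_le_sum_coord (a b : ℝ) (n : ℕ) :
    ∃ C : ℝ, 0 ≤ C ∧ ∀ x : L2 a b n, ‖x‖ ≤ C * ∑ i, ‖mapL2 a b (coordE i) x‖ := by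
  refine ⟨∑ i, ‖mapL2 a b (inclE (n := n) i)‖, by positivity, fun x => ?_⟩
  conv_lhs => rw [← sum_mapL2_inclE_coordE x]
  refine (norm_sum_le _ _).trans ?_
  rw [Finset.mul_sum]
  refine Finset.sum_le_sum fun i _ => ((mapL2 a b (inclE i)).le_opNorm _).trans
    (mul_le_mul_of_nonneg_right ?_ (norm_nonneg _))
  exact Finset.single_le_sum (f := fun i => ‖mapL2 a b (inclE (n := n) i)‖)
    (fun _ _ => norm_nonneg _) (Finset.mem_univ i)

/-- The exponential functions in `L²`. -/
theorem exists_exponential (hab : a < b) (l : ℂ) :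
    ∃ e : L2 a b 1, e ≠ 0 ∧ distD2 a b (toDist e) = l ^ 2 • toDist e := by
  let f : ℝ → EuclideanSpace ℂ (Fin 1) := fun t =>
    Complex.exp (l * t) • EuclideanSpace.single 0 1
  have hc : Continuous f := by fun_prop
  have hd : ∀ t, HasDerivAt f (l • f t) t := by
    intro t
    have h1 : HasDerivAt (fun t : ℝ => Complex.exp (l * t)) (Complex.exp (l * t) * (l * 1)) t :=
      (((hasDerivAt_id (t : ℂ)).const_mul l).cexp).comp_ofReal
    have h2 := h1.smul_const (EuclideanSpace.single (0 : Fin 1) (1 : ℂ))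
    rwa [mul_one, mul_comm, mul_smul] at h2
  have hcl : Continuous fun t => l • f t := by fun_prop
  have hsm : contL2 a b (fun t => l • f t) hcl = l • contL2 a b f hc := rfl
  have h1 : distDeriv (toDist (contL2 a b f hc)) = l • toDist (contL2 a b f hc) := by
    rw [distDeriv_contL2 hab.le hc hd hcl, hsm, map_smul]
  refine ⟨contL2 a b f hc, fun h0 => ?_, ?_⟩
  · have h2 := coeFn_contL2 (a := a) (b := b) hc
    rw [h0] at h2
    have h3 := (Lp.coeFn_zero (EuclideanSpace ℂ (Fin 1)) 2 (volume.restrict (Ioo a b))).symm.trans h2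
    have h4 := Measure.eqOn_open_of_ae_eq h3 isOpen_Ioo continuousOn_const hc.continuousOn
    have h5 := h4 (show (a + b) / 2 ∈ Ioo a b from ⟨by linarith, by linarith⟩)
    have h6 := congrArg (fun v : EuclideanSpace ℂ (Fin 1) => v 0) h5
    simp [f] at h6
    exact Complex.exp_ne_zero _ h6.symm
  · change distDeriv (distDeriv _) = _
    rw [h1, map_smul, h1, smul_smul, ← pow_two]

/-- On an eigenvector of `∂²` a polynomial matrix acts by evaluation at the eigenvalue; this carries
estimates from operators to symbols. -/
theorem polyAct_smul_of_eigen {e : Dist a b 1} {μ : ℂ} (he : distD2 a b e = μ • e)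
    {ι κ : Type*} [Fintype ι] (M : Matrix κ ι ℂ[X]) (v : ι → ℂ) (k : κ) :
    polyAct (distD2 a b) M (fun i => v i • e) k = (M.map (evalRingHom μ) *ᵥ v) k • e := by
  have h1 : ∀ p : ℂ[X], aeval (distD2 a b) p e = p.eval μ • e := fun p => by
    induction p using Polynomial.induction_on' with
    | add p q hp hq => simp [hp, hq, add_smul]
    | monomial k c =>
      have hk : (distD2 a b ^ k) e = μ ^ k • e := by
        induction k with
        | zero => simp
        | succ k ih => rw [pow_succ, Module.End.mul_apply, he, map_smul, ih, smul_smul, pow_succ']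
      rw [aeval_monomial, Module.End.mul_apply, hk, eval_monomial, mul_smul]
      rfl
  rw [polyAct_apply]
  simp only [map_smul, h1, smul_smul, ← Finset.sum_smul]
  simp [Matrix.mulVec, dotProduct, mul_comm]

/-- Coercivity of the column operator bounds its symbol from below, uniformly on `ℂ`. -/
theorem exists_symbol_bound (hab : a < b) {P S : Fin (N + 1) → Matrix (Fin n) (Fin n) ℂ}
    (hcoer : IsCoerciveColumn (maxOp a b P) (maxOp a b S)) :
    ∃ c : ℝ, ∀ (μ : ℂ) (v : Fin n → ℂ) (i : Fin n),
      ‖v i‖ ≤ c * ∑ k, ‖((colSymbol P S).map (evalRingHom μ) *ᵥ v) k‖ := by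
  obtain ⟨c, hc, hcoer⟩ := hcoer
  obtain ⟨C₁, hC₁, h₁⟩ := exists_norm_coord_le a b n
  obtain ⟨C₂, hC₂, h₂⟩ := exists_norm_le_sum_coord a b n
  refine ⟨C₁ * c⁻¹ * C₂, fun μ v i => ?_⟩
  -- Every complex `μ` is an eigenvalue of `∂²` on the maximal domain. The norm of the exponential
  -- depends on `μ`, but it occurs on both sides of the estimate and cancels, so the constant does
  -- not depend on `μ`.
  obtain ⟨l, hl⟩ : ∃ l : ℂ, l ^ 2 = μ := IsAlgClosed.exists_pow_nat_eq μ two_pos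
  obtain ⟨e, he0, he⟩ := exists_exponential hab l
  rw [hl] at he
  have hex : ∀ w : Fin n → ℂ, ∃ x : L2 a b n, vecDist x = fun i => w i • toDist e := fun w =>
    exists_vecDist_eq _ fun i => ⟨w i • e, map_smul _ _ _⟩
  have hcoord : ∀ (w : Fin n → ℂ) (x : L2 a b n), (vecDist x = fun i => w i • toDist e) →
      ∀ i, ‖mapL2 a b (coordE i) x‖ = ‖w i‖ * ‖e‖ := by
    intro w x hx i
    have : mapL2 a b (coordE i) x = w i • e := by
      apply toDist_injective
      rw [← vecDist_apply, hx, map_smul]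
    rw [this, norm_smul]
  obtain ⟨x, hx⟩ := hex v
  obtain ⟨z, hz⟩ := hex ((symbol P).map (evalRingHom μ) *ᵥ v)
  obtain ⟨w, hw⟩ := hex ((symbol S).map (evalRingHom μ) *ᵥ v)
  have hPx : polyAct (distD2 a b) (symbol P) (vecDist x) = vecDist z := by
    ext1 k
    rw [hx, hz, polyAct_smul_of_eigen he]
  have hSx : polyAct (distD2 a b) (symbol S) (vecDist x) = vecDist w := by
    ext1 k
    rw [hx, hw, polyAct_smul_of_eigen he]
  let x' : colDomain (maxOp a b P) (maxOp a b S) := ⟨x, (mem_colDomain_iff P S x).2 ⟨z, w, hPx, hSx⟩⟩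
  have h1 : (column (maxOp a b P) (maxOp a b S) x').1 = z :=
    vecDist_injective ((polyAct_vecDist_fst P S x').symm.trans hPx)
  have h2 : (column (maxOp a b P) (maxOp a b S) x').2 = w :=
    vecDist_injective ((polyAct_vecDist_snd P S x').symm.trans hSx)
  have hx1 : c * ‖x‖ ≤ ‖z‖ + ‖w‖ := by
    have := (hcoer x').trans (columnNorm_le _ _ x')
    rwa [h1, h2] at this
  have he' : 0 < ‖e‖ := norm_pos_iff.2 he0
  have hsum : ∑ k, ‖((colSymbol P S).map (evalRingHom μ) *ᵥ v) k‖ =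
      ∑ k, ‖((symbol P).map (evalRingHom μ) *ᵥ v) k‖ +
        ∑ k, ‖((symbol S).map (evalRingHom μ) *ᵥ v) k‖ := by
    rw [Fintype.sum_sum_type]
    rfl
  have hz' := h₂ z
  have hw' := h₂ w
  simp only [hcoord _ z hz, hcoord _ w hw, ← Finset.sum_mul] at hz' hw'
  have hx2 := h₁ x i
  rw [hcoord v x hx] at hx2
  rw [hsum]
  refine le_of_mul_le_mul_right ?_ he'
  calc ‖v i‖ * ‖e‖ ≤ C₁ * ‖x‖ := hx2
    _ = C₁ * c⁻¹ * (c * ‖x‖) := by field_simp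
    _ ≤ C₁ * c⁻¹ * (C₂ * ((∑ k, ‖((symbol P).map (evalRingHom μ) *ᵥ v) k‖) * ‖e‖) +
        C₂ * ((∑ k, ‖((symbol S).map (evalRingHom μ) *ᵥ v) k‖) * ‖e‖)) :=
      mul_le_mul_of_nonneg_left (hx1.trans (add_le_add hz' hw')) (by positivity)
    _ = _ := by ring

/-- A coercive column operator has a polynomial left inverse and a column reduction whose
unimodular factor is bounded by the column degrees. -/
theorem exists_reduction (hab : a < b) {P S : Fin (N + 1) → Matrix (Fin n) (Fin n) ℂ}
    (hcoer : IsCoerciveColumn (maxOp a b P) (maxOp a b S)) :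
    ∃ (Q : Matrix (Fin n) (Fin n ⊕ Fin n) ℂ[X]) (W V : Matrix (Fin n) (Fin n) ℂ[X])
      (d : Fin n → ℕ) (L : Matrix (Fin n) (Fin n ⊕ Fin n) ℂ),
      Q * colSymbol P S = 1 ∧ W * V = 1 ∧ V * W = 1 ∧
      (∀ i j, ((colSymbol P S * W) i j).natDegree ≤ d j) ∧
      L * (Matrix.of fun i j => ((colSymbol P S * W) i j).coeff (d j)) = 1 ∧
      ∀ i j, (W i j).natDegree ≤ d j := by
  obtain ⟨c, hc⟩ := exists_symbol_bound hab hcoer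
  obtain ⟨Q, hQ⟩ := exists_polynomial_leftInverse (colSymbol P S) fun μ v hv => by
    ext1 i
    have := hc μ v i
    rw [hv] at this
    simpa using this
  obtain ⟨W, d, L, hW, hd, hL⟩ := exists_column_reduction _ Q hQ
  exact ⟨Q, W, W⁻¹, d, L, hQ, Matrix.mul_nonsing_inv W hW, Matrix.nonsing_inv_mul W hW, hd, hL,
    natDegree_le_of_bounded_below hd hc⟩

end Coercivity

/-! ### The range of the column operator and its core -/

section Range

variable {a b : ℝ} {n N : ℕ}

theorem toDist_eq_sum (x : L2 a b n) (φ : Test a b n) :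
    toDist x φ = ∑ i, vecDist x i (vecTest φ i) := by
  rw [toDist_apply, inner_testToL2_left]

theorem vecTest_testDeriv (j : ℕ) (φ : Test a b n) (i : Fin n) :
    vecTest (testDeriv j φ) i = testDeriv j (vecTest φ i) := by
  rw [vecTest_apply, vecTest_apply, testDeriv_mapTest]

theorem isWeakDeriv_iff_vecDist (j : ℕ) (x y : L2 a b n) :
    IsWeakDeriv j x y ↔ ∀ i, (distDeriv ^ j) (vecDist x i) = vecDist y i := by
  have h1 : ∀ φ : Test a b n, (distDeriv ^ j) (toDist x) φ =
      ∑ i, (distDeriv ^ j) (vecDist x i) (vecTest φ i) := fun φ => by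
    simp only [distDeriv_pow_apply, toDist_eq_sum, vecTest_testDeriv, Finset.mul_sum]
  rw [isWeakDeriv_iff]
  constructor
  · intro h i
    ext φ
    obtain ⟨Φ, hΦ⟩ := exists_vecTest_eq (Pi.single i φ)
    have h2 := h1 Φ
    rw [h, toDist_eq_sum, hΦ, Finset.sum_eq_single i, Finset.sum_eq_single i] at h2
    · simpa using h2.symm
    all_goals simp +contextual
  · intro h
    ext φ
    rw [h1, toDist_eq_sum]
    simp only [h]

/-- The scale asks only for the highest derivative to be in `L²`; the intermediate ones follow
because the scale is decreasing. -/
theorem mem_sobolevSpace_iff (hab : a < b) (k : ℕ) (x : L2 a b n) :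
    x ∈ sobolevSpace a b n k ↔ ∀ i, vecDist x i ∈ sobolevScale a b 1 k := by
  constructor
  · rintro ⟨u, hu, rfl⟩ i
    have := (isWeakDeriv_iff_vecDist _ _ _).1 (hu (Fin.last k)) i
    rw [sobolevScale_natCast, Submodule.mem_comap]
    exact ⟨_, this.symm⟩
  · intro h
    have h1 : ∀ j : Fin (k + 1), ∃ y : L2 a b n, vecDist y =
        fun i => (distDeriv ^ (j : ℕ)) (vecDist x i) := fun j =>
      exists_vecDist_eq _ fun i => by
        have : (j : ℤ) ≤ k := by have := j.2; omega
        exact sobolevScale_antitone hab this (h i)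
    choose u hu using h1
    have h0 : u 0 = x := vecDist_injective (by rw [hu]; simp)
    refine ⟨u, fun j => ?_, h0⟩
    rw [isWeakDeriv_iff_vecDist, h0, hu]
    exact fun _ => rfl

/-- The symbols have degree at most `N` in `∂²`, so they cost at most `2N` orders. -/
theorem sobolevSpace_le_colDomain (hab : a < b) (P S : Fin (N + 1) → Matrix (Fin n) (Fin n) ℂ) :
    sobolevSpace a b n (2 * N) ≤ colDomain (maxOp a b P) (maxOp a b S) := by
  intro x hx
  rw [mem_sobolevSpace_iff hab] at hx
  have h : ∀ C : Fin (N + 1) → Matrix (Fin n) (Fin n) ℂ, ∃ z : L2 a b n,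
      vecDist z = polyAct (distD2 a b) (symbol C) (vecDist x) := fun C =>
    exists_vecDist_eq _ fun i => by
      rw [← sobolevScale_zero, polyAct_apply]
      refine Submodule.sum_mem _ fun j _ => ?_
      convert aeval_distD2_mem_sobolevScale hab (natDegree_symbol_le C i j) (hx j) using 2
      push_cast
      ring
  obtain ⟨z, hz⟩ := h P
  obtain ⟨w, hw⟩ := h S
  exact (mem_colDomain_iff P S x).2 ⟨z, w, hz.symm, hw.symm⟩

theorem testToL2_mem_sobolevScale (hab : a ≤ b) (φ : Test a b 1) (k : ℕ) :
    toDist (testToL2 φ) ∈ sobolevScale a b 1 k := by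
  rw [sobolevScale_natCast, Submodule.mem_comap]
  induction k generalizing φ with
  | zero => exact ⟨_, rfl⟩
  | succ k ih =>
    rw [pow_succ, Module.End.mul_apply, distDeriv_toDist_testToL2 hab]
    exact ih _

theorem polyAct_fromRows {V ι κ θ : Type*} [AddCommGroup V] [Module ℂ V] [Fintype ι]
    (δ : Module.End ℂ V) (A : Matrix κ ι ℂ[X]) (B : Matrix θ ι ℂ[X]) (u : ι → V) :
    polyAct δ (Matrix.fromRows A B) u = Sum.elim (polyAct δ A u) (polyAct δ B u) := by
  ext1 k
  cases k <;> simp [polyAct_apply]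

theorem polyAct_colSymbol (P S : Fin (N + 1) → Matrix (Fin n) (Fin n) ℂ)
    (x : colDomain (maxOp a b P) (maxOp a b S)) :
    polyAct (distD2 a b) (colSymbol P S) (vecDist (x : L2 a b n)) =
      Sum.elim (vecDist (column (maxOp a b P) (maxOp a b S) x).1)
        (vecDist (column (maxOp a b P) (maxOp a b S) x).2) := by
  rw [polyAct_fromRows, polyAct_vecDist_fst, polyAct_vecDist_snd]

theorem exists_column_eq {P S : Fin (N + 1) → Matrix (Fin n) (Fin n) ℂ} {x z w : L2 a b n}
    (h : polyAct (distD2 a b) (colSymbol P S) (vecDist x) = Sum.elim (vecDist z) (vecDist w)) :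
    ∃ hx : x ∈ colDomain (maxOp a b P) (maxOp a b S),
      column (maxOp a b P) (maxOp a b S) ⟨x, hx⟩ = (z, w) := by
  rw [polyAct_fromRows, Sum.elim_eq_iff] at h
  have hx := (mem_colDomain_iff P S x).2 ⟨z, w, h.1, h.2⟩
  refine ⟨hx, Prod.ext (vecDist_injective ?_) (vecDist_injective ?_)⟩
  · rw [← h.1, ← polyAct_vecDist_fst P S ⟨x, hx⟩]
  · rw [← h.2, ← polyAct_vecDist_snd P S ⟨x, hx⟩]

/-- A distribution of finite order that the column operator maps to `L²` is obtained from
functions with the regularity given by the column degrees of a column reduction. -/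
theorem polyAct_mem_of_colSymbol_mem (hab : a < b)
    {P S : Fin (N + 1) → Matrix (Fin n) (Fin n) ℂ}
    {W V : Matrix (Fin n) (Fin n) ℂ[X]} {d : Fin n → ℕ} {L : Matrix (Fin n) (Fin n ⊕ Fin n) ℂ}
    (hWV : W * V = 1)
    (hd : ∀ i j, ((colSymbol P S * W) i j).natDegree ≤ d j)
    (hL : L * (Matrix.of fun i j => ((colSymbol P S * W) i j).coeff (d j)) = 1)
    {u : Fin n → Dist a b 1} {K : ℕ} (hu : ∀ i, u i ∈ sobolevScale a b 1 (-(2 * K)))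
    (hM : ∀ k, polyAct (distD2 a b) (colSymbol P S) u k ∈ sobolevScale a b 1 0) (j : Fin n) :
    polyAct (distD2 a b) V u j ∈ sobolevScale a b 1 (2 * d j) := by
  obtain ⟨K', hK'⟩ := exists_polyAct_mem_sobolevScale hab V hu
  -- The bootstrap needs one starting deficit `K` for all components; adding the sum of the `d_j` to
  -- the order of `V(∂²) u` is enough.
  refine mem_sobolevScale_of_columnReduced hab hd hL (fun k => ?_) (K' + ∑ j, d j) (fun j => ?_) j
  · rw [polyAct_mul, ← polyAct_mul _ W V, hWV, polyAct_one]
    exact hM k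
  · refine sobolevScale_antitone hab ?_ (hK' j)
    have := Finset.single_le_sum (f := d) (fun _ _ => Nat.zero_le _) (Finset.mem_univ j)
    push_cast
    have : (d j : ℤ) ≤ ∑ i, (d i : ℤ) := by exact_mod_cast this
    omega

/-- The bound of the column degrees of `W` by `d` enters regularity here: regularity `m + 2 d_j` of
`y_j` passes to regularity `m` of `W(∂²) y`. -/
theorem polyAct_mem_sobolevScale_of_degree_le (hab : a < b) {W : Matrix (Fin n) (Fin n) ℂ[X]}
    {d : Fin n → ℕ} (hW : ∀ i j, (W i j).natDegree ≤ d j) {y : Fin n → Dist a b 1} (m : ℤ)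
    (hy : ∀ j, y j ∈ sobolevScale a b 1 (m + 2 * d j)) (i : Fin n) :
    polyAct (distD2 a b) W y i ∈ sobolevScale a b 1 m := by
  rw [polyAct_apply]
  refine Submodule.sum_mem _ fun j _ => ?_
  convert aeval_distD2_mem_sobolevScale hab (hW i j) (hy j) using 2
  ring

/-- The operator `T(∂²) diag(J^(2 d_j))` on `L²` for a matrix `T` of polynomials whose column degrees
are at most `d`, where `J` is the integration operator. -/
def liftVec (a b : ℝ) (T : Matrix (Fin n) (Fin n) ℂ[X]) (d : Fin n → ℕ) :
    (Fin n → L2 a b 1) →L[ℂ] L2 a b n :=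
  ∑ i, ∑ j, mapL2 a b (inclE i) ∘L liftL2 a b (T i j) (d j) ∘L ContinuousLinearMap.proj j

theorem vecDist_liftVec (hab : a < b) {T : Matrix (Fin n) (Fin n) ℂ[X]} {d : Fin n → ℕ}
    (hT : ∀ i j, (T i j).natDegree ≤ d j) (g : Fin n → L2 a b 1) :
    vecDist (liftVec a b T d g) = polyAct (distD2 a b) T
      fun j => toDist ((primL2 a b 1 ^ (2 * d j)) (g j)) := by
  ext1 i
  rw [polyAct_apply, vecDist_apply, liftVec]
  simp only [_root_.sum_apply, ContinuousLinearMap.comp_apply, ContinuousLinearMap.proj_apply,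
    map_sum, mapL2_coordE_inclE]
  rw [Finset.sum_eq_single i]
  · exact Finset.sum_congr rfl fun j _ => by rw [if_pos rfl, toDist_liftL2 hab (hT i j)]
  · intro i' _ hi'
    exact Finset.sum_eq_zero fun j _ => by rw [if_neg hi'.symm, map_zero]
  · simp

/-- Functions in `H^(2N)` are dense in the domain of the column operator. -/
theorem exists_sobolevSpace_columnNorm_sub_lt (hab : a < b)
    {P S : Fin (N + 1) → Matrix (Fin n) (Fin n) ℂ}
    (hcoer : IsCoerciveColumn (maxOp a b P) (maxOp a b S))
    (x : colDomain (maxOp a b P) (maxOp a b S)) {ε : ℝ} (hε : 0 < ε) :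
    ∃ x' : colDomain (maxOp a b P) (maxOp a b S), (x' : L2 a b n) ∈ sobolevSpace a b n (2 * N) ∧
      columnNorm (maxOp a b P) (maxOp a b S) (x - x') < ε := by
  obtain ⟨Q, W, V, d, L, -, hWV, -, hd, hL, hW⟩ := exists_reduction hab hcoer
  set y := polyAct (distD2 a b) V (vecDist (x : L2 a b n)) with hy
  have hWy : polyAct (distD2 a b) W y = vecDist (x : L2 a b n) := by
    rw [hy, ← polyAct_mul, hWV, polyAct_one]
  have hyd : ∀ j, y j ∈ sobolevScale a b 1 (2 * d j) :=
    polyAct_mem_of_colSymbol_mem hab hWV hd hL (K := 0)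
      (fun i => by
        rw [Nat.cast_zero, mul_zero, neg_zero, sobolevScale_zero]
        exact ⟨_, rfl⟩)
      (fun k => by
        rw [polyAct_colSymbol, sobolevScale_zero]
        cases k <;> exact ⟨_, rfl⟩)
  have hyd' : ∀ j, ∃ h : L2 a b 1, toDist h = (distDeriv ^ (2 * d j)) (y j) := fun j => by
    have h1 : y j ∈ sobolevScale a b 1 (0 + ((2 * d j : ℕ) : ℤ)) := by
      convert hyd j using 2
      push_cast
      ring
    rwa [mem_sobolevScale_add_natCast_iff hab, sobolevScale_zero] at h1
  choose h hh using hyd'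
  have hP : ∀ i j, ((symbol P * W) i j).natDegree ≤ d j := fun i j => by
    have := hd (Sum.inl i) j
    rwa [Matrix.fromRows_mul] at this
  have hS : ∀ i j, ((symbol S * W) i j).natDegree ≤ d j := fun i j => by
    have := hd (Sum.inr i) j
    rwa [Matrix.fromRows_mul] at this
  -- The top derivatives `h j` of `y j` are approximated by test functions. The error enters `P x`
  -- and `S x` only through the bounded operators `liftVec` of `P W` and `S W`.
  have hdense : DenseRange fun (ψ : Fin n → Test a b 1) (j : Fin n) => testToL2 (ψ j) :=
    DenseRange.piMap fun _ => denseRange_testToL2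
  have hopen : IsOpen {g : Fin n → L2 a b 1 |
      ‖liftVec a b (symbol P * W) d (h - g)‖ + ‖liftVec a b (symbol S * W) d (h - g)‖ < ε} := by
    exact isOpen_lt (by fun_prop) continuous_const
  obtain ⟨ψ, hψ⟩ := hdense.exists_mem_open hopen ⟨h, by simp [hε]⟩
  set g : Fin n → L2 a b 1 := h - fun j => testToL2 (ψ j) with hg
  set z : Fin n → Dist a b 1 := fun j => toDist ((primL2 a b 1 ^ (2 * d j)) (g j)) with hz
  obtain ⟨hΔ, hcol⟩ := exists_column_eq (P := P) (S := S) (x := liftVec a b W d g)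
    (z := liftVec a b (symbol P * W) d g)
    (w := liftVec a b (symbol S * W) d g) (by
      rw [vecDist_liftVec hab hW, vecDist_liftVec hab hP, vecDist_liftVec hab hS, polyAct_fromRows,
        ← polyAct_mul, ← polyAct_mul])
  -- After the correction, the derivative of order `2 d_j` of `y_j - z_j` is the test function
  -- `ψ_j`, so `y_j - z_j` has regularity `2N + 2 d_j`.
  refine ⟨x - ⟨liftVec a b W d g, hΔ⟩, ?_, ?_⟩
  · rw [mem_sobolevSpace_iff hab]
    intro i
    have h1 : vecDist ((x - ⟨liftVec a b W d g, hΔ⟩ : colDomain (maxOp a b P) (maxOp a b S)) : L2 a b n) =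
        polyAct (distD2 a b) W (y - z) := by
      rw [Submodule.coe_sub, map_sub, map_sub (polyAct (distD2 a b) W), hWy]
      exact congrArg _ (vecDist_liftVec hab hW g)
    rw [h1]
    refine polyAct_mem_sobolevScale_of_degree_le hab hW _ (fun j => ?_) i
    rw [show (2 * (d j : ℤ)) = ((2 * d j : ℕ) : ℤ) by push_cast; ring,
      mem_sobolevScale_add_natCast_iff hab, Pi.sub_apply, map_sub, ← hh, hz,
      distDeriv_pow_primL2_pow hab, ← map_sub, hg, Pi.sub_apply, sub_sub_cancel]
    exact testToL2_mem_sobolevScale hab.le _ _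
  · rw [sub_sub_cancel]
    refine (columnNorm_le _ _ _).trans_lt ?_
    rw [hcol]
    exact hψ

end Range

/-! ### The adjoint of the kernel relation -/

section KernelRelation

variable {a b : ℝ} {n N : ℕ}

/-- The symbol of the row operator whose kernel on test functions is the kernel relation. -/
abbrev rowSymbol (P S : Fin (N + 1) → Matrix (Fin n) (Fin n) ℂ) :
    Matrix (Fin n) (Fin n ⊕ Fin n) ℂ[X] :=
  Matrix.fromCols (conjTr (symbol S)) (-conjTr (symbol P))

theorem coeff_symbol (C : Fin (N + 1) → Matrix (Fin n) (Fin n) ℂ) (m : ℕ) (i j : Fin n) :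
    (symbol C i j).coeff m = coeff C m i j := by
  rw [symbol_apply, finsetSum_coeff, coeff]
  simp only [coeff_monomial]
  split_ifs with h
  · rw [Finset.sum_eq_single ⟨m, h⟩]
    · simp
    · intro k _ hk
      rw [if_neg]
      exact fun h' => hk (Fin.ext h')
    · simp
  · rw [Matrix.zero_apply]
    refine Finset.sum_eq_zero fun k _ => if_neg ?_
    have := k.2
    omega

/-- For `C = S` and `D = P` these coefficients are the matrices that Assumption (C) requires to be
Hermitian. -/
theorem coeff_conjTr_mul (C D : Fin (N + 1) → Matrix (Fin n) (Fin n) ℂ) (p : ℕ) (i j : Fin n) :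
    ((conjTr (symbol C) * symbol D) i j).coeff p =
      (∑ m ∈ Finset.range (p + 1), (coeff C m)ᴴ * coeff D (p - m)) i j := by
  rw [Matrix.mul_apply, finsetSum_coeff, Matrix.sum_apply]
  simp only [Matrix.mul_apply, Polynomial.coeff_mul, conjTr_apply, Polynomial.coeff_map,
    coeff_symbol, Finset.Nat.sum_antidiagonal_eq_sum_range_succ_mk]
  rw [Finset.sum_comm]
  rfl

/-- The product is `S~ P - P~ S`, the difference of `S~ P` and its formal adjoint. It vanishes by
(C) in degrees up to `2N`, and above for reasons of degree. -/
theorem rowSymbol_mul_colSymbol {P S : Fin (N + 1) → Matrix (Fin n) (Fin n) ℂ}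
    (hC : CoeffAssumption P S) : rowSymbol P S * colSymbol P S = 0 := by
  rw [Matrix.fromCols_mul_fromRows, Matrix.neg_mul, ← sub_eq_add_neg, sub_eq_zero]
  ext i j p
  rw [coeff_conjTr_mul, coeff_conjTr_mul]
  rcases le_or_gt p (2 * N) with hp | hp
  · rw [← (hC.symmetric p hp).eq, Matrix.conjTranspose_sum]
    simp only [Matrix.conjTranspose_mul, Matrix.conjTranspose_conjTranspose]
    rw [← Finset.sum_range_reflect]
    refine congrFun (congrFun (Finset.sum_congr rfl fun m hm => ?_) i) j
    have := Finset.mem_range.1 hm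
    rw [show p - (p + 1 - 1 - m) = m by omega, show p + 1 - 1 - m = p - m by omega]
  · have hz : ∀ C D : Fin (N + 1) → Matrix (Fin n) (Fin n) ℂ,
        ∑ m ∈ Finset.range (p + 1), (coeff C m)ᴴ * coeff D (p - m) = 0 := by
      intro C D
      refine Finset.sum_eq_zero fun m _ => ?_
      rcases le_or_gt m N with hm | hm
      · rw [coeff, coeff, dif_neg (show ¬ p - m < N + 1 by omega), Matrix.mul_zero]
      · rw [coeff, dif_neg (show ¬ m < N + 1 by omega), Matrix.conjTranspose_zero, Matrix.zero_mul]
    rw [hz, hz]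

theorem conjTr_conjTr {ι κ : Type*} (M : Matrix κ ι ℂ[X]) : conjTr (conjTr M) = M := by
  ext1 i j
  rw [conjTr_apply, conjTr_apply, Polynomial.map_map]
  convert Polynomial.map_id
  ext1 z
  simp

/-- Exactness of the complex formed by the column and the row operator. -/
theorem exists_exact {P S : Fin (N + 1) → Matrix (Fin n) (Fin n) ℂ}
    (hC : CoeffAssumption P S) {Q : Matrix (Fin n) (Fin n ⊕ Fin n) ℂ[X]}
    (hQ : Q * colSymbol P S = 1) :
    ∃ Z : Matrix (Fin n ⊕ Fin n) (Fin n) ℂ[X], colSymbol P S * Q + Z * rowSymbol P S = 1 := by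
  -- With `Q = [Q₁, Q₂]`, the formal adjoint of `Q₁ P + Q₂ S = 1` reads `S~ Q₂~ + P~ Q₁~ = 1`, so
  -- `[Q₂~; -Q₁~]` is a right inverse of `[S~, -P~]`.
  refine exists_mul_add_mul_eq_one (Z := Matrix.fromRows (conjTr Q.toCols₂) (-conjTr Q.toCols₁))
    hQ ?_ (rowSymbol_mul_colSymbol hC)
  rw [Matrix.fromCols_mul_fromRows, Matrix.neg_mul, Matrix.mul_neg, neg_neg, ← conjTr_mul,
    ← conjTr_mul, ← conjTr_add,
    add_comm, ← Matrix.fromCols_mul_fromRows, Matrix.fromCols_toCols, hQ, conjTr_one]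

theorem polyAct_fromCols {V ι κ θ : Type*} [AddCommGroup V] [Module ℂ V] [Fintype ι] [Fintype θ]
    (δ : Module.End ℂ V) (A : Matrix κ ι ℂ[X]) (B : Matrix κ θ ℂ[X]) (u : ι → V) (v : θ → V) :
    polyAct δ (Matrix.fromCols A B) (Sum.elim u v) = polyAct δ A u + polyAct δ B v := by
  ext1 k
  simp [polyAct_apply]

theorem polyAct_neg {V ι κ : Type*} [AddCommGroup V] [Module ℂ V] [Fintype ι]
    (δ : Module.End ℂ V) (A : Matrix κ ι ℂ[X]) (u : ι → V) :
    polyAct δ (-A) u = -polyAct δ A u := by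
  ext1 k
  simp [polyAct_apply]

theorem mem_kerRelation_iff (P S : Fin (N + 1) → Matrix (Fin n) (Fin n) ℂ)
    (f : L2 a b n × L2 a b n) :
    f ∈ kerRelation (minOp a b P) (minOp a b S) ↔ ∃ φ₁ φ₂ : Test a b n,
      f = (testToL2 φ₁, testToL2 φ₂) ∧ polyAct (testD2 a b) (rowSymbol P S)
        (Sum.elim (vecTest φ₁) (vecTest φ₂)) = 0 := by
  have key : ∀ φ₁ φ₂ : Test a b n, polyAct (testD2 a b) (rowSymbol P S)
      (Sum.elim (vecTest φ₁) (vecTest φ₂)) = 0 ↔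
      testToL2 (testOp S φ₁) = testToL2 (testOp P φ₂) := fun φ₁ φ₂ => by
    rw [testToL2_injective.eq_iff, ← vecTest_injective.eq_iff, vecTest_testOp, vecTest_testOp,
      polyAct_fromCols, polyAct_neg, ← sub_eq_add_neg, sub_eq_zero, conjTr_symbol, conjTr_symbol]
  constructor
  · rintro ⟨⟨_, φ₁, rfl⟩, ⟨_, φ₂, rfl⟩, rfl, h⟩
    exact ⟨φ₁, φ₂, rfl, (key _ _).2 (((minOp_apply S φ₁ ⟨φ₁, rfl⟩).symm.trans h).trans
      (minOp_apply P φ₂ ⟨φ₂, rfl⟩))⟩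
  · rintro ⟨φ₁, φ₂, rfl, h⟩
    exact ⟨⟨_, φ₁, rfl⟩, ⟨_, φ₂, rfl⟩, rfl, ((minOp_apply S φ₁ ⟨φ₁, rfl⟩).trans
      ((key _ _).1 h)).trans (minOp_apply P φ₂ ⟨φ₂, rfl⟩).symm⟩

theorem vecDist_testToL2_eq_polyAct (hab : a ≤ b) (M : Matrix (Fin n) (Fin n) ℂ[X])
    {φ ψ : Test a b n} (h : vecTest φ = polyAct (testD2 a b) M (vecTest ψ)) :
    polyAct (distD2 a b) M (vecDist (testToL2 ψ)) = vecDist (testToL2 φ) := by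
  ext1 i
  rw [vecDist_testToL2, h]
  have := map_polyAct_of_intertwine (δ := testD2 a b) (δ' := distD2 a b)
    (toDist ∘ₗ (testToL2 : Test a b 1 →ₗ[ℂ] L2 a b 1))
    (fun v => toDist_testToL2_testD2 hab v) M (vecTest ψ) i
  rw [LinearMap.comp_apply] at this
  rw [this]
  congr 1

/-- The column operator on test functions. -/
theorem column_testToL2 (hab : a ≤ b) (P S : Fin (N + 1) → Matrix (Fin n) (Fin n) ℂ)
    {φ₁ φ₂ ψ : Test a b n} (h₁ : vecTest φ₁ = polyAct (testD2 a b) (symbol P) (vecTest ψ))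
    (h₂ : vecTest φ₂ = polyAct (testD2 a b) (symbol S) (vecTest ψ)) :
    ∃ h : testToL2 ψ ∈ colDomain (maxOp a b P) (maxOp a b S),
      column (maxOp a b P) (maxOp a b S) ⟨testToL2 ψ, h⟩ = (testToL2 φ₁, testToL2 φ₂) :=
  exists_column_eq (by
    rw [polyAct_fromRows, vecDist_testToL2_eq_polyAct hab _ h₁,
      vecDist_testToL2_eq_polyAct hab _ h₂])

theorem mem_kerRelation_of_polyAct {P S : Fin (N + 1) → Matrix (Fin n) (Fin n) ℂ}
    (hC : CoeffAssumption P S)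
    {φ₁ φ₂ ψ : Test a b n} (h₁ : vecTest φ₁ = polyAct (testD2 a b) (symbol P) (vecTest ψ))
    (h₂ : vecTest φ₂ = polyAct (testD2 a b) (symbol S) (vecTest ψ)) :
    (testToL2 φ₁, testToL2 φ₂) ∈ kerRelation (minOp a b P) (minOp a b S) := by
  refine (mem_kerRelation_iff P S _).2 ⟨φ₁, φ₂, rfl, ?_⟩
  rw [h₁, h₂, ← polyAct_fromRows, ← polyAct_mul, rowSymbol_mul_colSymbol hC, polyAct_zero]

/-- The kernel relation is the image of the test functions under the column operator. -/
theorem kerRelation_eq_map (hab : a < b) {P S : Fin (N + 1) → Matrix (Fin n) (Fin n) ℂ}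
    (hcoer : IsCoerciveColumn (maxOp a b P) (maxOp a b S)) (hC : CoeffAssumption P S) :
    kerRelation (minOp a b P) (minOp a b S) =
      ((LinearMap.range (testToL2 : Test a b n →ₗ[ℂ] L2 a b n)).comap
        (colDomain (maxOp a b P) (maxOp a b S)).subtype).map
          (column (maxOp a b P) (maxOp a b S)) := by
  obtain ⟨Q, W, V, d, L, hQ, -⟩ := exists_reduction hab hcoer
  obtain ⟨Z, hZ⟩ := exists_exact hC hQ
  ext f
  constructor
  · intro hf
    obtain ⟨φ₁, φ₂, rfl, h⟩ := (mem_kerRelation_iff P S f).1 hf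
    -- Differential operators preserve test functions, so `Q(∂²)` applied to an element of `H` is an
    -- admissible preimage; on `H` the row term of `M Q + Z R = 1` drops out.
    obtain ⟨ψ, hψ⟩ := exists_vecTest_eq
      (polyAct (testD2 a b) Q (Sum.elim (vecTest φ₁) (vecTest φ₂)))
    have h1 : polyAct (testD2 a b) (colSymbol P S) (vecTest ψ) =
        Sum.elim (vecTest φ₁) (vecTest φ₂) := by
      have := polyAct_one (testD2 a b) (Sum.elim (vecTest φ₁) (vecTest φ₂))
      rw [← hZ, polyAct_add, polyAct_mul, polyAct_mul, h, map_zero, add_zero, ← hψ] at this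
      exact this
    rw [polyAct_fromRows, Sum.elim_eq_iff] at h1
    obtain ⟨hm, hcol⟩ := column_testToL2 hab.le P S h1.1.symm h1.2.symm
    exact ⟨⟨testToL2 ψ, hm⟩, ⟨ψ, rfl⟩, hcol⟩
  · rintro ⟨⟨_, hm⟩, ⟨ψ, rfl⟩, rfl⟩
    obtain ⟨φ₁, h₁⟩ := exists_vecTest_eq (polyAct (testD2 a b) (symbol P) (vecTest ψ))
    obtain ⟨φ₂, h₂⟩ := exists_vecTest_eq (polyAct (testD2 a b) (symbol S) (vecTest ψ))
    obtain ⟨_, hcol⟩ := column_testToL2 hab.le P S h₁ h₂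
    rw [show column (maxOp a b P) (maxOp a b S) ⟨testToL2 ψ, hm⟩ = _ from hcol]
    exact mem_kerRelation_of_polyAct hC h₁ h₂

/-- For `S₀ f₁ = P₀ f₂` one has `⟨f₁, S x⟩ = ⟨S₀ f₁, x⟩ = ⟨P₀ f₂, x⟩ = ⟨f₂, P x⟩`. -/
theorem ranColumn_le_adjoint (P S : Fin (N + 1) → Matrix (Fin n) (Fin n) ℂ) :
    ranColumn (maxOp a b P) (maxOp a b S) ≤
      (kerRelation (minOp a b P) (minOp a b S)).adjoint := by
  rintro _ ⟨x, rfl⟩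
  rw [Submodule.mem_adjoint_iff]
  rintro _ _ ⟨f₁, f₂, h, heq⟩
  obtain ⟨rfl, rfl⟩ := Prod.mk.inj h
  have h1 := (LinearPMap.adjoint_isFormalAdjoint (dense_minOp_domain P)).symm f₂ ⟨x, x.2.1⟩
  have h2 := (LinearPMap.adjoint_isFormalAdjoint (dense_minOp_domain S)).symm f₁ ⟨x, x.2.2⟩
  rw [sub_eq_zero]
  exact h1.symm.trans ((congrArg (inner ℂ · (x : L2 a b n)) heq.symm).trans h2)

/-- By (C) the pairs `(P ψ, S ψ)` with a test function `ψ` belong to `H`; pairing `g` with them is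
the weak form of `S~ g₁ - P~ g₂ = 0`. -/
theorem polyAct_rowSymbol_of_mem_adjoint {P S : Fin (N + 1) → Matrix (Fin n) (Fin n) ℂ}
    (hC : CoeffAssumption P S) {g : L2 a b n × L2 a b n}
    (hg : g ∈ (kerRelation (minOp a b P) (minOp a b S)).adjoint) :
    polyAct (distD2 a b) (rowSymbol P S) (Sum.elim (vecDist g.1) (vecDist g.2)) = 0 := by
  rw [Submodule.mem_adjoint_iff] at hg
  rw [polyAct_fromCols, polyAct_neg, ← sub_eq_add_neg, sub_eq_zero]
  ext i φ
  obtain ⟨ψ, hψ⟩ := exists_vecTest_eq (Pi.single i φ)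
  obtain ⟨φ₁, h₁⟩ := exists_vecTest_eq (polyAct (testD2 a b) (symbol P) (vecTest ψ))
  obtain ⟨φ₂, h₂⟩ := exists_vecTest_eq (polyAct (testD2 a b) (symbol S) (vecTest ψ))
  have h := hg _ _ (mem_kerRelation_of_polyAct hC h₁ h₂)
  rw [sub_eq_zero, inner_testToL2_left, inner_testToL2_left, h₁, h₂] at h
  have h3 := sum_polyAct_apply (conjTr (symbol S)) (vecDist g.1) (vecTest ψ)
  have h4 := sum_polyAct_apply (conjTr (symbol P)) (vecDist g.2) (vecTest ψ)
  rw [conjTr_conjTr] at h3 h4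
  rw [← h3, ← h4, hψ, Finset.sum_eq_single i, Finset.sum_eq_single i] at h
  · simpa using h
  all_goals simp +contextual

/-- The adjoint of the kernel relation is the range of the column operator. -/
theorem adjoint_kerRelation_eq (hab : a < b) {P S : Fin (N + 1) → Matrix (Fin n) (Fin n) ℂ}
    (hcoer : IsCoerciveColumn (maxOp a b P) (maxOp a b S)) (hC : CoeffAssumption P S) :
    (kerRelation (minOp a b P) (minOp a b S)).adjoint =
      ranColumn (maxOp a b P) (maxOp a b S) := by
  refine le_antisymm (fun g hg => ?_) (ranColumn_le_adjoint P S)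
  obtain ⟨Q, W, V, d, L, hQ, hWV, -, hd, hL, hW⟩ := exists_reduction hab hcoer
  obtain ⟨Z, hZ⟩ := exists_exact hC hQ
  set G := Sum.elim (vecDist g.1) (vecDist g.2) with hG
  have hG0 : ∀ k, G k ∈ sobolevScale a b 1 0 := fun k => by
    rw [sobolevScale_zero]
    cases k <;> exact ⟨_, rfl⟩
  -- The candidate preimage is at first only a distribution of finite order, because `Q` may have
  -- any degree; the regularity theory then puts it in `L²`.
  set u := polyAct (distD2 a b) Q G with hu
  have hMu : polyAct (distD2 a b) (colSymbol P S) u = G := by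
    have := polyAct_one (distD2 a b) G
    rwa [← hZ, polyAct_add, polyAct_mul, polyAct_mul, polyAct_rowSymbol_of_mem_adjoint hC hg,
      map_zero, add_zero] at this
  obtain ⟨K, hK⟩ := exists_polyAct_mem_sobolevScale hab Q (K := 0) (u := G) (by simpa using hG0)
  have hy := polyAct_mem_of_colSymbol_mem hab hWV hd hL hK (by rw [← hu, hMu]; exact hG0)
  have hu0 : ∀ i, u i ∈ sobolevScale a b 1 0 := fun i => by
    have := polyAct_mem_sobolevScale_of_degree_le hab hW 0 (by simpa using hy) i
    rwa [← polyAct_mul, hWV, polyAct_one] at this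
  obtain ⟨x, hx⟩ := exists_vecDist_eq u fun i => by
    rw [← sobolevScale_zero]
    exact hu0 i
  obtain ⟨hm, hcol⟩ := exists_column_eq (P := P) (S := S) (x := x) (z := g.1) (w := g.2)
    (by rw [hx, hMu])
  exact ⟨⟨x, hm⟩, hcol⟩

end KernelRelation

/-! ### Traces and the Green identity on `H^(2N)` -/

section Traces

variable {a b : ℝ} {n m : ℕ}

theorem contRep_eq (hab : a < b) {y : L2 a b n} {g : ℝ → EuclideanSpace ℂ (Fin n)}
    (hg : ContinuousOn g (Icc a b)) (hy : y =ᵐ[volume.restrict (Ioo a b)] g) {t : ℝ}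
    (ht : t ∈ Icc a b) : contRep y t = g t := by
  have h : ∃ g : ℝ → EuclideanSpace ℂ (Fin n),
      ContinuousOn g (Icc a b) ∧ y =ᵐ[volume.restrict (Ioo a b)] g := ⟨g, hg, hy⟩
  rw [contRep, dif_pos h]
  have h1 : h.choose =ᵐ[volume.restrict (Icc a b)] g := by
    rw [← restrict_Ioo_eq_restrict_Icc]
    exact h.choose_spec.2.symm.trans hy
  exact Measure.eqOn_Icc_of_ae_eq volume hab.ne h1 h.choose_spec.1 hg ht

theorem weakDeriv_eq {j : ℕ} {x y : L2 a b n} (h : IsWeakDeriv j x y) : weakDeriv j x = y := by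
  have h' : ∃ y, IsWeakDeriv j x y := ⟨y, h⟩
  rw [weakDeriv, dif_pos h']
  exact toDist_injective (((isWeakDeriv_iff j x _).1 h'.choose_spec).symm.trans
    ((isWeakDeriv_iff j x y).1 h))

/-- The absolutely continuous representative, which gives access to the boundary values. -/
theorem exists_eq_constL2_add_primL2 (hab : a < b) {y y' : L2 a b n} (h : IsWeakDeriv 1 y y') :
    ∃ c, y = constL2 a b n c + primL2 a b n y' ∧
      ∀ t ∈ Icc a b, contRep y t = c + prim y' t := by
  rw [isWeakDeriv_iff, pow_one] at h
  obtain ⟨c, hc⟩ := exists_of_distDeriv_eq_toDist hab _ _ h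
  have hy := toDist_injective hc
  refine ⟨c, hy, fun t ht => contRep_eq hab (continuous_const.add (continuous_prim y')).continuousOn
    ?_ ht⟩
  rw [hy]
  exact coeFn_constL2_add_primL2 c y'

/-- Integration by parts. -/
theorem inner_add_inner_of_isWeakDeriv (hab : a < b) {y y' z z' : L2 a b n}
    (hy : IsWeakDeriv 1 y y') (hz : IsWeakDeriv 1 z z') :
    ⟪y', z⟫_ℂ + ⟪y, z'⟫_ℂ =
      ⟪contRep y b, contRep z b⟫_ℂ - ⟪contRep y a, contRep z a⟫_ℂ := by
  obtain ⟨c, hc, hcr⟩ := exists_eq_constL2_add_primL2 hab hy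
  obtain ⟨d, hd, hdr⟩ := exists_eq_constL2_add_primL2 hab hz
  rw [hcr b (right_mem_Icc.2 hab.le), hcr a (left_mem_Icc.2 hab.le),
    hdr b (right_mem_Icc.2 hab.le), hdr a (left_mem_Icc.2 hab.le), prim_left, prim_left, add_zero,
    add_zero, ← inner_add_inner_primL2 hab.le, ← hc, ← hd]

theorem IsWeakDeriv.mapL2 {j : ℕ} {x y : L2 a b n} (h : IsWeakDeriv j x y)
    (T : EuclideanSpace ℂ (Fin n) →L[ℂ] EuclideanSpace ℂ (Fin m)) :
    IsWeakDeriv j (mapL2 a b T x) (mapL2 a b T y) := by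
  intro φ
  rw [inner_mapL2_left, inner_mapL2_left, mapL2_testToL2, mapL2_testToL2, h, testDeriv_mapTest]

theorem contRep_mapL2 (hab : a < b) {y y' : L2 a b n} (h : IsWeakDeriv 1 y y')
    (T : EuclideanSpace ℂ (Fin n) →L[ℂ] EuclideanSpace ℂ (Fin m)) {t : ℝ} (ht : t ∈ Icc a b) :
    contRep (mapL2 a b T y) t = T (contRep y t) := by
  obtain ⟨c, hc, hcr⟩ := exists_eq_constL2_add_primL2 hab h
  rw [hcr t ht]
  have hcont : Continuous fun t => T (c + prim y' t) :=
    T.continuous.comp (continuous_const.add (continuous_prim y'))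
  refine contRep_eq hab hcont.continuousOn ?_ ht
  filter_upwards [coeFn_mapL2 T y, coeFn_constL2_add_primL2 c y'] with s h1 h2
  rw [h1, ← h2, ← hc]

theorem isWeakDeriv_weakDeriv {k : ℕ} {x : L2 a b n}
    (hx : x ∈ sobolevSpace a b n k) {j : ℕ} (hj : j ≤ k) : IsWeakDeriv j x (weakDeriv j x) := by
  obtain ⟨u, hu, rfl⟩ := hx
  have := hu ⟨j, Nat.lt_succ_of_le hj⟩
  rw [LinearMap.proj_apply, weakDeriv_eq this]
  exact this

theorem isWeakDeriv_weakDeriv_succ {k : ℕ} {x : L2 a b n}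
    (hx : x ∈ sobolevSpace a b n k) {j : ℕ} (hj : j < k) :
    IsWeakDeriv 1 (weakDeriv j x) (weakDeriv (j + 1) x) := by
  have h1 := (isWeakDeriv_iff _ _ _).1 (isWeakDeriv_weakDeriv hx hj.le)
  have h2 := (isWeakDeriv_iff _ _ _).1 (isWeakDeriv_weakDeriv hx (Nat.succ_le_of_lt hj))
  rw [isWeakDeriv_iff, ← h1, ← h2, pow_one, Nat.succ_eq_add_one, pow_succ', Module.End.mul_apply]

/-- The vector `(x(t), x'(t), …, x^(k-1)(t))`. -/
def jetAt (k : ℕ) (t : ℝ) (x : L2 a b n) : Fin k × Fin n → ℂ :=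
  fun r => contRep (weakDeriv r.1 x) t r.2

theorem trace_eq (k : ℕ) (x : L2 a b n) : trace k x = Sum.elim (jetAt k b x) (jetAt k a x) := rfl

end Traces

section GreenIdentity

variable {a b : ℝ} {n N : ℕ}

/-- The pointwise action of a matrix on `L²`. -/
abbrev matL2 (a b : ℝ) (C : Matrix (Fin n) (Fin n) ℂ) : L2 a b n →L[ℂ] L2 a b n :=
  mapL2 a b (Matrix.toEuclideanCLM (𝕜 := ℂ) C)

theorem vecDist_matL2 (C : Matrix (Fin n) (Fin n) ℂ) (x : L2 a b n) (i : Fin n) :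
    vecDist (matL2 a b C x) i = ∑ j, C i j • vecDist x j := by
  have h : coordE i ∘L Matrix.toEuclideanCLM (𝕜 := ℂ) C = ∑ j, C i j • coordE (n := n) j := by
    ext v k
    simp only [ContinuousLinearMap.comp_apply, coordE_apply, Matrix.ofLp_toEuclideanCLM,
      _root_.sum_apply, WithLp.ofLp_sum, Finset.sum_apply, Matrix.mulVec, dotProduct]
    rfl
  rw [vecDist_apply, mapL2_mapL2, h, mapL2_sum, map_sum]
  refine Finset.sum_congr rfl fun j _ => ?_
  rw [mapL2_smul, map_smul, vecDist_apply]

theorem coeff_fin (C : Fin (N + 1) → Matrix (Fin n) (Fin n) ℂ) (k : Fin (N + 1)) :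
    coeff C k = C k := by
  rw [coeff, dif_pos k.2]

theorem vecDist_sum_weakDeriv (C : Fin (N + 1) → Matrix (Fin n) (Fin n) ℂ)
    {x : L2 a b n} (hx : x ∈ sobolevSpace a b n (2 * N)) :
    vecDist (∑ k ∈ Finset.range (N + 1), matL2 a b (coeff C k) (weakDeriv (2 * k) x)) =
      polyAct (distD2 a b) (symbol C) (vecDist x) := by
  ext1 i
  rw [Finset.sum_range, map_sum, Finset.sum_apply, polyAct_apply]
  simp only [vecDist_matL2, symbol_apply, map_sum, LinearMap.sum_apply, coeff_fin]
  rw [Finset.sum_comm]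
  refine Finset.sum_congr rfl fun j _ => Finset.sum_congr rfl fun k _ => ?_
  have h1 := (isWeakDeriv_iff_vecDist _ _ _).1 (isWeakDeriv_weakDeriv hx
    (show 2 * (k : ℕ) ≤ 2 * N by have := k.2; omega)) j
  rw [aeval_monomial, Module.End.mul_apply, ← pow_mul, h1]
  rfl

theorem column_of_mem_sobolevSpace (P S : Fin (N + 1) → Matrix (Fin n) (Fin n) ℂ)
    (x : colDomain (maxOp a b P) (maxOp a b S))
    (hx : (x : L2 a b n) ∈ sobolevSpace a b n (2 * N)) :
    column (maxOp a b P) (maxOp a b S) x =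
      (∑ k ∈ Finset.range (N + 1), matL2 a b (coeff P k) (weakDeriv (2 * k) (x : L2 a b n)),
        ∑ k ∈ Finset.range (N + 1), matL2 a b (coeff S k) (weakDeriv (2 * k) (x : L2 a b n))) := by
  refine Prod.ext (vecDist_injective ?_) (vecDist_injective ?_)
  · rw [← polyAct_vecDist_fst, vecDist_sum_weakDeriv P hx]
  · rw [← polyAct_vecDist_snd, vecDist_sum_weakDeriv S hx]

/-- The form `(x, y) ↦ ⟨x^(i), C y^(j)⟩` on `L²`. -/
def derivForm (x y : L2 a b n) (C : Matrix (Fin n) (Fin n) ℂ) (i j : ℕ) : ℂ :=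
  ⟪weakDeriv i x, matL2 a b C (weakDeriv j y)⟫_ℂ

/-- The form `(x, y) ↦ ⟨x^(i)(t), C y^(j)(t)⟩`. -/
def pointForm (x y : L2 a b n) (t : ℝ) (C : Matrix (Fin n) (Fin n) ℂ) (i j : ℕ) : ℂ :=
  ⟪contRep (weakDeriv i x) t, Matrix.toEuclideanCLM (𝕜 := ℂ) C (contRep (weakDeriv j y) t)⟫_ℂ

theorem derivForm_succ_add (hab : a < b) {k : ℕ} {x y : L2 a b n} (hx : x ∈ sobolevSpace a b n k)
    (hy : y ∈ sobolevSpace a b n k) (C : Matrix (Fin n) (Fin n) ℂ) {i j : ℕ} (hi : i < k)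
    (hj : j < k) :
    derivForm x y C (i + 1) j + derivForm x y C i (j + 1) =
      pointForm x y b C i j - pointForm x y a C i j := by
  have hyj := isWeakDeriv_weakDeriv_succ hy hj
  rw [derivForm, derivForm, inner_add_inner_of_isWeakDeriv hab
    (isWeakDeriv_weakDeriv_succ hx hi) (hyj.mapL2 _),
    contRep_mapL2 hab hyj _ (right_mem_Icc.2 hab.le), contRep_mapL2 hab hyj _
    (left_mem_Icc.2 hab.le)]
  rfl

/-- `F i j` stands for `⟨x^(i), C y^(j)⟩` and `G` for its boundary term. Moving `l` derivatives to
the second slot one at a time gives alternating boundary terms. -/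
theorem iterated_integration_by_parts {F G : ℕ → ℕ → ℂ} {M : ℕ}
    (h : ∀ i j, i < M → j < M → F (i + 1) j + F i (j + 1) = G i j) (l : ℕ) :
    ∀ i j, i + l ≤ M → j + l ≤ M → F (i + l) j =
      ∑ k ∈ Finset.range l, (-1) ^ k * G (i + l - 1 - k) (j + k) + (-1) ^ l * F i (j + l) := by
  induction l with
  | zero => intro i j _ _; simp
  | succ l ih =>
    intro i j hi hj
    have h1 := h (i + l) j (by omega) (by omega)
    have h2 := ih i (j + 1) (by omega) (by omega)
    rw [Finset.sum_range_succ']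
    have h3 : ∑ k ∈ Finset.range l, (-1) ^ (k + 1) * G (i + (l + 1) - 1 - (k + 1)) (j + (k + 1)) =
        -∑ k ∈ Finset.range l, (-1) ^ k * G (i + l - 1 - k) (j + 1 + k) := by
      rw [← Finset.sum_neg_distrib]
      refine Finset.sum_congr rfl fun k _ => ?_
      rw [show i + (l + 1) - 1 - (k + 1) = i + l - 1 - k by omega,
        show j + (k + 1) = j + 1 + k by omega]
      ring
    rw [h3, show i + (l + 1) - 1 - 0 = i + l by omega, show i + (l + 1) = i + l + 1 by omega,
      show j + (l + 1) = j + 1 + l by omega]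
    linear_combination h1 - h2

theorem iterated_integration_by_parts' {F G : ℕ → ℕ → ℂ} {M : ℕ}
    (h : ∀ i j, i < M → j < M → F (i + 1) j + F i (j + 1) = G i j) (l i j : ℕ) (hi : i + l ≤ M)
    (hj : j + l ≤ M) : F j (i + l) =
      ∑ k ∈ Finset.range l, (-1) ^ k * G (j + k) (i + l - 1 - k) + (-1) ^ l * F (j + l) i :=
  iterated_integration_by_parts (F := fun i j => F j i) (G := fun i j => G j i)
    (fun i j hi hj => by rw [← h j i hj hi, add_comm]) l i j hi hj

/-- The off-diagonal pairs are grouped by their distance `l` and larger index `i`; this matches the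
index set of the blocks `M_{lkm}` with `m = 2i - 1`. -/
theorem sum_range_sum_range_eq (h : ℕ → ℕ → ℂ) (N : ℕ) :
    ∑ k ∈ Finset.range (N + 1), ∑ l ∈ Finset.range (N + 1), h k l =
      ∑ k ∈ Finset.range (N + 1), h k k +
        ∑ l ∈ Finset.Icc 1 N, ∑ i ∈ Finset.Icc l N, (h i (i - l) + h (i - l) i) := by
  induction N with
  | zero => simp
  | succ N ih =>
    have h1 : ∑ l ∈ Finset.Icc 1 (N + 1), ∑ i ∈ Finset.Icc l (N + 1), (h i (i - l) + h (i - l) i) =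
        ∑ l ∈ Finset.Icc 1 N, ∑ i ∈ Finset.Icc l N, (h i (i - l) + h (i - l) i) +
          ∑ l ∈ Finset.Icc 1 (N + 1), (h (N + 1) (N + 1 - l) + h (N + 1 - l) (N + 1)) := by
      have h2 : ∀ l ∈ Finset.Icc 1 (N + 1),
          ∑ i ∈ Finset.Icc l (N + 1), (h i (i - l) + h (i - l) i) =
          ∑ i ∈ Finset.Icc l N, (h i (i - l) + h (i - l) i) +
            (h (N + 1) (N + 1 - l) + h (N + 1 - l) (N + 1)) := fun l hl =>
        Finset.sum_Icc_succ_top (Finset.mem_Icc.1 hl).2 _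
      rw [Finset.sum_congr rfl h2, Finset.sum_add_distrib, Finset.sum_Icc_succ_top (by omega)]
      simp
    have h3 : ∑ l ∈ Finset.Icc 1 (N + 1), (h (N + 1) (N + 1 - l) + h (N + 1 - l) (N + 1)) =
        ∑ l ∈ Finset.range (N + 1), (h (N + 1) l + h l (N + 1)) := by
      rw [← Finset.sum_range_reflect, Finset.sum_bij (fun l _ => l - 1)]
      · intro l hl
        have := Finset.mem_Icc.1 hl
        exact Finset.mem_range.2 (by omega)
      · intro l hl l' hl' hll
        have := Finset.mem_Icc.1 hl
        have := Finset.mem_Icc.1 hl'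
        omega
      · intro l hl
        have := Finset.mem_range.1 hl
        exact ⟨l + 1, Finset.mem_Icc.2 (by omega), by omega⟩
      · intro l hl
        have := Finset.mem_Icc.1 hl
        rw [show N + 1 - 1 - (l - 1) = N + 1 - l by omega]
    rw [h1, h3, Finset.sum_range_succ, Finset.sum_range_succ (fun k => h k k)]
    simp only [Finset.sum_range_succ _ (N + 1), Finset.sum_add_distrib]
    rw [ih]
    simp only [Finset.sum_add_distrib]
    ring

/-- The coefficient of the boundary form of `x ↦ ∑ ⟨S_k x^(2k), P_l y^(2l)⟩`. -/
theorem star_dotProduct_greenBlock (P S : Fin (N + 1) → Matrix (Fin n) (Fin n) ℂ)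
    (x y : L2 a b n) (t : ℝ) {l k i : ℕ} (hl : 1 ≤ l) (hk : k < l) (hli : l ≤ i) (hi : i ≤ N) :
    star (jetAt (2 * N) t x) ⬝ᵥ (greenBlock P S l k (2 * i - 1) *ᵥ jetAt (2 * N) t y) =
      (-1) ^ k * (pointForm x y t ((coeff S i)ᴴ * coeff P (i - l)) (2 * i - 1 - k)
          (2 * (i - l) + k) +
        pointForm x y t ((coeff S (i - l))ᴴ * coeff P i) (2 * (i - l) + k) (2 * i - 1 - k)) := by
  have hform : ∀ (C : Matrix (Fin n) (Fin n) ℂ) (p q : ℕ), pointForm x y t C p q =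
      ∑ r, ∑ s, star (contRep (weakDeriv p x) t r) * (C r s * contRep (weakDeriv q y) t s) := by
    intro C p q
    rw [pointForm, PiLp.inner_apply]
    refine Finset.sum_congr rfl fun r _ => ?_
    rw [Matrix.ofLp_toEuclideanCLM, ← Finset.mul_sum]
    simp [Matrix.mulVec, dotProduct, mul_comm]
  set p : Fin (2 * N) := ⟨2 * i - 1 - k, by omega⟩ with hp
  set q : Fin (2 * N) := ⟨2 * (i - l) + k, by omega⟩ with hq
  -- The two positions of the block differ because `k < l`, so the second case of the definition
  -- never hides behind the first.
  have hpq : p ≠ q := fun h => by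
    have := congrArg Fin.val h
    simp only [hp, hq] at this
    omega
  have hblock : ∀ r s, greenBlock P S l k (2 * i - 1) r s =
      if r.1 = p ∧ s.1 = q then (-1) ^ k * ((coeff S i)ᴴ * coeff P (i - l)) r.2 s.2
      else if r.1 = q ∧ s.1 = p then (-1) ^ k * ((coeff S (i - l))ᴴ * coeff P i) r.2 s.2
      else 0 := by
    intro r s
    rw [greenBlock, Matrix.of_apply, show (2 * i - 1 + 1) / 2 = i by omega,
      show (2 * i - 1 + 1 - 2 * l) / 2 = i - l by omega,
      show 2 * i - 1 + 1 - 2 * l + k = 2 * (i - l) + k by omega]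
    simp only [Fin.ext_iff, hp, hq]
  have hsum : star (jetAt (2 * N) t x) ⬝ᵥ (greenBlock P S l k (2 * i - 1) *ᵥ jetAt (2 * N) t y) =
      ∑ r₁, ∑ s₁, ∑ r₂, ∑ s₂, star (jetAt (2 * N) t x (r₁, r₂)) *
        (greenBlock P S l k (2 * i - 1) (r₁, r₂) (s₁, s₂) * jetAt (2 * N) t y (s₁, s₂)) := by
    simp only [dotProduct, Matrix.mulVec, Pi.star_apply, Finset.mul_sum, Fintype.sum_prod_type]
    exact Finset.sum_congr rfl fun r₁ _ => Finset.sum_comm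
  rw [hsum, mul_add, hform, hform]
  have hterm : ∀ r₁ s₁ : Fin (2 * N), ∑ r₂, ∑ s₂, star (jetAt (2 * N) t x (r₁, r₂)) *
      (greenBlock P S l k (2 * i - 1) (r₁, r₂) (s₁, s₂) * jetAt (2 * N) t y (s₁, s₂)) =
      (if r₁ = p ∧ s₁ = q then (-1) ^ k * ∑ r₂, ∑ s₂, star (jetAt (2 * N) t x (p, r₂)) *
        (((coeff S i)ᴴ * coeff P (i - l)) r₂ s₂ * jetAt (2 * N) t y (q, s₂)) else 0) +
      (if r₁ = q ∧ s₁ = p then (-1) ^ k * ∑ r₂, ∑ s₂, star (jetAt (2 * N) t x (q, r₂)) *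
        (((coeff S (i - l))ᴴ * coeff P i) r₂ s₂ * jetAt (2 * N) t y (p, s₂)) else 0) := by
    intro r₁ s₁
    simp only [hblock, Finset.mul_sum]
    by_cases h1 : r₁ = p ∧ s₁ = q
    · obtain ⟨rfl, rfl⟩ := h1
      rw [if_pos ⟨rfl, rfl⟩, if_neg (fun h => hpq h.1), add_zero]
      refine Finset.sum_congr rfl fun r₂ _ => Finset.sum_congr rfl fun s₂ _ => ?_
      rw [if_pos ⟨rfl, rfl⟩]
      ring
    · rw [if_neg h1, zero_add]
      by_cases h2 : r₁ = q ∧ s₁ = p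
      · obtain ⟨rfl, rfl⟩ := h2
        rw [if_pos ⟨rfl, rfl⟩]
        refine Finset.sum_congr rfl fun r₂ _ => Finset.sum_congr rfl fun s₂ _ => ?_
        rw [if_neg h1, if_pos ⟨rfl, rfl⟩]
        ring
      · rw [if_neg h2]
        refine Finset.sum_eq_zero fun r₂ _ => Finset.sum_eq_zero fun s₂ _ => ?_
        rw [if_neg h1, if_neg h2]
        ring
  simp only [hterm, Finset.sum_add_distrib, ite_and, Finset.sum_ite_eq', Finset.mem_univ, if_true,
    Finset.sum_ite_irrel, Finset.sum_const_zero]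
  rfl

/-- The sesquilinear form of the matrix `B^H` at the point `t`. -/
def greenForm (P S : Fin (N + 1) → Matrix (Fin n) (Fin n) ℂ) (t : ℝ) (x y : L2 a b n) : ℂ :=
  star (jetAt (2 * N) t x) ⬝ᵥ ((greenB P S)ᴴ *ᵥ jetAt (2 * N) t y)

theorem greenForm_eq (P S : Fin (N + 1) → Matrix (Fin n) (Fin n) ℂ) (t : ℝ) (x y : L2 a b n) :
    greenForm P S t x y = ∑ l ∈ Finset.Icc 1 N, ∑ i ∈ Finset.Icc l N, ∑ k ∈ Finset.range l,
      (-1) ^ k * (pointForm x y t ((coeff S i)ᴴ * coeff P (i - l)) (2 * i - 1 - k)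
          (2 * (i - l) + k) +
        pointForm x y t ((coeff S (i - l))ᴴ * coeff P i) (2 * (i - l) + k) (2 * i - 1 - k)) := by
  rw [greenForm, greenB, Matrix.conjTranspose_conjTranspose]
  simp only [Matrix.sum_mulVec, dotProduct_sum]
  refine Finset.sum_congr rfl fun l hl => ?_
  rw [Finset.sum_comm]
  refine Finset.sum_congr rfl fun i hi => Finset.sum_congr rfl fun k hk => ?_
  exact star_dotProduct_greenBlock P S x y t (Finset.mem_Icc.1 hl).1 (Finset.mem_range.1 hk)
    (Finset.mem_Icc.1 hi).1 (Finset.mem_Icc.1 hi).2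

theorem derivForm_add (x y : L2 a b n) (C D : Matrix (Fin n) (Fin n) ℂ) (i j : ℕ) :
    derivForm x y (C + D) i j = derivForm x y C i j + derivForm x y D i j := by
  rw [derivForm, matL2, map_add, mapL2_add, inner_add_right]
  rfl

theorem derivForm_zero (x y : L2 a b n) (i j : ℕ) : derivForm x y 0 i j = 0 := by
  rw [derivForm, matL2, map_zero, mapL2_zero, inner_zero_right]

theorem derivForm_sum {ι : Type*} (s : Finset ι) (x y : L2 a b n)
    (C : ι → Matrix (Fin n) (Fin n) ℂ) (i j : ℕ) :
    derivForm x y (∑ k ∈ s, C k) i j = ∑ k ∈ s, derivForm x y (C k) i j := by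
  classical
  induction s using Finset.induction_on with
  | empty => simp [derivForm_zero]
  | insert k s hk ih => rw [Finset.sum_insert hk, Finset.sum_insert hk, derivForm_add, ih]

theorem adjoint_toEuclideanCLM (C : Matrix (Fin n) (Fin n) ℂ) :
    ContinuousLinearMap.adjoint (Matrix.toEuclideanCLM (𝕜 := ℂ) C) =
      Matrix.toEuclideanCLM (𝕜 := ℂ) Cᴴ :=
  (map_star (Matrix.toEuclideanCLM (𝕜 := ℂ)) C).symm

theorem inner_matL2_matL2 (C D : Matrix (Fin n) (Fin n) ℂ) (x y : L2 a b n) :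
    ⟪matL2 a b C x, matL2 a b D y⟫_ℂ = ⟪x, matL2 a b (Cᴴ * D) y⟫_ℂ := by
  rw [inner_mapL2_left, adjoint_toEuclideanCLM, mapL2_mapL2, matL2, map_mul]
  rfl

theorem conj_derivForm (x y : L2 a b n) (C : Matrix (Fin n) (Fin n) ℂ) (i j : ℕ) :
    starRingEnd ℂ (derivForm y x C j i) = derivForm x y Cᴴ i j := by
  rw [derivForm, inner_conj_symm, inner_mapL2_left, adjoint_toEuclideanCLM]
  rfl

/-- The symmetric part of the form `(x, y) ↦ ⟨S x, P y⟩`. -/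
def symmForm (P S : Fin (N + 1) → Matrix (Fin n) (Fin n) ℂ) (x y : L2 a b n) : ℂ :=
  ∑ p ∈ Finset.range (2 * N + 1), (-1) ^ p *
    derivForm x y (∑ m ∈ Finset.range (p + 1), (coeff S m)ᴴ * coeff P (p - m)) p p

/-- The Hermitian condition makes this part of `⟨S x, P y⟩` drop out of the antisymmetrized Green
form. -/
theorem conj_symmForm {P S : Fin (N + 1) → Matrix (Fin n) (Fin n) ℂ} (hC : CoeffAssumption P S)
    (x y : L2 a b n) : starRingEnd ℂ (symmForm P S y x) = symmForm P S x y := by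
  rw [symmForm, map_sum, symmForm]
  refine Finset.sum_congr rfl fun p hp => ?_
  rw [map_mul, conj_derivForm,
    (hC.symmetric p (Nat.lt_succ_iff.1 (Finset.mem_range.1 hp))).eq]
  simp

theorem coeff_eq_zero (C : Fin (N + 1) → Matrix (Fin n) (Fin n) ℂ) {m : ℕ} (hm : N < m) :
    coeff C m = 0 := by
  rw [coeff, dif_neg (by omega)]

/-- The terms are collected by `p = k + l`; those with an index above `N` vanish by the convention
for the coefficients. -/
theorem symmForm_eq (P S : Fin (N + 1) → Matrix (Fin n) (Fin n) ℂ) (x y : L2 a b n) :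
    symmForm P S x y = ∑ k ∈ Finset.range (N + 1), ∑ l ∈ Finset.range (N + 1),
      (-1) ^ (k + l) * derivForm x y ((coeff S k)ᴴ * coeff P l) (k + l) (k + l) := by
  rw [← Finset.sum_product', ← Finset.sum_fiberwise_of_maps_to
    (g := fun z : ℕ × ℕ => z.1 + z.2) (t := Finset.range (2 * N + 1)), symmForm]
  · refine Finset.sum_congr rfl fun p _ => ?_
    rw [derivForm_sum, Finset.mul_sum, ← Finset.Nat.sum_antidiagonal_eq_sum_range_succ
      (fun k l => (-1) ^ p * derivForm x y ((coeff S k)ᴴ * coeff P l) p p)]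
    symm
    refine Finset.sum_subset_zero_on_sdiff (fun z hz => ?_) (fun z hz => ?_) (fun z hz => ?_)
    · exact Finset.HasAntidiagonal.mem_antidiagonal.2 (Finset.mem_filter.1 hz).2
    · simp only [Finset.mem_sdiff, Finset.HasAntidiagonal.mem_antidiagonal, Finset.mem_filter, Finset.mem_product,
        Finset.mem_range] at hz
      rcases lt_or_ge N z.1 with h | h
      · rw [coeff_eq_zero S h, Matrix.conjTranspose_zero, Matrix.zero_mul, derivForm_zero, mul_zero]
      · rw [coeff_eq_zero P (show N < z.2 by omega), Matrix.mul_zero, derivForm_zero, mul_zero]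
    · rw [(Finset.mem_filter.1 hz).2]
  · intro z hz
    simp only [Finset.mem_product, Finset.mem_range] at hz ⊢
    omega

/-- For each pair of orders `2i` and `2(i - l)`, moving `l` derivatives balances both at `2i - l`.
The balanced terms form `symmForm` and the boundary terms are the entries of the blocks `M_{lkm}`.
Diagonal terms are already balanced. -/
theorem sum_derivForm_eq (hab : a < b) (P S : Fin (N + 1) → Matrix (Fin n) (Fin n) ℂ)
    {x y : L2 a b n} (hx : x ∈ sobolevSpace a b n (2 * N)) (hy : y ∈ sobolevSpace a b n (2 * N)) :
    ∑ k ∈ Finset.range (N + 1), ∑ l ∈ Finset.range (N + 1),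
        derivForm x y ((coeff S k)ᴴ * coeff P l) (2 * k) (2 * l) =
      greenForm P S b x y - greenForm P S a x y + symmForm P S x y := by
  rw [sum_range_sum_range_eq, symmForm_eq, sum_range_sum_range_eq, greenForm_eq, greenForm_eq,
    ← Finset.sum_sub_distrib, add_left_comm, ← Finset.sum_add_distrib]
  refine congrArg₂ (· + ·) (Finset.sum_congr rfl fun k _ => ?_) ?_
  · rw [← two_mul, pow_mul]
    simp
  · refine Finset.sum_congr rfl fun l hl => ?_
    rw [← Finset.sum_sub_distrib, ← Finset.sum_add_distrib]
    refine Finset.sum_congr rfl fun i hi => ?_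
    have hl' := Finset.mem_Icc.1 hl
    have hi' := Finset.mem_Icc.1 hi
    have h1 := iterated_integration_by_parts (F := derivForm x y ((coeff S i)ᴴ * coeff P (i - l)))
      (M := 2 * N) (G := fun p q => pointForm x y b ((coeff S i)ᴴ * coeff P (i - l)) p q -
        pointForm x y a ((coeff S i)ᴴ * coeff P (i - l)) p q)
      (fun _ _ hp hq => derivForm_succ_add hab hx hy ((coeff S i)ᴴ * coeff P (i - l)) hp hq)
      l (2 * i - l) (2 * (i - l)) (by omega) (by omega)
    have h2 := iterated_integration_by_parts' (F := derivForm x y ((coeff S (i - l))ᴴ * coeff P i))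
      (M := 2 * N) (G := fun p q => pointForm x y b ((coeff S (i - l))ᴴ * coeff P i) p q -
        pointForm x y a ((coeff S (i - l))ᴴ * coeff P i) p q)
      (fun _ _ hp hq => derivForm_succ_add hab hx hy ((coeff S (i - l))ᴴ * coeff P i) hp hq)
      l (2 * i - l) (2 * (i - l)) (by omega) (by omega)
    rw [show 2 * i - l + l = 2 * i by omega, show 2 * (i - l) + l = l + 2 * (i - l) by omega,
      show 2 * i - l = l + 2 * (i - l) by omega] at h1 h2
    have hsign : (-1 : ℂ) ^ (l + 2 * (i - l)) = (-1) ^ l := by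
      rw [pow_add, pow_mul]
      simp
    rw [h1, h2, show i + (i - l) = l + 2 * (i - l) by omega,
      show i - l + i = l + 2 * (i - l) by omega, hsign]
    simp only [mul_sub, mul_add, Finset.sum_sub_distrib, Finset.sum_add_distrib]
    ring

theorem inner_sum_matL2_weakDeriv (P S : Fin (N + 1) → Matrix (Fin n) (Fin n) ℂ)
    (x y : L2 a b n) :
    ⟪∑ k ∈ Finset.range (N + 1), matL2 a b (coeff S k) (weakDeriv (2 * k) x),
        ∑ l ∈ Finset.range (N + 1), matL2 a b (coeff P l) (weakDeriv (2 * l) y)⟫_ℂ =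
      ∑ k ∈ Finset.range (N + 1), ∑ l ∈ Finset.range (N + 1),
        derivForm x y ((coeff S k)ᴴ * coeff P l) (2 * k) (2 * l) := by
  rw [sum_inner]
  refine Finset.sum_congr rfl fun k _ => ?_
  rw [inner_sum]
  refine Finset.sum_congr rfl fun l _ => ?_
  rw [inner_matL2_matL2, derivForm]

theorem inner_column_eq (hab : a < b) (P S : Fin (N + 1) → Matrix (Fin n) (Fin n) ℂ)
    (x y : colDomain (maxOp a b P) (maxOp a b S))
    (hx : (x : L2 a b n) ∈ sobolevSpace a b n (2 * N))
    (hy : (y : L2 a b n) ∈ sobolevSpace a b n (2 * N)) :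
    ⟪(column (maxOp a b P) (maxOp a b S) x).2, (column (maxOp a b P) (maxOp a b S) y).1⟫_ℂ =
      greenForm P S b (x : L2 a b n) y - greenForm P S a (x : L2 a b n) y +
        symmForm P S (x : L2 a b n) y := by
  rw [column_of_mem_sobolevSpace P S x hx, column_of_mem_sobolevSpace P S y hy,
    inner_sum_matL2_weakDeriv, sum_derivForm_eq hab P S hx hy]

/-- The Green identity on `H^(2N)`. -/
theorem green_identity_sobolev (hab : a < b) {P S : Fin (N + 1) → Matrix (Fin n) (Fin n) ℂ}
    (hC : CoeffAssumption P S) (x y : colDomain (maxOp a b P) (maxOp a b S))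
    (hx : (x : L2 a b n) ∈ sobolevSpace a b n (2 * N))
    (hy : (y : L2 a b n) ∈ sobolevSpace a b n (2 * N)) :
    ⟪(column (maxOp a b P) (maxOp a b S) x).2, (column (maxOp a b P) (maxOp a b S) y).1⟫_ℂ -
        ⟪(column (maxOp a b P) (maxOp a b S) x).1, (column (maxOp a b P) (maxOp a b S) y).2⟫_ℂ =
      star (jetAt (2 * N) a (x : L2 a b n)) ⬝ᵥ (greenA P S *ᵥ jetAt (2 * N) a (y : L2 a b n)) -
      star (jetAt (2 * N) b (x : L2 a b n)) ⬝ᵥ (greenA P S *ᵥ jetAt (2 * N) b (y : L2 a b n)) := by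
  -- Exchanging `x` and `y` and conjugating turns the form of `B^H` into that of `B`. The difference
  -- is the form of `-A` at `b` minus that at `a`, which explains the order of the endpoints.
  have hconj : ∀ t, starRingEnd ℂ (greenForm P S t (y : L2 a b n) x) =
      star (jetAt (2 * N) t (x : L2 a b n)) ⬝ᵥ
        (greenB P S *ᵥ jetAt (2 * N) t (y : L2 a b n)) := by
    intro t
    rw [greenForm, starRingEnd_apply, ← Matrix.star_dotProduct_star, star_star,
      Matrix.star_mulVec, Matrix.conjTranspose_conjTranspose,
      ← Matrix.dotProduct_mulVec]
  rw [← inner_conj_symm (column (maxOp a b P) (maxOp a b S) x).1, inner_column_eq hab P S x y hx hy,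
    inner_column_eq hab P S y x hy hx, map_add, map_sub, conj_symmForm hC, hconj, hconj]
  simp only [greenA, Matrix.sub_mulVec, dotProduct_sub, greenForm]
  ring

end GreenIdentity

/-! ### Surjectivity of the trace operator -/

section Hermite

theorem eval_iterate_derivative_eq (p : ℂ[X]) (c : ℂ) (j : ℕ) :
    (derivative^[j] p).eval c = (j.factorial : ℂ) * (taylor c p).coeff j := by
  rw [taylor_coeff, ← factorial_smul_hasseDeriv, LinearMap.smul_apply, nsmul_eq_mul, eval_mul,
    eval_natCast]

theorem eval_iterate_derivative_mul_pow (q : ℂ[X]) (c : ℂ) {j k : ℕ} (hj : j < k) :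
    (derivative^[j] (q * (X - C c) ^ k)).eval c = 0 := by
  rw [eval_iterate_derivative_eq, taylor_mul, taylor_pow, map_sub, taylor_X, taylor_C,
    add_sub_cancel_right, coeff_mul_X_pow', if_neg (by omega), mul_zero]

theorem exists_polynomial_jet (c : ℂ) (k : ℕ) (α : ℕ → ℂ) :
    ∃ p : ℂ[X], ∀ j < k, (derivative^[j] p).eval c = α j := by
  refine ⟨∑ j ∈ Finset.range k, C (α j / (j.factorial : ℂ)) * (X - C c) ^ j, fun j hj => ?_⟩
  have h : taylor c (∑ j ∈ Finset.range k, C (α j / (j.factorial : ℂ)) * (X - C c) ^ j) =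
      ∑ j ∈ Finset.range k, C (α j / (j.factorial : ℂ)) * X ^ j := by
    rw [map_sum]
    refine Finset.sum_congr rfl fun j _ => ?_
    rw [taylor_mul, taylor_pow, map_sub, taylor_X, taylor_C, taylor_C, add_sub_cancel_right]
  rw [eval_iterate_derivative_eq, h, finsetSum_coeff, Finset.sum_eq_single j]
  · rw [coeff_C_mul_X_pow, if_pos rfl, mul_div_cancel₀]
    exact_mod_cast j.factorial_ne_zero
  · intro i _ hij
    rw [coeff_C_mul_X_pow, if_neg hij.symm]
  · intro h
    exact absurd (Finset.mem_range.2 hj) h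

/-- Hermite interpolation at two points. -/
theorem exists_polynomial_two_jets {c c' : ℂ} (hc : c ≠ c') (k : ℕ) (α β : ℕ → ℂ) :
    ∃ p : ℂ[X], ∀ j < k, (derivative^[j] p).eval c = α j ∧ (derivative^[j] p).eval c' = β j := by
  obtain ⟨f, hf⟩ := exists_polynomial_jet c k α
  obtain ⟨g, hg⟩ := exists_polynomial_jet c' k β
  -- The factor `v (X - c')^k` is `1` modulo `(X - c)^k` and `0` modulo `(X - c')^k`, and
  -- symmetrically for the other, so the two jets can be prescribed independently.
  obtain ⟨u, v, huv⟩ : IsCoprime ((X - C c) ^ k) ((X - C c') ^ k) :=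
    (pairwise_coprime_X_sub_C Function.injective_id hc).pow
  refine ⟨f * (v * (X - C c') ^ k) + g * (u * (X - C c) ^ k), fun j hj => ⟨?_, ?_⟩⟩
  · rw [show f * (v * (X - C c') ^ k) + g * (u * (X - C c) ^ k) =
        f + (g - f) * u * (X - C c) ^ k by linear_combination f * huv, iterate_map_add,
      eval_add, hf j hj, eval_iterate_derivative_mul_pow _ _ hj, add_zero]
  · rw [show f * (v * (X - C c') ^ k) + g * (u * (X - C c) ^ k) =
        g + (f - g) * v * (X - C c') ^ k by linear_combination g * huv, iterate_map_add,
      eval_add, hg j hj, eval_iterate_derivative_mul_pow _ _ hj, add_zero]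

variable {a b : ℝ} {n : ℕ}

/-- The curve with the polynomial components `p`. -/
def polyCurve (p : Fin n → ℂ[X]) (t : ℝ) : EuclideanSpace ℂ (Fin n) :=
  WithLp.toLp 2 fun i => (p i).eval (t : ℂ)

theorem continuous_polyCurve (p : Fin n → ℂ[X]) : Continuous (polyCurve p) :=
  (PiLp.continuous_toLp 2 _).comp (continuous_pi fun i =>
    (p i).continuous.comp Complex.continuous_ofReal)

theorem hasDerivAt_polyCurve (p : Fin n → ℂ[X]) (t : ℝ) :
    HasDerivAt (polyCurve p) (polyCurve (fun i => derivative (p i)) t) t := by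
  have h : HasDerivAt (fun (t : ℝ) (i : Fin n) => (p i).eval (t : ℂ))
      (fun i => (derivative (p i)).eval (t : ℂ)) t :=
    hasDerivAt_pi.2 fun i => ((p i).hasDerivAt (t : ℂ)).comp_ofReal
  exact ((PiLp.continuousLinearEquiv 2 ℝ
    (fun _ : Fin n => ℂ)).symm.toContinuousLinearMap.hasFDerivAt).comp_hasDerivAt t h

theorem isWeakDeriv_polyCurve (hab : a < b) (p : Fin n → ℂ[X]) (j : ℕ) :
    IsWeakDeriv j (contL2 a b (polyCurve p) (continuous_polyCurve p))
      (contL2 a b (polyCurve fun i => derivative^[j] (p i)) (continuous_polyCurve _)) := by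
  rw [isWeakDeriv_iff]
  induction j with
  | zero => rfl
  | succ j ih =>
    rw [pow_succ', Module.End.mul_apply, ih]
    simp only [Function.iterate_succ_apply']
    exact distDeriv_contL2 hab.le _ (hasDerivAt_polyCurve _) _

theorem exists_jetAt_eq (hab : a < b) (k : ℕ) (α β : Fin k × Fin n → ℂ) :
    ∃ x ∈ sobolevSpace a b n k, jetAt k a x = α ∧ jetAt k b x = β := by
  have h : ∀ i : Fin n, ∃ p : ℂ[X], ∀ j : Fin k,
      (derivative^[j] p).eval (a : ℂ) = α (j, i) ∧ (derivative^[j] p).eval (b : ℂ) = β (j, i) := by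
    intro i
    obtain ⟨p, hp⟩ := exists_polynomial_two_jets (c := (a : ℂ)) (c' := b)
      (by exact_mod_cast hab.ne) k (fun j => if h : j < k then α (⟨j, h⟩, i) else 0)
      (fun j => if h : j < k then β (⟨j, h⟩, i) else 0)
    exact ⟨p, fun j => by simpa using hp j j.2⟩
  choose p hp using h
  refine ⟨contL2 a b (polyCurve p) (continuous_polyCurve p), ⟨fun j => contL2 a b
    (polyCurve fun i => derivative^[j] (p i)) (continuous_polyCurve _),
    fun j => isWeakDeriv_polyCurve hab p j, rfl⟩, ?_, ?_⟩
  · ext r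
    rw [jetAt, weakDeriv_eq (isWeakDeriv_polyCurve hab p r.1),
      contRep_eq hab (continuous_polyCurve _).continuousOn (coeFn_contL2 _) (left_mem_Icc.2 hab.le)]
    exact (hp r.2 r.1).1
  · ext r
    rw [jetAt, weakDeriv_eq (isWeakDeriv_polyCurve hab p r.1),
      contRep_eq hab (continuous_polyCurve _).continuousOn (coeFn_contL2 _)
        (right_mem_Icc.2 hab.le)]
    exact (hp r.2 r.1).2

end Hermite

/-! ### The boundary map on `H^(2N)` -/

section BoundaryMap

theorem fromBlocks_mulVec_elim {ι κ : Type*} [Fintype ι] (U : Matrix ι κ ℂ) (p q : ι → ℂ) :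
    Matrix.fromBlocks Uᴴ 0 0 Uᴴ *ᵥ Sum.elim p q = Sum.elim (Uᴴ *ᵥ p) (Uᴴ *ᵥ q) := by
  simp [Matrix.fromBlocks_mulVec]

variable {κ : Type*} [Fintype κ] [DecidableEq κ]

theorem boundaryPair_elim (D : Matrix κ κ ℂ) (p q : κ → ℂ) :
    boundaryPair D (Sum.elim p q) =
      (WithLp.toLp 2 ((1 / (√2 : ℂ)) • (D *ᵥ (p - q))),
        WithLp.toLp 2 (-(1 / (√2 : ℂ)) • (p + q))) := by
  refine Prod.ext ?_ ?_
  · refine congrArg (WithLp.toLp 2) ?_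
    ext i
    simp [Matrix.fromBlocks_mulVec, Matrix.mulVec_add, Matrix.mulVec_neg, Matrix.neg_mulVec,
      sub_eq_add_neg]
  · refine congrArg (WithLp.toLp 2) ?_
    ext i
    simp [Matrix.fromBlocks_mulVec, Matrix.neg_mulVec]
    ring

theorem ofReal_sqrt_two_mul_self : (√2 : ℂ) * (√2 : ℂ) = 2 := by
  rw [← Complex.ofReal_mul, Real.mul_self_sqrt (by norm_num)]
  norm_num

theorem ofReal_sqrt_two_ne_zero : (√2 : ℂ) ≠ 0 := by
  intro h
  have := ofReal_sqrt_two_mul_self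
  rw [h] at this
  norm_num at this

theorem exists_boundaryPair_eq {D : Matrix κ κ ℂ} (hD : IsUnit D.det)
    (w : EuclideanSpace ℂ κ × EuclideanSpace ℂ κ) :
    ∃ p q : κ → ℂ, boundaryPair D (Sum.elim p q) = w := by
  -- The solution of `p - q = √2 D⁻¹ w₁` and `p + q = -√2 w₂`.
  refine ⟨((√2 : ℂ) / 2) • (D⁻¹ *ᵥ w.1.ofLp - w.2.ofLp),
    ((√2 : ℂ) / 2) • (-(D⁻¹ *ᵥ w.1.ofLp) - w.2.ofLp), ?_⟩
  have h0 := ofReal_sqrt_two_ne_zero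
  rw [boundaryPair_elim]
  refine Prod.ext ?_ ?_
  · rw [← smul_sub, show D⁻¹ *ᵥ w.1.ofLp - w.2.ofLp - (-(D⁻¹ *ᵥ w.1.ofLp) - w.2.ofLp) =
      (2 : ℂ) • (D⁻¹ *ᵥ w.1.ofLp) by rw [two_smul]; abel, Matrix.mulVec_smul, Matrix.mulVec_smul,
      Matrix.mulVec_mulVec, Matrix.mul_nonsing_inv D hD, Matrix.one_mulVec, smul_smul, smul_smul,
      show 1 / (√2 : ℂ) * ((√2 : ℂ) / 2) * 2 = 1 by field_simp, one_smul]
  · rw [← smul_add, show D⁻¹ *ᵥ w.1.ofLp - w.2.ofLp + (-(D⁻¹ *ᵥ w.1.ofLp) - w.2.ofLp) =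
      (-2 : ℂ) • w.2.ofLp by rw [neg_smul, two_smul]; abel, smul_smul, smul_smul,
      show -(1 / (√2 : ℂ)) * ((√2 : ℂ) / 2) * -2 = 1 by field_simp, one_smul]

/-- As `D` is skew-Hermitian, the left side is `-½` times the sum of the form of `D` on `(p + q, p'
- q')` and on `(p - q, p' + q')`; the mixed terms cancel. -/
theorem inner_boundaryPair {D : Matrix κ κ ℂ} (hD : Dᴴ = -D) (p q p' q' : κ → ℂ) :
    ⟪(boundaryPair D (Sum.elim p q)).2, (boundaryPair D (Sum.elim p' q')).1⟫_ℂ -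
        ⟪(boundaryPair D (Sum.elim p q)).1, (boundaryPair D (Sum.elim p' q')).2⟫_ℂ =
      star q ⬝ᵥ (D *ᵥ q') - star p ⬝ᵥ (D *ᵥ p') := by
  have hs : star (1 / (√2 : ℂ)) = 1 / (√2 : ℂ) := by simp
  have h2 : (1 / (√2 : ℂ)) * (1 / (√2 : ℂ)) = 1 / 2 := by
    rw [div_mul_div_comm, ofReal_sqrt_two_mul_self, one_mul]
  have hdot : ∀ v w : κ → ℂ, star (D *ᵥ v) ⬝ᵥ w = -(star v ⬝ᵥ (D *ᵥ w)) := by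
    intro v w
    rw [Matrix.star_mulVec, hD, Matrix.vecMul_neg, neg_dotProduct, ← Matrix.dotProduct_mulVec]
  have hin : ∀ v w : κ → ℂ, ⟪WithLp.toLp 2 v, WithLp.toLp 2 w⟫_ℂ = star v ⬝ᵥ w := fun v w => by
    rw [EuclideanSpace.inner_toLp_toLp, dotProduct_comm]
  rw [boundaryPair_elim, boundaryPair_elim]
  simp only [hin, star_smul, star_neg, hs, smul_dotProduct, dotProduct_smul, neg_smul, hdot,
    star_add, star_sub, neg_dotProduct, add_dotProduct, sub_dotProduct, dotProduct_add,
    dotProduct_sub, dotProduct_neg, Matrix.mulVec_sub, smul_eq_mul]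
  linear_combination (2 * star q ⬝ᵥ (D *ᵥ q') - 2 * star p ⬝ᵥ (D *ᵥ p')) * h2

theorem conjTranspose_greenA {n N : ℕ} (P S : Fin (N + 1) → Matrix (Fin n) (Fin n) ℂ) :
    (greenA P S)ᴴ = -greenA P S := by
  rw [greenA, Matrix.conjTranspose_sub, Matrix.conjTranspose_conjTranspose, neg_sub]

variable {a b : ℝ} {n N : ℕ}

/-- The boundary map `x ↦ (1/√2) [D, -D; -I, -I] [U^H, 0; 0, U^H] γ x`. -/
abbrev boundaryMap (D : Matrix κ κ ℂ) (U : Matrix (Fin (2 * N) × Fin n) κ ℂ) (x : L2 a b n) :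
    EuclideanSpace ℂ κ × EuclideanSpace ℂ κ :=
  boundaryPair D (Matrix.fromBlocks Uᴴ 0 0 Uᴴ *ᵥ trace (2 * N) x)

/-- Jets of the form `U q` and `U p` reach every pair `(q, p)`, because `Uᴴ U = 1`. -/
theorem exists_boundaryMap_eq (hab : a < b) {D : Matrix κ κ ℂ} (hD : IsUnit D.det)
    {U : Matrix (Fin (2 * N) × Fin n) κ ℂ} (hU : Uᴴ * U = 1)
    (w : EuclideanSpace ℂ κ × EuclideanSpace ℂ κ) :
    ∃ x ∈ sobolevSpace a b n (2 * N), boundaryMap D U x = w := by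
  obtain ⟨p, q, hpq⟩ := exists_boundaryPair_eq hD w
  obtain ⟨x, hx, hxa, hxb⟩ := exists_jetAt_eq hab (2 * N) (U *ᵥ q) (U *ᵥ p)
  refine ⟨x, hx, ?_⟩
  rw [boundaryMap, trace_eq, fromBlocks_mulVec_elim, hxa, hxb, Matrix.mulVec_mulVec,
    Matrix.mulVec_mulVec, hU, Matrix.one_mulVec, Matrix.one_mulVec, hpq]

theorem green_identity_boundaryMap (hab : a < b) {P S : Fin (N + 1) → Matrix (Fin n) (Fin n) ℂ}
    (hC : CoeffAssumption P S) {D : Matrix κ κ ℂ} {U : Matrix (Fin (2 * N) × Fin n) κ ℂ}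
    (hU : Uᴴ * U = 1) (hA : greenA P S = U * D * Uᴴ)
    (x y : colDomain (maxOp a b P) (maxOp a b S))
    (hx : (x : L2 a b n) ∈ sobolevSpace a b n (2 * N))
    (hy : (y : L2 a b n) ∈ sobolevSpace a b n (2 * N)) :
    ⟪(column (maxOp a b P) (maxOp a b S) x).2, (column (maxOp a b P) (maxOp a b S) y).1⟫_ℂ -
        ⟪(column (maxOp a b P) (maxOp a b S) x).1, (column (maxOp a b P) (maxOp a b S) y).2⟫_ℂ =
      ⟪(boundaryMap D U (x : L2 a b n)).2, (boundaryMap D U (y : L2 a b n)).1⟫_ℂ -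
        ⟪(boundaryMap D U (x : L2 a b n)).1, (boundaryMap D U (y : L2 a b n)).2⟫_ℂ := by
  -- `D` inherits skew-Hermitian symmetry from `A`.
  have hDA : D = Uᴴ * greenA P S * U := by
    rw [hA, Matrix.mul_assoc, Matrix.mul_assoc, hU, Matrix.mul_one, ← Matrix.mul_assoc, hU,
      Matrix.one_mul]
  have hD : Dᴴ = -D := by
    rw [hDA, Matrix.conjTranspose_mul, Matrix.conjTranspose_mul, conjTranspose_greenA,
      Matrix.conjTranspose_conjTranspose]
    simp [Matrix.mul_assoc]
  have hform : ∀ u v : Fin (2 * N) × Fin n → ℂ,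
      star (Uᴴ *ᵥ u) ⬝ᵥ (D *ᵥ (Uᴴ *ᵥ v)) = star u ⬝ᵥ (greenA P S *ᵥ v) := by
    intro u v
    rw [Matrix.star_mulVec, Matrix.conjTranspose_conjTranspose, ← Matrix.dotProduct_mulVec,
      Matrix.mulVec_mulVec, Matrix.mulVec_mulVec, hA]
  rw [green_identity_sobolev hab hC x y hx hy, boundaryMap, boundaryMap, trace_eq, trace_eq,
    fromBlocks_mulVec_elim, fromBlocks_mulVec_elim, inner_boundaryPair hD, hform, hform]

end BoundaryMap

/-! ### The reduced factorization -/

/-- `i A` is Hermitian. In its spectral decomposition the zero eigenvalues are dropped, which leaves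
`rk A` columns, and the remaining eigenvalues are multiplied by `-i`. -/
theorem exists_isReducedFactorization {ι : Type*} [Fintype ι] [DecidableEq ι] {A : Matrix ι ι ℂ}
    (hA : Aᴴ = -A) :
    ∃ (U : Matrix ι (Fin A.rank) ℂ) (d : Fin A.rank → ℂ), IsReducedFactorization A U d := by
  have hH : (Complex.I • A).IsHermitian := by
    rw [Matrix.IsHermitian, Matrix.conjTranspose_smul, hA]
    simp
  have hrank : A.rank = Fintype.card {i // hH.eigenvalues i ≠ 0} := by
    rw [← hH.rank_eq_card_non_zero_eigs, Matrix.rank_smul_of_mem_nonZeroDivisors]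
    exact mem_nonZeroDivisors_of_ne_zero Complex.I_ne_zero
  let e : Fin A.rank ≃ {i // hH.eigenvalues i ≠ 0} :=
    (finCongr hrank).trans (Fintype.equivFin _).symm
  let V : Matrix ι ι ℂ := hH.eigenvectorUnitary
  have hV : Vᴴ * V = 1 := Unitary.coe_star_mul_self hH.eigenvectorUnitary
  have hspec : Complex.I • A = V * Matrix.diagonal (fun i => (hH.eigenvalues i : ℂ)) * Vᴴ :=
    hH.spectral_theorem
  refine ⟨V.submatrix id fun i => (e i : ι), fun i => -Complex.I * (hH.eigenvalues (e i) : ℂ),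
    ?_, fun i => ?_, ?_⟩
  · ext i j
    have := congrFun (congrFun hV (e i)) (e j)
    rw [Matrix.mul_apply] at this ⊢
    rw [Matrix.conjTranspose_submatrix]
    simp only [Matrix.submatrix_apply, id] at this ⊢
    rw [this, Matrix.one_apply, Matrix.one_apply]
    simp [Subtype.coe_inj]
  · simpa using (e i).2
  · ext i j
    have h1 : A i j = -Complex.I * (Complex.I • A) i j := by
      rw [Matrix.smul_apply, smul_eq_mul, ← mul_assoc]
      simp
    have h2 := congrFun (congrFun hspec i) j
    rw [h1, h2, Matrix.mul_apply, Matrix.mul_apply]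
    simp only [Matrix.mul_diagonal, Matrix.submatrix_apply,
      Matrix.conjTranspose_apply, id, Finset.mul_sum]
    symm
    refine Fintype.sum_of_injective (fun k => (e k : ι)) (Subtype.val_injective.comp e.injective) _
      _ (fun k hk => ?_) (fun k => by ring)
    have : hH.eigenvalues k = 0 := by
      by_contra hne
      exact hk ⟨e.symm ⟨k, hne⟩, by simp⟩
    rw [this]
    simp

/-! ### Extension of the boundary map to the whole domain -/

section Extension

variable {κ : Type*} [Fintype κ] [DecidableEq κ] {a b : ℝ} {n N : ℕ}

theorem norm_column_le {X : Type*} [NormedAddCommGroup X] [InnerProductSpace ℂ X]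
    (P S : X →ₗ.[ℂ] X) (x : colDomain P S) : ‖column P S x‖ ≤ columnNorm P S x :=
  max_le (norm_fst_le_columnNorm P S x) (norm_snd_le_columnNorm P S x)

/-- The functional `v ↦ ⟨u₂, v₁⟩ - ⟨u₁, v₂⟩`. -/
def greenFunctional {X : Type*} [NormedAddCommGroup X] [InnerProductSpace ℂ X] (u : X × X) :
    X × X →L[ℂ] ℂ :=
  innerSL ℂ u.2 ∘L ContinuousLinearMap.fst ℂ X X - innerSL ℂ u.1 ∘L ContinuousLinearMap.snd ℂ X X

theorem greenFunctional_apply {X : Type*} [NormedAddCommGroup X] [InnerProductSpace ℂ X]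
    (u v : X × X) : greenFunctional u v = ⟪u.2, v.1⟫_ℂ - ⟪u.1, v.2⟫_ℂ := rfl

theorem greenFunctional_eq_of_mem_closure {X E : Type*} [NormedAddCommGroup X]
    [InnerProductSpace ℂ X] [NormedAddCommGroup E] [InnerProductSpace ℂ E]
    (L : X × X →L[ℂ] E × E) {s : Set (X × X)}
    (h : ∀ u ∈ s, ∀ v ∈ s, greenFunctional u v = greenFunctional (L u) (L v)) {u v : X × X}
    (hu : u ∈ closure s) (hv : v ∈ closure s) :
    greenFunctional u v = greenFunctional (L u) (L v) := by
  have hclosed : IsClosed {z : (X × X) × (X × X) |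
      greenFunctional z.1 z.2 = greenFunctional (L z.1) (L z.2)} := by
    simp only [greenFunctional_apply]
    exact isClosed_eq (by fun_prop) (by fun_prop)
  have hmem : (u, v) ∈ closure (s ×ˢ s) := by
    rw [closure_prod_eq]
    exact ⟨hu, hv⟩
  exact closure_minimal (fun z hz => h z.1 hz.1 z.2 hz.2) hclosed hmem

theorem column_mem_closure (hab : a < b) {P S : Fin (N + 1) → Matrix (Fin n) (Fin n) ℂ}
    (hcoer : IsCoerciveColumn (maxOp a b P) (maxOp a b S))
    (x : colDomain (maxOp a b P) (maxOp a b S)) :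
    column (maxOp a b P) (maxOp a b S) x ∈ closure (column (maxOp a b P) (maxOp a b S) ''
      {x | (x : L2 a b n) ∈ sobolevSpace a b n (2 * N)}) := by
  refine Metric.mem_closure_iff.2 fun ε hε => ?_
  obtain ⟨x', hx', h⟩ := exists_sobolevSpace_columnNorm_sub_lt hab hcoer x hε
  refine ⟨_, ⟨x', hx', rfl⟩, ?_⟩
  rw [dist_eq_norm, ← map_sub]
  exact (norm_column_le _ _ _).trans_lt h

/-- The boundary map on `H^(2N)` is a continuous function of `(P x, S x)`. -/
theorem exists_boundaryMap_eq_column (hab : a < b)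
    {P S : Fin (N + 1) → Matrix (Fin n) (Fin n) ℂ} (hC : CoeffAssumption P S)
    {D : Matrix κ κ ℂ} (hD : IsUnit D.det) {U : Matrix (Fin (2 * N) × Fin n) κ ℂ}
    (hU : Uᴴ * U = 1) (hA : greenA P S = U * D * Uᴴ) :
    ∃ L : L2 a b n × L2 a b n →L[ℂ] EuclideanSpace ℂ κ × EuclideanSpace ℂ κ,
      ∀ x : colDomain (maxOp a b P) (maxOp a b S), (x : L2 a b n) ∈ sobolevSpace a b n (2 * N) →
        L (column (maxOp a b P) (maxOp a b S) x) = boundaryMap D U (x : L2 a b n) := by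
  have h : ∀ w : EuclideanSpace ℂ κ × EuclideanSpace ℂ κ,
      ∃ y : colDomain (maxOp a b P) (maxOp a b S), (y : L2 a b n) ∈ sobolevSpace a b n (2 * N) ∧
        boundaryMap D U (y : L2 a b n) = w := by
    intro w
    obtain ⟨x, hx, hxw⟩ := exists_boundaryMap_eq hab hD hU w
    exact ⟨⟨x, sobolevSpace_le_colDomain hab P S hx⟩, hx, hxw⟩
  choose y hy hyw using h
  -- The Green form against a fixed `y w` with boundary values `w` is a bounded functional of `(P x,
  -- S x)`. By the Green identity, unit vectors in the second slot of `w` read off the coordinates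
  -- of `Γ₀ x`, and in the first slot those of `-Γ₁ x`.
  let ω (w : EuclideanSpace ℂ κ × EuclideanSpace ℂ κ) : L2 a b n × L2 a b n →L[ℂ] ℂ :=
    greenFunctional (column (maxOp a b P) (maxOp a b S) (y w))
  let e : (κ → ℂ) →L[ℂ] EuclideanSpace ℂ κ :=
    (PiLp.continuousLinearEquiv 2 ℂ (fun _ : κ => ℂ)).symm.toContinuousLinearMap
  refine ⟨(e ∘L ContinuousLinearMap.pi fun i => ω (0, EuclideanSpace.single i 1)).prod
    (e ∘L ContinuousLinearMap.pi fun i => -ω (EuclideanSpace.single i 1, 0)), fun x hx => ?_⟩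
  have hω : ∀ w, ω w (column (maxOp a b P) (maxOp a b S) x) =
      ⟪w.2, (boundaryMap D U (x : L2 a b n)).1⟫_ℂ -
        ⟪w.1, (boundaryMap D U (x : L2 a b n)).2⟫_ℂ := by
    intro w
    rw [greenFunctional_apply, green_identity_boundaryMap hab hC hU hA (y w) x (hy w) hx, hyw]
  refine Prod.ext ?_ ?_
  · ext i
    change ω _ _ = _
    rw [hω, inner_zero_left, EuclideanSpace.inner_single_left]
    simp
  · ext i
    change -ω _ _ = _
    rw [hω, inner_zero_left, EuclideanSpace.inner_single_left]
    simp

/-- The boundary map has exactly one bounded extension, which is a boundary triplet. -/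
theorem exists_extension_boundaryMap (hab : a < b)
    {P S : Fin (N + 1) → Matrix (Fin n) (Fin n) ℂ}
    (hcoer : IsCoerciveColumn (maxOp a b P) (maxOp a b S)) (hC : CoeffAssumption P S)
    {D : Matrix κ κ ℂ} (hD : IsUnit D.det) {U : Matrix (Fin (2 * N) × Fin n) κ ℂ}
    (hU : Uᴴ * U = 1) (hA : greenA P S = U * D * Uᴴ) :
    ∃ Γ : colDomain (maxOp a b P) (maxOp a b S) →ₗ[ℂ]
        EuclideanSpace ℂ κ × EuclideanSpace ℂ κ,
      (∃ c : ℝ, ∀ x, ‖Γ x‖ ≤ c * columnNorm (maxOp a b P) (maxOp a b S) x) ∧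
      (∀ x : colDomain (maxOp a b P) (maxOp a b S), (x : L2 a b n) ∈ sobolevSpace a b n (2 * N) →
        Γ x = boundaryMap D U (x : L2 a b n)) ∧
      IsBoundaryTriplet (maxOp a b P) (maxOp a b S) Γ := by
  obtain ⟨L, hL⟩ := exists_boundaryMap_eq_column hab hC hD hU hA
  refine ⟨L.toLinearMap ∘ₗ column (maxOp a b P) (maxOp a b S), ⟨‖L‖, fun x => ?_⟩, hL,
    fun w => ?_, fun x y => ?_⟩
  · exact (L.le_opNorm _).trans
      (mul_le_mul_of_nonneg_left (norm_column_le _ _ _) (norm_nonneg _))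
  · obtain ⟨x, hx, hxw⟩ := exists_boundaryMap_eq hab hD hU w
    exact ⟨⟨x, sobolevSpace_le_colDomain hab P S hx⟩, (hL ⟨x, _⟩ hx).trans hxw⟩
  -- Both sides of the Green identity are continuous in the pairs `(P x, S x)`, so it passes from
  -- `H^(2N)` to the domain by density.
  · have h : ∀ u ∈ column (maxOp a b P) (maxOp a b S) ''
        {x | (x : L2 a b n) ∈ sobolevSpace a b n (2 * N)},
        ∀ v ∈ column (maxOp a b P) (maxOp a b S) ''
          {x | (x : L2 a b n) ∈ sobolevSpace a b n (2 * N)},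
        greenFunctional u v = greenFunctional (L u) (L v) := by
      rintro _ ⟨x, hx, rfl⟩ _ ⟨y, hy, rfl⟩
      rw [hL x hx, hL y hy, greenFunctional_apply, greenFunctional_apply]
      exact green_identity_boundaryMap hab hC hU hA x y hx hy
    have key := greenFunctional_eq_of_mem_closure L h (column_mem_closure hab hcoer x)
      (column_mem_closure hab hcoer y)
    rw [greenFunctional_apply, greenFunctional_apply] at key
    exact key

theorem eq_of_bounded_of_eqOn_sobolevSpace (hab : a < b)
    {P S : Fin (N + 1) → Matrix (Fin n) (Fin n) ℂ}
    (hcoer : IsCoerciveColumn (maxOp a b P) (maxOp a b S)) {E : Type*} [NormedAddCommGroup E]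
    [NormedSpace ℂ E] {Γ Γ' : colDomain (maxOp a b P) (maxOp a b S) →ₗ[ℂ] E} {c c' : ℝ}
    (hΓ : ∀ x, ‖Γ x‖ ≤ c * columnNorm (maxOp a b P) (maxOp a b S) x)
    (hΓ' : ∀ x, ‖Γ' x‖ ≤ c' * columnNorm (maxOp a b P) (maxOp a b S) x)
    (h : ∀ x : colDomain (maxOp a b P) (maxOp a b S),
      (x : L2 a b n) ∈ sobolevSpace a b n (2 * N) → Γ x = Γ' x) : Γ = Γ' := by
  ext1 x
  refine eq_of_forall_dist_le fun ε hε => ?_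
  have hc : 0 < |c| + |c'| + 1 := by positivity
  obtain ⟨x', hx', hlt⟩ := exists_sobolevSpace_columnNorm_sub_lt hab hcoer x
    (div_pos hε hc)
  have h0 : 0 ≤ columnNorm (maxOp a b P) (maxOp a b S) (x - x') := Real.sqrt_nonneg _
  rw [lt_div_iff₀ hc] at hlt
  calc dist (Γ x) (Γ' x) = ‖Γ (x - x') - Γ' (x - x')‖ := by
        rw [dist_eq_norm, map_sub, map_sub, h x' hx', sub_sub_sub_cancel_right]
    _ ≤ ‖Γ (x - x')‖ + ‖Γ' (x - x')‖ := norm_sub_le _ _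
    _ ≤ c * columnNorm (maxOp a b P) (maxOp a b S) (x - x') +
        c' * columnNorm (maxOp a b P) (maxOp a b S) (x - x') := add_le_add (hΓ _) (hΓ' _)
    _ ≤ ε := by nlinarith [le_abs_self c, le_abs_self c']

end Extension

/-! ### The case of full rank -/

section FullRank

theorem isUnit_det_of_rank_eq_card {ι : Type*} [Fintype ι] [DecidableEq ι] {A : Matrix ι ι ℂ}
    (h : A.rank = Fintype.card ι) : IsUnit A.det := by
  rw [← Matrix.isUnit_iff_isUnit_det, ← Matrix.mulVec_surjective_iff_isUnit]
  have : LinearMap.range A.mulVecLin = ⊤ := by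
    refine Submodule.eq_top_of_finrank_eq ?_
    rw [Module.finrank_fintype_fun_eq_card]
    exact h
  exact LinearMap.range_eq_top.1 this

variable {a b : ℝ} {n N : ℕ}

/-- If `P_N v = S_N v = 0`, then `v`, placed in the last block, is in the kernel of `A`. -/
theorem greenA_mulVec_eq_zero (P S : Fin (N + 1) → Matrix (Fin n) (Fin n) ℂ) (hN : N ≠ 0)
    {v : Fin n → ℂ} (hP : coeff P N *ᵥ v = 0) (hS : coeff S N *ᵥ v = 0) :
    greenA P S *ᵥ (fun r => if (r.1 : ℕ) = 2 * N - 1 then v r.2 else 0) = 0 := by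
  set w : Fin (2 * N) × Fin n → ℂ := fun r => if (r.1 : ℕ) = 2 * N - 1 then v r.2 else 0 with hw
  have hsum : ∀ (M : Matrix (Fin (2 * N) × Fin n) (Fin (2 * N) × Fin n) ℂ) r,
      (M *ᵥ w) r = ∑ s, M r (⟨2 * N - 1, by omega⟩, s) * v s := by
    intro M r
    rw [Matrix.mulVec, dotProduct, Fintype.sum_prod_type,
      Finset.sum_eq_single ⟨2 * N - 1, by omega⟩]
    · simp [hw]
    · intro s _ hs
      refine Finset.sum_eq_zero fun t _ => ?_
      rw [hw]
      simp only
      rw [if_neg fun h => hs (Fin.ext h), mul_zero]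
    · simp
  -- The block index `2N - 1` equals `2i - 1 - k` only for `i = N`, `k = 0`, and never equals `2(i -
  -- l) + k`, which is at most `2N - 2`. So the last block column meets only products ending in
  -- `P_N`, and that of the adjoint only products ending in `S_N`.
  have hblock : ∀ l k i, 1 ≤ l → k < l → l ≤ i → i ≤ N →
      greenBlock P S l k (2 * i - 1) *ᵥ w = 0 ∧ (greenBlock P S l k (2 * i - 1))ᴴ *ᵥ w = 0 := by
    intro l k i hl hk hli hi
    constructor
    · ext r
      rw [hsum]
      simp only [greenBlock, Matrix.of_apply, Pi.zero_apply]
      rw [Finset.sum_congr rfl fun s _ => by rw [if_neg (by omega)]]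
      split_ifs with h
      · have h1 := congrFun (congrArg (fun u => (coeff S ((2 * i - 1 + 1 - 2 * l) / 2))ᴴ *ᵥ u) hP)
          r.2
        simp only [Matrix.mulVec_mulVec, Matrix.mulVec_zero, Pi.zero_apply] at h1
        rw [show (2 * i - 1 + 1) / 2 = N by omega]
        simp only [mul_assoc, ← Finset.mul_sum]
        rw [Matrix.mulVec, dotProduct] at h1
        rw [h1, mul_zero]
      · simp
    · ext r
      rw [hsum]
      simp only [greenBlock, Matrix.conjTranspose_apply, Matrix.of_apply, Pi.zero_apply]
      by_cases h : 2 * N - 1 = 2 * i - 1 - k ∧ (r.1 : ℕ) = 2 * i - 1 + 1 - 2 * l + k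
      · have h1 := congrFun (congrArg (fun u => (coeff P ((2 * i - 1 + 1 - 2 * l) / 2))ᴴ *ᵥ u) hS)
          r.2
        simp only [Matrix.mulVec_mulVec, Matrix.mulVec_zero, Pi.zero_apply] at h1
        rw [Finset.sum_congr rfl fun s _ => by rw [if_pos h],
          show (2 * i - 1 + 1) / 2 = N by omega]
        have h2 : ∀ s, star ((-1) ^ k * ((coeff S N)ᴴ *
            coeff P ((2 * i - 1 + 1 - 2 * l) / 2)) s r.2) =
            (-1) ^ k * ((coeff P ((2 * i - 1 + 1 - 2 * l) / 2))ᴴ * coeff S N) r.2 s := by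
          intro s
          rw [← Matrix.conjTranspose_conjTranspose (coeff S N), ← Matrix.conjTranspose_mul,
            Matrix.conjTranspose_conjTranspose, Matrix.conjTranspose_apply]
          simp
        simp only [h2, mul_assoc, ← Finset.mul_sum]
        rw [Matrix.mulVec, dotProduct] at h1
        rw [h1, mul_zero]
      · refine Finset.sum_eq_zero fun s _ => ?_
        rw [if_neg h, if_neg (by omega)]
        simp
  have hsumblock : (greenB P S)ᴴ *ᵥ w = 0 ∧ greenB P S *ᵥ w = 0 := by
    rw [greenB, Matrix.conjTranspose_conjTranspose]
    simp only [Matrix.conjTranspose_sum, Matrix.sum_mulVec]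
    constructor <;>
    · refine Finset.sum_eq_zero fun l hl => Finset.sum_eq_zero fun k hk =>
        Finset.sum_eq_zero fun i hi => ?_
      have := hblock l k i (Finset.mem_Icc.1 hl).1 (Finset.mem_range.1 hk) (Finset.mem_Icc.1 hi).1
        (Finset.mem_Icc.1 hi).2
      simp [this.1, this.2]
  rw [greenA, Matrix.sub_mulVec, hsumblock.1, hsumblock.2, sub_zero]

/-- Invertibility of `A` makes `[P_N; S_N]` injective. Then `M` is column reduced as it stands, with
all column degrees `N`, and regularity applies directly to `x`. -/
theorem colDomain_eq_sobolevSpace (hab : a < b) {P S : Fin (N + 1) → Matrix (Fin n) (Fin n) ℂ}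
    (hC : CoeffAssumption P S) (hA : IsUnit (greenA P S).det) :
    colDomain (maxOp a b P) (maxOp a b S) = sobolevSpace a b n (2 * N) := by
  refine le_antisymm (fun x hx => ?_) (sobolevSpace_le_colDomain hab P S)
  -- For `N = 0` there are no two distinct indices; the last block `2N - 1` exists only for `N > 0`.
  have hN : N ≠ 0 := by
    rintro rfl
    obtain ⟨k, l, hkl, -⟩ := hC.nontrivial
    exact hkl (Fin.ext (by omega))
  obtain ⟨L, hL⟩ := exists_matrix_leftInverse (Matrix.fromRows (coeff P N) (coeff S N))
    (fun v hv => by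
      rw [Matrix.fromRows_mulVec] at hv
      have h0 := greenA_mulVec_eq_zero P S hN (v := v)
        (funext fun i => congrFun hv (Sum.inl i)) (funext fun i => congrFun hv (Sum.inr i))
      have h1 := Matrix.eq_zero_of_mulVec_eq_zero hA.ne_zero h0
      ext i
      simpa using congrFun h1 (⟨2 * N - 1, by omega⟩, i))
  have hcoeff : Matrix.fromRows (coeff P N) (coeff S N) =
      Matrix.of fun i j => (colSymbol P S i j).coeff N := by
    ext i j
    cases i <;> simp [coeff_symbol]
  rw [hcoeff] at hL
  rw [mem_sobolevSpace_iff hab]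
  intro i
  -- The bootstrap starts at `x ∈ L²`, that is, with deficit `K = N`.
  have := mem_sobolevScale_of_columnReduced hab (T := colSymbol P S) (d := fun _ => N) (L := L)
    (fun i j => by cases i <;> exact natDegree_symbol_le _ _ _) hL (y := vecDist x)
    (fun k => by
      have h := congrFun (polyAct_colSymbol P S ⟨x, hx⟩) k
      rw [h, sobolevScale_zero]
      cases k <;> exact ⟨_, rfl⟩) N
    (fun j => by
      rw [sub_self, sobolevScale_zero]
      exact ⟨_, rfl⟩) i
  exact_mod_cast this

end FullRank

/-! ### The closure of the kernel relation -/

section Closure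

/-- An injective bounded operator with closed range on a Banach space is a closed embedding by the
open mapping theorem, and closed embeddings commute with closures. -/
theorem closure_image_of_injOn {E F : Type*} [NormedAddCommGroup E] [NormedSpace ℂ E]
    [CompleteSpace E] [NormedAddCommGroup F] [NormedSpace ℂ F] [CompleteSpace F] (f : E →L[ℂ] F)
    {J : Submodule ℂ E} (hJ : IsClosed (J : Set E)) (hf : ∀ u ∈ J, f u = 0 → u = 0)
    (hran : IsClosed (f '' J)) {s : Set E} (hs : s ⊆ J) :
    closure (f '' s) = f '' closure s := by
  have : CompleteSpace J := hJ.completeSpace_coe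
  have hrange : Set.range (f ∘L J.subtypeL) = f '' J := by
    rw [ContinuousLinearMap.coe_comp, Set.range_comp]
    simp
  obtain ⟨K, hK⟩ := (f ∘L J.subtypeL).antilipschitz_of_injective_of_isClosed_range
    ((injective_iff_map_eq_zero _).2 fun u hu => Subtype.ext (hf u u.2 hu)) (hrange ▸ hran)
  have himage (t : Set J) : (f ∘L J.subtypeL) '' t = f '' (J.subtype '' t) :=
    (Set.image_image f J.subtype t).symm
  have hs' : J.subtype '' (J.subtype ⁻¹' s) = s := by
    ext u
    exact ⟨fun ⟨v, hv, hvu⟩ => hvu ▸ hv, fun hu => ⟨⟨u, hs hu⟩, hu, rfl⟩⟩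
  have h1 := (hK.isClosedEmbedding (f ∘L J.subtypeL).uniformContinuous).closure_image_eq
    (J.subtype ⁻¹' s)
  have h2 : closure (J.subtype '' (J.subtype ⁻¹' s)) = J.subtype '' closure (J.subtype ⁻¹' s) :=
    hJ.isClosedEmbedding_subtypeVal.closure_image_eq _
  rwa [himage, himage, ← h2, hs'] at h1

theorem isClosed_adjoint {X : Type*} [NormedAddCommGroup X] [InnerProductSpace ℂ X]
    (H : Submodule ℂ (X × X)) : IsClosed (H.adjoint : Set (X × X)) := by
  have : (H.adjoint : Set (X × X)) =
      ⋂ z ∈ H, {x : X × X | ⟪z.2, x.1⟫_ℂ - ⟪z.1, x.2⟫_ℂ = 0} := by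
    ext x
    simp [Submodule.mem_adjoint_iff]
  rw [this]
  exact isClosed_biInter fun z _ => isClosed_eq (by fun_prop) continuous_const

variable {a b : ℝ} {n N : ℕ}

theorem isClosed_sobolevJets (a b : ℝ) (n k : ℕ) :
    IsClosed (sobolevJets a b n k : Set (Fin (k + 1) → L2 a b n)) := by
  have : (sobolevJets a b n k : Set (Fin (k + 1) → L2 a b n)) =
      ⋂ (j : Fin (k + 1)) (φ : Test a b n), {u | ⟪u j, testToL2 φ⟫_ℂ =
        (-1) ^ (j : ℕ) * ⟪u 0, testToL2 (testDeriv (j : ℕ) φ)⟫_ℂ} := by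
    ext u
    simp only [Set.mem_iInter]
    rfl
  rw [this]
  exact isClosed_iInter fun j => isClosed_iInter fun φ => isClosed_eq (by fun_prop) (by fun_prop)

theorem isWeakDeriv_testToL2 (hab : a ≤ b) (j : ℕ) (φ : Test a b n) :
    IsWeakDeriv j (testToL2 φ) (testToL2 (testDeriv j φ)) := by
  rw [isWeakDeriv_iff]
  induction j with
  | zero => rw [testDeriv_zero_apply, pow_zero, Module.End.one_apply]
  | succ j ih =>
    rw [pow_succ', Module.End.mul_apply, ih, distDeriv_toDist_testToL2 hab, ← testDeriv_add_apply,
      add_comm 1 j]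

theorem testJet_mem_sobolevJets (hab : a ≤ b) (k : ℕ) (φ : Test a b n) :
    testJet a b n k φ ∈ sobolevJets a b n k := by
  intro j
  have h0 : testJet a b n k φ 0 = testToL2 φ := congrArg testToL2 (testDeriv_zero_apply φ)
  rw [h0]
  exact isWeakDeriv_testToL2 hab j φ

/-- The operator `∑ C_k ∂^(2k)` as a function of the derivatives. -/
def jetOp (a b : ℝ) (C : Fin (N + 1) → Matrix (Fin n) (Fin n) ℂ) :
    (Fin (2 * N + 1) → L2 a b n) →L[ℂ] L2 a b n :=
  ∑ k : Fin (N + 1), matL2 a b (C k) ∘L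
    ContinuousLinearMap.proj (R := ℂ) (φ := fun _ : Fin (2 * N + 1) => L2 a b n)
      ⟨2 * k, by omega⟩

theorem column_eq_jetOp (P S : Fin (N + 1) → Matrix (Fin n) (Fin n) ℂ)
    {u : Fin (2 * N + 1) → L2 a b n} (hu : u ∈ sobolevJets a b n (2 * N))
    (h : u 0 ∈ colDomain (maxOp a b P) (maxOp a b S)) :
    column (maxOp a b P) (maxOp a b S) ⟨u 0, h⟩ = (jetOp a b P).prod (jetOp a b S) u := by
  have key : ∀ C : Fin (N + 1) → Matrix (Fin n) (Fin n) ℂ,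
      ∑ k ∈ Finset.range (N + 1), matL2 a b (coeff C k) (weakDeriv (2 * k) (u 0)) =
        jetOp a b C u := by
    intro C
    rw [Finset.sum_range, jetOp, _root_.sum_apply]
    refine Finset.sum_congr rfl fun k _ => ?_
    rw [coeff_fin, weakDeriv_eq (hu ⟨2 * k, by omega⟩)]
    rfl
  rw [column_of_mem_sobolevSpace P S ⟨u 0, h⟩ ⟨u, hu, rfl⟩, key, key]
  rfl

/-- On jets the column operator is bounded and everywhere defined, and the topology is that of
`H^(2N)`; statements about closures are transported there. -/
theorem map_column_eq_image (hab : a < b) (P S : Fin (N + 1) → Matrix (Fin n) (Fin n) ℂ)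
    {V : Submodule ℂ (Fin (2 * N + 1) → L2 a b n)} (hV : V ≤ sobolevJets a b n (2 * N)) :
    ((((V.map (LinearMap.proj 0)).comap (colDomain (maxOp a b P) (maxOp a b S)).subtype).map
      (column (maxOp a b P) (maxOp a b S)) : Submodule ℂ (L2 a b n × L2 a b n)) :
        Set (L2 a b n × L2 a b n)) = (jetOp a b P).prod (jetOp a b S) '' V := by
  ext z
  constructor
  · rintro ⟨⟨_, hx⟩, ⟨u, hu, rfl⟩, rfl⟩
    exact ⟨u, hu, (column_eq_jetOp P S (hV hu) hx).symm⟩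
  · rintro ⟨u, hu, rfl⟩
    have h : u 0 ∈ colDomain (maxOp a b P) (maxOp a b S) :=
      sobolevSpace_le_colDomain hab P S ⟨u, hV hu, rfl⟩
    exact ⟨⟨u 0, h⟩, ⟨u, hu, rfl⟩, column_eq_jetOp P S (hV hu) h⟩

theorem eq_zero_of_column_eq_zero {X : Type*} [NormedAddCommGroup X] [InnerProductSpace ℂ X]
    {P S : X →ₗ.[ℂ] X} (hcoer : IsCoerciveColumn P S) {x : colDomain P S}
    (hx : column P S x = 0) : x = 0 := by
  obtain ⟨c, hc, h⟩ := hcoer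
  have h1 := h x
  rw [columnNorm, hx] at h1
  simp only [Prod.fst_zero, Prod.snd_zero, norm_zero] at h1
  rw [show √((0 : ℝ) ^ 2 + 0 ^ 2) = 0 by simp] at h1
  exact Subtype.ext (norm_le_zero_iff.1 (nonpos_of_mul_nonpos_right h1 hc))

/-- `H` is the image of the jets of test functions, whose closure defines `H₀^(2N)`. The image of
all jets is `H*`, which is closed, and coercivity gives injectivity, so the closure can be taken
before applying the operator. -/
theorem topologicalClosure_kerRelation (hab : a < b)
    {P S : Fin (N + 1) → Matrix (Fin n) (Fin n) ℂ}
    (hcoer : IsCoerciveColumn (maxOp a b P) (maxOp a b S)) (hC : CoeffAssumption P S)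
    (hdom : colDomain (maxOp a b P) (maxOp a b S) = sobolevSpace a b n (2 * N)) :
    (kerRelation (minOp a b P) (minOp a b S)).topologicalClosure =
      ((sobolevSpaceZero a b n (2 * N)).comap
        (colDomain (maxOp a b P) (maxOp a b S)).subtype).map
          (column (maxOp a b P) (maxOp a b S)) := by
  have htest : LinearMap.range (testJet a b n (2 * N)) ≤ sobolevJets a b n (2 * N) := by
    rintro _ ⟨φ, rfl⟩
    exact testJet_mem_sobolevJets hab.le _ φ
  have hclos : (LinearMap.range (testJet a b n (2 * N))).topologicalClosure ≤
      sobolevJets a b n (2 * N) :=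
    Submodule.topologicalClosure_minimal _ htest (isClosed_sobolevJets a b n _)
  have hrange : (LinearMap.range (testJet a b n (2 * N))).map (LinearMap.proj 0) =
      LinearMap.range (testToL2 : Test a b n →ₗ[ℂ] L2 a b n) := by
    rw [← LinearMap.range_comp]
    refine congrArg _ (LinearMap.ext fun φ => ?_)
    exact congrArg testToL2 (testDeriv_zero_apply φ)
  have hran : (jetOp a b P).prod (jetOp a b S) '' sobolevJets a b n (2 * N) =
      ((kerRelation (minOp a b P) (minOp a b S)).adjoint : Set (L2 a b n × L2 a b n)) := by
    rw [adjoint_kerRelation_eq hab hcoer hC, ← map_column_eq_image hab P S le_rfl]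
    refine congrArg _ ?_
    rw [← sobolevSpace, ← hdom, Submodule.comap_subtype_self, Submodule.map_top]
    rfl
  refine SetLike.coe_injective ?_
  rw [Submodule.topologicalClosure_coe, kerRelation_eq_map hab hcoer hC, ← hrange,
    map_column_eq_image hab P S htest, sobolevSpaceZero, map_column_eq_image hab P S hclos,
    Submodule.topologicalClosure_coe]
  refine closure_image_of_injOn _ (isClosed_sobolevJets a b n (2 * N)) (fun u hu h0 => ?_)
    (hran ▸ isClosed_adjoint _) htest
  have hu0 : u 0 ∈ colDomain (maxOp a b P) (maxOp a b S) :=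
    sobolevSpace_le_colDomain hab P S ⟨u, hu, rfl⟩
  have h1 := eq_zero_of_column_eq_zero hcoer ((column_eq_jetOp P S hu hu0).trans h0)
  have h2 : u 0 = 0 := congrArg Subtype.val h1
  ext1 j
  have h3 := (isWeakDeriv_iff _ _ _).1 (hu j)
  rw [h2, map_zero, map_zero] at h3
  exact toDist_injective (by rw [← h3, Pi.zero_apply, map_zero])

end Closure

end RangeTriplet

end

/-! ### Assembly of the theorem. -/

open RangeTriplet in
theorem theorem3p8 {a b : ℝ} (hab : a < b) (n N : ℕ)
    (P S : Fin (N + 1) → Matrix (Fin n) (Fin n) ℂ)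
    (hcoer : IsCoerciveColumn (maxOp a b P) (maxOp a b S)) :
    StandingAssumption (minOp a b P) (minOp a b S) ∧
    (CoeffAssumption P S →
      kerRelation (minOp a b P) (minOp a b S) ≤
        (kerRelation (minOp a b P) (minOp a b S)).adjoint →
      (kerRelation (minOp a b P) (minOp a b S)).adjoint =
          ranColumn (maxOp a b P) (maxOp a b S) ∧
      sobolevSpace a b n (2 * N) ≤ colDomain (maxOp a b P) (maxOp a b S) ∧
      (∃ (U : Matrix (Fin (2 * N) × Fin n) (Fin (greenA P S).rank) ℂ)
          (d : Fin (greenA P S).rank → ℂ), IsReducedFactorization (greenA P S) U d) ∧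
      ∀ (U : Matrix (Fin (2 * N) × Fin n) (Fin (greenA P S).rank) ℂ)
          (d : Fin (greenA P S).rank → ℂ), IsReducedFactorization (greenA P S) U d →
        ∃ Γ : colDomain (maxOp a b P) (maxOp a b S) →ₗ[ℂ]
            EuclideanSpace ℂ (Fin (greenA P S).rank) × EuclideanSpace ℂ (Fin (greenA P S).rank),
          IsTraceExtension P S U d Γ ∧
          (∀ Γ', IsTraceExtension P S U d Γ' → Γ' = Γ) ∧
          IsBoundaryTriplet (maxOp a b P) (maxOp a b S) Γ) ∧
    (CoeffAssumption P S → (greenA P S).rank = 2 * N * n →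
      (kerRelation (minOp a b P) (minOp a b S)).adjoint =
          ranColumn (maxOp a b P) (maxOp a b S) ∧
      colDomain (maxOp a b P) (maxOp a b S) = sobolevSpace a b n (2 * N) ∧
      (∃ Γ : colDomain (maxOp a b P) (maxOp a b S) →ₗ[ℂ]
          EuclideanSpace ℂ (Fin (2 * N) × Fin n) × EuclideanSpace ℂ (Fin (2 * N) × Fin n),
        (∀ x, Γ x = boundaryPair (greenA P S) (trace (2 * N) (x : L2 a b n))) ∧
        IsBoundaryTriplet (maxOp a b P) (maxOp a b S) Γ) ∧
      (kerRelation (minOp a b P) (minOp a b S)).topologicalClosure =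
        ((sobolevSpaceZero a b n (2 * N)).comap
          (colDomain (maxOp a b P) (maxOp a b S)).subtype).map
            (column (maxOp a b P) (maxOp a b S))) := by

  refine ⟨⟨dense_minOp_domain P, dense_minOp_domain S, hcoer⟩, fun hC _ => ?_, fun hC hA => ?_⟩
  · refine ⟨adjoint_kerRelation_eq hab hcoer hC, sobolevSpace_le_colDomain hab P S,
      exists_isReducedFactorization (conjTranspose_greenA P S), fun U d hUd => ?_⟩
    have hD : IsUnit (Matrix.diagonal d).det := by
      rw [Matrix.det_diagonal, isUnit_iff_ne_zero]
      exact Finset.prod_ne_zero_iff.2 fun i _ => hUd.ne_zero i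
    obtain ⟨Γ, ⟨c, hc⟩, hΓ, htriplet⟩ :=
      exists_extension_boundaryMap hab hcoer hC hD hUd.orthonormal hUd.eq
    refine ⟨Γ, ⟨⟨c, hc⟩, hΓ⟩, fun Γ' hΓ' => ?_, htriplet⟩
    obtain ⟨c', hc'⟩ := hΓ'.bounded
    exact eq_of_bounded_of_eqOn_sobolevSpace hab hcoer hc' hc fun x hx =>
      (hΓ'.extends_trace x hx).trans (hΓ x hx).symm
  · have hdet : IsUnit (greenA P S).det := isUnit_det_of_rank_eq_card (by simpa using hA)
    have hdom := colDomain_eq_sobolevSpace hab hC hdet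
    refine ⟨adjoint_kerRelation_eq hab hcoer hC, hdom, ?_,
      topologicalClosure_kerRelation hab hcoer hC hdom⟩
    -- With full rank the trivial factorization `U = 1`, `D = A` is admissible, and no extension is
    -- needed since the domain is `H^(2N)`.
    obtain ⟨Γ, -, hΓ, htriplet⟩ :=
      exists_extension_boundaryMap hab hcoer hC hdet (U := 1) (by simp) (by simp)
    refine ⟨Γ, fun x => ?_, htriplet⟩
    rw [hΓ x (hdom ▸ x.2), boundaryMap, Matrix.conjTranspose_one, Matrix.fromBlocks_one,
      Matrix.one_mulVec]
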